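/- **Setting.** Let $(V,\|\cdot\|)$ be a separable real Banach space with the Radon–Nikodým property, $V^*$ its dual with norm $\|\cdot\|_*$, and $T>0$. Let $\Psi:V\to[0,\infty)$ be continuous, convex, strictly positive on $V\setminus\{0\}$ and positively $1$-homogeneous (not necessarily symmetric). Let $\Phi(v)=F(\|v\|)$ with $F\in C^1([0,\infty))$ convex, $F(r)>0$ for $r>0$, $F(0)=F'(0)=0$, $F'(r)\to\infty$ as $r\to\infty$. For $\varepsilon>0$ put $\Psi_\varepsilon(v)=\Psi(v)+\varepsilon^{-1}\Phi(\varepsilon v)$ and $\Psi_\varepsilon^*(\xi)=\sup_{v}(\langle\xi,v\rangle-\Psi_\varepsilon(v))$. Let $D\subset V$ and let $\mathcal E:[0,T]\times D\to\mathbb R$ be lower semicontinuous ($\mathcal E_t=+\infty$ off $D$), with Fréchet subdifferential $\partial\mathcal E_t(u)\subset V^*$, such that: * for every $E>0$ the set $D_E=\{u\in D:\Psi(u)+\sup_{t\in[0,T]}\mathcal E_t(u)\le E\}$ is compact; * for every $u\in D$, $t\mapsto\mathcal E_t(u)$ is differentiable on $[0,T]$, and there is $C_P\ge0$ such that for all $(t,u)\in(0,T)\times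 D$ and $E>0$: $|\partial_t\mathcal E_t(u)|\le C_P(\Psi(u)+\mathcal E_t(u))$ and $\limsup_{w\to u,\,w\in D_E}\partial_t\mathcal E_t(w)\le\partial_t\mathcal E_t(u)$; * for every $E>0$ there is an upper semicontinuous $\omega^E:[0,T]\times D_E\times D_E\to\mathbb R$ with $\omega^E_t(u,u)=0$ and $\mathcal E_t(v)\ge\mathcal E_t(u)+\langle\xi,v-u\rangle-\omega^E_t(u,v)\min\{\Psi(v-u),\Psi(u-v)\}$ for all $t\in[0,T]$, $u,v\in D_E$, $\xi\in\partial\mathcal E_t(u)$. A curve $u:[a,b]\to V$ is $\Psi$-absolutely continuous if there is a nonnegative $m\in L^1(a,b)$ with $\Psi(u(r)-u(s))\le\int_s^r m$ for $a\le s\le r\le b$; then its metric derivative $\Psi[u'](r)=\lim_{h\to0}\Psi\big((u(r+h)-u(r))/h\big)$ exists a.e. $AC([a,b];V)$ denotes absolutely continuous curves with respect to $\|\cdot\|$. Let $K^*=\{z\in V^*:\langle z,w\rangle\le\Psi(w)\ \forall w\in V\}$, $$\mathfrak p(v,\xi)=\inf_{\varepsilon>0}\big(\Psi_\varepsilon(v)+\Psi_\varepsilon^*(\xi)\big),\quad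 \mathfrak f_t(u,v)=\inf\{\mathfrak p(v,\xi):\xi\in-\partial\mathcal E_t(u)\}\ (v\ne0),\quad \mathfrak f_t(u,0)=0,$$ $$\mathfrak e_t(u)=\inf\{\|\xi-z\|_*:\xi\in-\partial\mathcal E_t(u),\ z\in K^*\},\qquad \inf\emptyset=+\infty .$$ For $t\in[0,T]$ and $u_0,u_1\in D$ let $\mathcal T_t(u_0,u_1)$ be the set of admissible transitions: curves $\vartheta:[0,1]\to V$ with $\vartheta(0)=u_0$, $\vartheta(1)=u_1$, with values in some $D_{E'}$, $\Psi$-absolutely continuous, and locally absolutely continuous with respect to $\|\cdot\|$ on $G_t[\vartheta]=\{r\in[0,1]:\mathfrak e_t(\vartheta(r))>0\}$. Put $\mathfrak f_t[\vartheta,\vartheta'](r)=\mathfrak f_t(\vartheta(r),\dot\vartheta(r))$ if $r\in G_t[\vartheta]$ and $\mathfrak f_t[\vartheta,\vartheta'](r)=\Psi[\vartheta'](r)$ otherwise, and $$\Delta_{\mathfrak f_t}(u_0,u_1)=\inf_{\vartheta\in\mathcal T_t(u_0,u_1)}\int_0^1\mathfrak f_t[\vartheta,\vartheta'](r)\,dr\in[0,\infty].$$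 **Theorem.** Let $t\in[0,T]$, $E>0$ and $u_-,u_+\in D_E$. **(F1)** If $\Delta_{\mathfrak f_t}(u_-,u_+)<\infty$, the infimum is attained by some $\vartheta\in\mathcal T_t(u_-,u_+)$. Moreover $$\Delta_{\mathfrak f_t}(u_-,u_+)\ \ge\ \mathcal E_t(u_-)-\mathcal E_t(u_+),$$ and, if $\Psi$ is symmetric ($\Psi(-v)=\Psi(v)$ for all $v$), $\Delta_{\mathfrak f_t}(u_-,u_+)\ge|\mathcal E_t(u_-)-\mathcal E_t(u_+)|$. **(F2)** If $u_{0,n},u_{1,n}\in D_E$, $u_{0,n}\to u_-$ and $u_{1,n}\to u_+$ strongly in $V$, then $\liminf_n\Delta_{\mathfrak f_t}(u_{0,n},u_{1,n})\ge\Delta_{\mathfrak f_t}(u_-,u_+)$. **(F3)** Let $[\alpha_n,\beta_n]\subset[0,T]$, $u_n\in AC([\alpha_n,\beta_n];V)$, $\tilde u_n:[\alpha_n,\beta_n]\to D_E$ measurable, $\xi_n\in L^1(\alpha_n,\beta_n;V^*)$, and $\varepsilon_n>0$ with $\varepsilon_n\to0$, be such that $\sup_{r\in[\alpha_n,\beta_n]}\|\tilde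 u_n(r)-u_n(r)\|\to0$, $\xi_n(r)\in-\partial\mathcal E_r(\tilde u_n(r))$ for a.a. $r\in(\alpha_n,\beta_n)$, $u_n(\alpha_n)\to u_-$, $u_n(\beta_n)\to u_+$, $\alpha_n\to t$ and $\beta_n\to t$. If $$\Delta:=\lim_{n\to\infty}\int_{\alpha_n}^{\beta_n}\big(\Psi_{\varepsilon_n}(\dot u_n)+\Psi^*_{\varepsilon_n}(\xi_n)\big)\,dr$$ exists and is finite, then there are a strictly increasing sequence of indices $(n_k)_k$, absolutely continuous surjective rescalings $\mathsf t_{n_k}:[0,1]\to[\alpha_{n_k},\beta_{n_k}]$, nondecreasing and strictly increasing whenever $\alpha_{n_k}<\beta_{n_k}$, and an admissible transition $\vartheta\in\mathcal T_t(u_-,u_+)$ such that $u_{n_k}\circ\mathsf t_{n_k}\to\vartheta$ strongly in $V$, uniformly on $[0,1]$, and $\int_0^1\mathfrak f_t[\vartheta,\vartheta'](r)\,dr\le\Delta$. Moreover, whether or not this limit exists or is finite, $$\liminf_{n\to\infty}\int_{\alpha_n}^{\beta_n}\big(\Psi_{\varepsilon_n}(\dot u_n)+\Psi^*_{\varepsilon_n}(\xi_n)\big)\,dr\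 \ge\ \Delta_{\mathfrak f_t}(u_-,u_+).$$ -/

import Mathlib

open Set Filter Topology MeasureTheory
open scoped ENNReal

noncomputable section

/-- A curve `u : [a,b] → V` is `Ψ`-absolutely continuous: there is a nonnegative `m ∈ L¹(a,b)` with
`Ψ (u t - u s) ≤ ∫ₛᵗ m` for all `a ≤ s ≤ t ≤ b`. Only the values of `u` on `[a,b]` matter.
For `Ψ = ‖·‖` this is ordinary (norm) absolute continuity. -/
def GaugeAC {V : Type*} [AddCommGroup V] (Ψ : V → ℝ) (u : ℝ → V) (a b : ℝ) : Prop :=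
  ∃ m : ℝ → ℝ, (∀ r, 0 ≤ m r) ∧ IntegrableOn m (Icc a b) ∧
    ∀ s t : ℝ, a ≤ s → s ≤ t → t ≤ b → Ψ (u t - u s) ≤ ∫ r in s..t, m r

/-- Absolutely continuous curves with values in the normed space `V`: the class `AC([a,b];V)`. -/
def NormAC {V : Type*} [NormedAddCommGroup V] (u : ℝ → V) (a b : ℝ) : Prop :=
  GaugeAC (fun v : V => ‖v‖) u a b

/-- The class `AC_loc(G;V)`: norm absolute continuity on each compact interval contained in `G`. -/
def NormACLoc {V : Type*} [NormedAddCommGroup V] (u : ℝ → V) (G : Set ℝ) : Prop :=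
  ∀ a b : ℝ, a ≤ b → Icc a b ⊆ G → NormAC u a b

/-- The Radon–Nikodým property: absolutely continuous curves with values in `V` are almost
everywhere differentiable. -/
def RadonNikodymProperty (V : Type*) [NormedAddCommGroup V] [NormedSpace ℝ V] : Prop :=
  ∀ (u : ℝ → V) (a b : ℝ), NormAC u a b →
    ∀ᵐ r ∂(volume.restrict (Ioo a b)), DifferentiableAt ℝ u r

/-- The `Ψ`-metric derivative `lim_{h → 0} Ψ ((u (t + h) - u t) / h)`, as a `limsup`, which is
the limit wherever the limit exists (almost everywhere for a `Ψ`-absolutely continuous curve). -/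
def metricDeriv {V : Type*} [AddCommGroup V] [Module ℝ V] (Ψ : V → ℝ) (u : ℝ → V) (t : ℝ) :
    ℝ≥0∞ :=
  limsup (fun h : ℝ => ENNReal.ofReal (Ψ (h⁻¹ • (u (t + h) - u t)))) (𝓝[≠] (0 : ℝ))

/-- The data of a rate-independent system with viscous regularisation: a final time `T`, a
rate-independent potential `Ψ`, the profile `F` of the viscous potential `Φ v = F ‖v‖`, the energy
domain `D` and the energy `E : [0,T] × D → ℝ` (thought of as `+∞` outside `D`; the values of `E`
outside `[0,T] × D` are never used). -/
structure RISystem (V : Type*) where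
  T : ℝ
  Ψ : V → ℝ
  F : ℝ → ℝ
  D : Set V
  E : ℝ → V → ℝ

namespace RISystem

variable {V : Type*} [NormedAddCommGroup V] [NormedSpace ℝ V] (S : RISystem V)

/-- The sublevel `D_e = {u ∈ D : Ψ u + sup_{t ∈ [0,T]} E_t u ≤ e}`. -/
def sublevel (e : ℝ) : Set V :=
  {u | u ∈ S.D ∧ ∀ t ∈ Icc (0 : ℝ) S.T, S.Ψ u + S.E t u ≤ e}

/-- The power `∂ₜ E_t u` (one-sided derivative at `t = 0` and `t = T`). -/
def power (t : ℝ) (u : V) : ℝ := derivWithin (fun s => S.E s u) (Icc (0 : ℝ) S.T) t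

/-- The Fréchet subdifferential of `E_t` at `u ∈ D`:
`E_t v - E_t u - ⟨ξ, v - u⟩ ≥ o(‖v - u‖)` as `v → u`; points `v ∉ D` impose no condition since
`E_t v = +∞` there. -/
def subdiff (t : ℝ) (u : V) : Set (V →L[ℝ] ℝ) :=
  {ξ | u ∈ S.D ∧ ∀ δ : ℝ, 0 < δ →
    ∀ᶠ v in 𝓝[S.D] u, -(δ * ‖v - u‖) ≤ S.E t v - S.E t u - ξ (v - u)}

/-- The stable set `K* = {ξ ∈ V* : ⟨ξ, w⟩ ≤ Ψ w for all w}`. -/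
def stableSet : Set (V →L[ℝ] ℝ) := {ξ | ∀ w : V, ξ w ≤ S.Ψ w}

/-- The viscous potentials `Ψ_ε v = Ψ v + ε⁻¹ Φ (ε v)` with `Φ v = F ‖v‖`. -/
def viscous (ε : ℝ) (v : V) : ℝ := S.Ψ v + ε⁻¹ * S.F ‖ε • v‖

/-- The conjugate `Ψ_ε* ξ = sup_v (⟨ξ, v⟩ - Ψ_ε v)`. Since `v = 0` competes with the value `0`, the
supremum is nonnegative, and truncating the competitors at `0` does not change it. -/
def viscousConj (ε : ℝ) (ξ : V →L[ℝ] ℝ) : ℝ≥0∞ :=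
  ⨆ v : V, ENNReal.ofReal (ξ v - S.viscous ε v)

/-- The vanishing-viscosity contact potential `𝔭(v, ξ) = inf_{ε > 0} (Ψ_ε v + Ψ_ε* ξ)`. -/
def contactPotential (v : V) (ξ : V →L[ℝ] ℝ) : ℝ≥0∞ :=
  ⨅ (ε : ℝ) (_ : 0 < ε), ENNReal.ofReal (S.viscous ε v) + S.viscousConj ε ξ

/-- `𝔢_t(u) = inf {‖ξ - z‖_* : ξ ∈ -∂E_t(u), z ∈ K*}`, equal to `∞` if `∂E_t(u)` is empty. -/
def instability (t : ℝ) (u : V) : ℝ≥0∞ :=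
  ⨅ (ξ : V →L[ℝ] ℝ) (_ : -ξ ∈ S.subdiff t u) (z : V →L[ℝ] ℝ) (_ : z ∈ S.stableSet),
    ENNReal.ofReal ‖ξ - z‖

open Classical in
/-- The Finsler dissipation functional `𝔣_t(u; v) = inf {𝔭(v, ξ) : ξ ∈ -∂E_t(u)}`, with
`inf ∅ = ∞` for `v ≠ 0` and `𝔣_t(u; 0) = 0`. This is `Ψ v + 𝔢_t(u) ‖v‖` with the convention
`∞ · 0 = 0`; the case `v = 0` is separated only because of that convention. -/
def finsler (t : ℝ) (u v : V) : ℝ≥0∞ :=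
  if v = 0 then 0
  else ⨅ (ξ : V →L[ℝ] ℝ) (_ : -ξ ∈ S.subdiff t u), S.contactPotential v ξ

/-- The set `G_t[ϑ] = {r ∈ [0,1] : 𝔢_t(ϑ r) > 0}`. -/
def unstableTimes (t : ℝ) (ϑ : ℝ → V) : Set ℝ :=
  {r | r ∈ Icc (0 : ℝ) 1 ∧ 0 < S.instability t (ϑ r)}

/-- The class `𝒯_t(u₀, u₁)` of admissible transition curves `ϑ : [0,1] → V` from `u₀` to `u₁`:
`ϑ ∈ AC([0,1]; D_e, Ψ)` for some `e > 0` and `ϑ ∈ AC_loc(G_t[ϑ]; V)`. -/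
structure IsTransition (t : ℝ) (u₀ u₁ : V) (ϑ : ℝ → V) : Prop where
  exists_sublevel : ∃ e : ℝ, 0 < e ∧ ∀ r ∈ Icc (0 : ℝ) 1, ϑ r ∈ S.sublevel e
  gaugeAC : GaugeAC S.Ψ ϑ 0 1
  normACLoc : NormACLoc ϑ (S.unstableTimes t ϑ)
  left_end : ϑ 0 = u₀
  right_end : ϑ 1 = u₁

open Classical in
/-- The density `𝔣_t[ϑ; ϑ'](r)`: it is `𝔣_t(ϑ r; ϑ' r)` for `r ∈ G_t[ϑ]`, and the `Ψ`-metric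
derivative of `ϑ` at `r` otherwise. -/
def costDensity (t : ℝ) (ϑ : ℝ → V) (r : ℝ) : ℝ≥0∞ :=
  if r ∈ S.unstableTimes t ϑ then S.finsler t (ϑ r) (deriv ϑ r) else metricDeriv S.Ψ ϑ r

/-- `∫₀¹ 𝔣_t[ϑ; ϑ'](r) dr`. -/
def curveCost (t : ℝ) (ϑ : ℝ → V) : ℝ≥0∞ :=
  ∫⁻ r in Ioo (0 : ℝ) 1, S.costDensity t ϑ r

/-- The Finsler dissipation cost `Δ_{𝔣_t}(u₀, u₁)`, equal to `∞` if there is no transition. -/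
def cost (t : ℝ) (u₀ u₁ : V) : ℝ≥0∞ :=
  ⨅ (ϑ : ℝ → V) (_ : S.IsTransition t u₀ u₁ ϑ), S.curveCost t ϑ

/-- The viscous dissipation `∫_α^β (Ψ_ε(u') + Ψ_ε*(ξ)) dr`. -/
def viscousDissipation (ε α β : ℝ) (u : ℝ → V) (ξ : ℝ → V →L[ℝ] ℝ) : ℝ≥0∞ :=
  ∫⁻ r in Ioo α β, (ENNReal.ofReal (S.viscous ε (deriv u r)) + S.viscousConj ε (ξ r))

/-- The standing assumptions on the dissipation potentials and on the energy. -/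
structure Standing : Prop where
  T_pos : 0 < S.T
  -- the rate-independent potential: continuous, convex, positive off `0`, positively 1-homogeneous
  psi_continuous : Continuous S.Ψ
  psi_convex : ConvexOn ℝ univ S.Ψ
  psi_nonneg : ∀ v, 0 ≤ S.Ψ v
  psi_pos : ∀ v, v ≠ 0 → 0 < S.Ψ v
  psi_homogeneous : ∀ (c : ℝ) (v : V), 0 ≤ c → S.Ψ (c • v) = c * S.Ψ v
  -- the profile of the viscous potential
  F_contDiff : ContDiffOn ℝ 1 S.F (Ici 0)
  F_convex : ConvexOn ℝ (Ici 0) S.F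
  F_pos : ∀ r, 0 < r → 0 < S.F r
  F_zero : S.F 0 = 0
  F_deriv_zero : derivWithin S.F (Ici 0) 0 = 0
  F_deriv_tendsto : Tendsto (derivWithin S.F (Ici 0)) atTop atTop
  -- lower semicontinuity of the energy
  E_lsc : LowerSemicontinuousOn (fun p : ℝ × V => S.E p.1 p.2) (Icc (0 : ℝ) S.T ×ˢ S.D)
  -- coercivity
  E_coercive : ∀ e : ℝ, 0 < e → IsCompact (S.sublevel e)
  -- power control
  E_differentiable : ∀ u ∈ S.D, DifferentiableOn ℝ (fun s => S.E s u) (Icc (0 : ℝ) S.T)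
  power_bound : ∃ C : ℝ, 0 ≤ C ∧
    ∀ t ∈ Ioo (0 : ℝ) S.T, ∀ u ∈ S.D, |S.power t u| ≤ C * (S.Ψ u + S.E t u)
  power_usc : ∀ t ∈ Ioo (0 : ℝ) S.T, ∀ u ∈ S.D, ∀ e : ℝ, 0 < e →
    UpperSemicontinuousWithinAt (S.power t) (S.sublevel e) u
  -- uniform subdifferentiability
  E_subdiff : ∀ e : ℝ, 0 < e → ∃ ω : ℝ × V × V → ℝ,
    UpperSemicontinuousOn ω (Icc (0 : ℝ) S.T ×ˢ S.sublevel e ×ˢ S.sublevel e) ∧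
    (∀ t ∈ Icc (0 : ℝ) S.T, ∀ u ∈ S.sublevel e, ω (t, u, u) = 0) ∧
    ∀ t ∈ Icc (0 : ℝ) S.T, ∀ u ∈ S.sublevel e, ∀ v ∈ S.sublevel e, ∀ ξ ∈ S.subdiff t u,
      S.E t u + ξ (v - u) - ω (t, u, v) * min (S.Ψ (v - u)) (S.Ψ (-(v - u))) ≤ S.E t v

/-- Viscous-type sequences concentrating at the time `t` and connecting `u₀` to `u₁` in the limit:
`[α n, β n] ⊆ [0,T]` shrinks to `t`, `u n ∈ AC([α n, β n]; V)`, `w n` is a measurable curve in `D_e`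
uniformly close to `u n`, `ξ n ∈ L¹(α n, β n; V*)` is a selection of `-∂E_r(w n r)`, and `ε n ↓ 0`. -/
structure IsConcentrating (e t : ℝ) (u₀ u₁ : V) (α β : ℕ → ℝ) (u w : ℕ → ℝ → V)
    (ξ : ℕ → ℝ → V →L[ℝ] ℝ) (ε : ℕ → ℝ) : Prop where
  interval : ∀ n, 0 ≤ α n ∧ α n ≤ β n ∧ β n ≤ S.T
  u_ac : ∀ n, NormAC (u n) (α n) (β n)
  w_mem : ∀ n, ∀ r ∈ Icc (α n) (β n), w n r ∈ S.sublevel e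
  w_meas : ∀ n, AEStronglyMeasurable (w n) (volume.restrict (Icc (α n) (β n)))
  xi_integrable : ∀ n, IntegrableOn (ξ n) (Ioo (α n) (β n))
  eps_pos : ∀ n, 0 < ε n
  eps_tendsto : Tendsto ε atTop (𝓝 0)
  close : ∀ δ : ℝ, 0 < δ → ∀ᶠ n in atTop, ∀ r ∈ Icc (α n) (β n), ‖w n r - u n r‖ ≤ δ
  xi_mem : ∀ n, ∀ᵐ r ∂(volume.restrict (Ioo (α n) (β n))), -(ξ n r) ∈ S.subdiff r (w n r)
  u_left : Tendsto (fun n => u n (α n)) atTop (𝓝 u₀)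
  u_right : Tendsto (fun n => u n (β n)) atTop (𝓝 u₁)
  alpha_tendsto : Tendsto α atTop (𝓝 t)
  beta_tendsto : Tendsto β atTop (𝓝 t)

end RISystem

end

/-!
The contact potential satisfies `𝔭 (v, ξ) = Ψ v + dist (ξ, K*) ‖v‖`, so the cost of a transition is
`∫ Ψ ϑ' + 𝔢_t(ϑ) ‖ϑ'‖`. A bound on this cost by a primitive `A` can be written without derivatives:
`Ψ (ϑ q - ϑ p) + c ‖ϑ q - ϑ p‖ ≤ A q - A p` on every interval on which `𝔢_t ∘ ϑ ≥ c`. In this form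
it survives reparametrization and, `𝔢` being lower semicontinuous, uniform limits.

Uniform subdifferentiability yields the energy chain rule along admissible curves. It bounds the
cost from below by the energy release and keeps all curves of bounded cost in one compact energy
sublevel. Rescaling by a multiple of time plus accumulated cost makes such curves uniformly
`Ψ`-Lipschitz, so Ascoli provides a uniform limit, which inherits the derivative-free bound; the
Radon–Nikodým property recovers its derivative on the unstable set. Since viscous dissipation
dominates `Ψ + 𝔢 ‖·‖`, the same argument applies to minimizing sequences, to converging endpoints
and to the viscous approximations.
-/

/-- Nonnegative, subadditive and positively homogeneous functions (asymmetric seminorms): the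
properties shared by the potential `Ψ`, the norm and the sums `Ψ + c ‖·‖`. -/
structure IsGauge {V : Type*} [AddCommGroup V] [Module ℝ V] (N : V → ℝ) : Prop where
  nonneg : ∀ v, 0 ≤ N v
  add_le : ∀ v w, N (v + w) ≤ N v + N w
  smul_eq : ∀ (c : ℝ) (v : V), 0 ≤ c → N (c • v) = c * N v

namespace IsGauge

section Algebra

variable {V : Type*} [AddCommGroup V] [Module ℝ V] {N N₁ N₂ : V → ℝ}

lemma map_zero (hN : IsGauge N) : N 0 = 0 := by
  simpa using hN.smul_eq 0 0 le_rfl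

lemma sub_le (hN : IsGauge N) (u v w : V) : N (u - w) ≤ N (u - v) + N (v - w) := by
  simpa using hN.add_le (u - v) (v - w)

lemma add (h₁ : IsGauge N₁) (h₂ : IsGauge N₂) : IsGauge (fun v => N₁ v + N₂ v) where
  nonneg v := add_nonneg (h₁.nonneg v) (h₂.nonneg v)
  add_le v w := by linarith [h₁.add_le v w, h₂.add_le v w]
  smul_eq c v hc := by rw [h₁.smul_eq c v hc, h₂.smul_eq c v hc, mul_add]

/-- Apply the Hahn–Banach theorem on `V × V` to `(v, v) ↦ f v`, which lies below
`(v, w) ↦ N₁ v + N₂ w` on the diagonal. -/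
lemma exists_add_eq_of_le_add (h₁ : IsGauge N₁) (h₂ : IsGauge N₂) (f : V →ₗ[ℝ] ℝ)
    (hf : ∀ v, f v ≤ N₁ v + N₂ v) :
    ∃ f₁ f₂ : V →ₗ[ℝ] ℝ, f₁ + f₂ = f ∧ (∀ v, f₁ v ≤ N₁ v) ∧ ∀ v, f₂ v ≤ N₂ v := by
  let diagonal : V →ₗ[ℝ] V × V := LinearMap.prod LinearMap.id LinearMap.id
  let onDiagonal : V × V →ₗ.[ℝ] ℝ :=
    ⟨LinearMap.range diagonal,
      f.comp ((LinearMap.fst ℝ V V).comp (LinearMap.range diagonal).subtype)⟩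
  obtain ⟨g, hg, hgN⟩ := exists_extension_of_le_sublinear onDiagonal
    (fun p => N₁ p.1 + N₂ p.2)
    (fun c hc p => by
      rw [Prod.smul_fst, Prod.smul_snd, h₁.smul_eq c _ hc.le, h₂.smul_eq c _ hc.le, mul_add])
    (fun p q => by
      rw [Prod.fst_add, Prod.snd_add]
      linarith [h₁.add_le p.1 q.1, h₂.add_le p.2 q.2])
    (by rintro ⟨_, ⟨v, rfl⟩⟩; exact hf v)
  refine ⟨g.comp (LinearMap.inl ℝ V V), g.comp (LinearMap.inr ℝ V V), ?_, fun v => ?_, fun v => ?_⟩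
  · ext v
    have hdiag : g (v, v) = f v := hg ⟨(v, v), ⟨v, rfl⟩⟩
    rw [← hdiag, LinearMap.add_apply, LinearMap.comp_apply, LinearMap.comp_apply, ← _root_.map_add]
    simp
  · simpa [h₂.map_zero] using hgN (v, 0)
  · simpa [h₁.map_zero] using hgN (0, v)

end Algebra

section Normed

variable {V : Type*} [NormedAddCommGroup V] [NormedSpace ℝ V] {N : V → ℝ}

lemma mul_norm {c : ℝ} (hc : 0 ≤ c) : IsGauge (fun v : V => c * ‖v‖) where
  nonneg v := by positivity
  add_le v w := by rw [← mul_add]; exact mul_le_mul_of_nonneg_left (norm_add_le v w) hc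
  smul_eq a v ha := by rw [norm_smul, Real.norm_of_nonneg ha, mul_left_comm]

lemma add_mul_norm (hN : IsGauge N) {c : ℝ} (hc : 0 ≤ c) : IsGauge (fun v => N v + c * ‖v‖) :=
  hN.add (mul_norm hc)

lemma exists_le_mul_norm (hN : IsGauge N) (hcont : Continuous N) :
    ∃ L : ℝ, 0 < L ∧ ∀ v, N v ≤ L * ‖v‖ := by
  have hnear : ∀ᶠ v in 𝓝 (0 : V), N v < 1 :=
    hcont.continuousAt.eventually_lt_const (by rw [hN.map_zero]; exact one_pos)
  obtain ⟨δ, hδ, h⟩ := Metric.eventually_nhds_iff.1 hnear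
  refine ⟨2 / δ, by positivity, fun v => ?_⟩
  rcases eq_or_ne v 0 with rfl | hv
  · simp [hN.map_zero]
  have hlt := h (y := (δ / (2 * ‖v‖)) • v) (by
    rw [dist_zero_right, norm_smul, Real.norm_of_nonneg (by positivity)]
    field_simp; norm_num)
  rw [hN.smul_eq _ _ (by positivity), div_mul_eq_mul_div, div_lt_one (by positivity)] at hlt
  rw [div_mul_eq_mul_div, le_div_iff₀ hδ]
  linarith

lemma exists_sub_gauge_norm_le (hN : IsGauge N) {c : ℝ} (hc : 0 ≤ c) (hcont : Continuous N)
    (ξ : V →L[ℝ] ℝ) (hξ : ∀ v, ξ v ≤ N v + c * ‖v‖) :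
    ∃ z : V →L[ℝ] ℝ, (∀ v, z v ≤ N v) ∧ ∀ v, (ξ - z) v ≤ c * ‖v‖ := by
  obtain ⟨f₁, f₂, hsum, hf₁, hf₂⟩ :=
    hN.exists_add_eq_of_le_add (mul_norm hc) (ξ : V →ₗ[ℝ] ℝ) hξ
  have hf₁' : f₁ = (ξ : V →ₗ[ℝ] ℝ) - f₂ := eq_sub_of_add_eq hsum
  obtain ⟨L, -, hL⟩ := hN.exists_le_mul_norm hcont
  have hbound : ∀ v, ‖f₁ v‖ ≤ L * ‖v‖ := fun v => by
    have hpos := (hf₁ v).trans (hL v)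
    have hneg := (hf₁ (-v)).trans (hL (-v))
    rw [_root_.map_neg, norm_neg] at hneg
    exact abs_le.2 ⟨by linarith, hpos⟩
  refine ⟨f₁.mkContinuous L hbound, hf₁, fun v => ?_⟩
  simpa [hf₁'] using hf₂ v

end Normed

end IsGauge

section Functionals

variable {V : Type*} [NormedAddCommGroup V] [NormedSpace ℝ V]

lemma opNorm_le_of_apply_le {ξ : V →L[ℝ] ℝ} {c : ℝ} (hc : 0 ≤ c) (h : ∀ v, ξ v ≤ c * ‖v‖) :
    ‖ξ‖ ≤ c := by
  refine ξ.opNorm_le_bound hc fun v => abs_le.2 ⟨?_, h v⟩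
  have hneg := h (-v)
  rw [map_neg, norm_neg] at hneg
  linarith

lemma tendsto_apply_of_forall_norm_le {ι : Type*} {l : Filter ι} {ξ : ι → V →L[ℝ] ℝ}
    {ξ₀ : V →L[ℝ] ℝ} {x : ι → V} {x₀ : V} {C : ℝ} (hC : ∀ i, ‖ξ i‖ ≤ C)
    (hξ : ∀ v, Tendsto (fun i => ξ i v) l (𝓝 (ξ₀ v))) (hx : Tendsto x l (𝓝 x₀)) :
    Tendsto (fun i => ξ i (x i)) l (𝓝 (ξ₀ x₀)) := by
  have hsmall : Tendsto (fun i => ξ i (x i - x₀)) l (𝓝 0) := by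
    refine squeeze_zero_norm (fun i => (ξ i).le_of_opNorm_le (hC i) _) ?_
    simpa using (tendsto_iff_norm_sub_tendsto_zero.1 hx).const_mul C
  simpa [map_sub] using hsmall.add (hξ x₀)

end Functionals

namespace RISystem

variable {V : Type*} [NormedAddCommGroup V] [NormedSpace ℝ V] {S : RISystem V}

/-- The distance `inf {‖ξ - z‖ : z ∈ K*}` of a force `ξ` to the stable set; its infimum over the
forces in `-∂E_t(u)` is `𝔢_t(u)`. -/
noncomputable def stableDist (S : RISystem V) (ξ : V →L[ℝ] ℝ) : ℝ≥0∞ :=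
  ⨅ (z : V →L[ℝ] ℝ) (_ : z ∈ S.stableSet), ENNReal.ofReal ‖ξ - z‖

lemma instability_eq_iInf_stableDist (t : ℝ) (u : V) :
    S.instability t u = ⨅ (ξ : V →L[ℝ] ℝ) (_ : -ξ ∈ S.subdiff t u), S.stableDist ξ := rfl

namespace Standing

lemma isGauge (hS : S.Standing) : IsGauge S.Ψ where
  nonneg := hS.psi_nonneg
  add_le v w := by
    have h := hS.psi_convex.2 (mem_univ v) (mem_univ w)
      (by norm_num : (0 : ℝ) ≤ 1 / 2) (by norm_num : (0 : ℝ) ≤ 1 / 2) (by norm_num)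
    rw [← smul_add, hS.psi_homogeneous _ _ (by norm_num)] at h
    simp only [smul_eq_mul] at h
    linarith
  smul_eq := hS.psi_homogeneous

lemma stableDist_le_ofReal_iff (hS : S.Standing) {ξ : V →L[ℝ] ℝ} {c : ℝ} (hc : 0 ≤ c) :
    S.stableDist ξ ≤ ENNReal.ofReal c ↔ ∀ v, ξ v ≤ S.Ψ v + c * ‖v‖ := by
  refine ⟨fun h v => ?_, fun h => ?_⟩
  · have happrox : ∀ c' ∈ Ioi c, ξ v ≤ S.Ψ v + c' * ‖v‖ := fun c' hc' => by
      have hlt : S.stableDist ξ < ENNReal.ofReal c' :=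
        h.trans_lt ((ENNReal.ofReal_lt_ofReal_iff (hc.trans_lt hc')).2 hc')
      simp only [stableDist, iInf_lt_iff] at hlt
      obtain ⟨z, hz, hzc⟩ := hlt
      have hle : ξ v - z v ≤ ‖ξ - z‖ * ‖v‖ := (le_abs_self _).trans ((ξ - z).le_opNorm v)
      have hnorm := mul_le_mul_of_nonneg_right
        ((ENNReal.ofReal_lt_ofReal_iff (hc.trans_lt hc')).1 hzc).le (norm_nonneg v)
      linarith [hz v]
    have hcont : Tendsto (fun c' => S.Ψ v + c' * ‖v‖) (𝓝[>] c) (𝓝 (S.Ψ v + c * ‖v‖)) :=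
      (Continuous.tendsto (by fun_prop) c).mono_left nhdsWithin_le_nhds
    exact ge_of_tendsto hcont (eventually_mem_nhdsWithin.mono happrox)
  · obtain ⟨z, hz, hzc⟩ := hS.isGauge.exists_sub_gauge_norm_le hc hS.psi_continuous ξ h
    exact iInf₂_le_of_le z hz (ENNReal.ofReal_le_ofReal (opNorm_le_of_apply_le hc hzc))

lemma stableDist_lt_top (hS : S.Standing) (ξ : V →L[ℝ] ℝ) : S.stableDist ξ < ⊤ :=
  (iInf₂_le_of_le 0 (fun w => hS.psi_nonneg w) le_rfl).trans_lt ENNReal.ofReal_lt_top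

lemma add_derivWithin_F_mul_le (hS : S.Standing) {r l : ℝ} (hr : 0 ≤ r) (hl : 0 ≤ l) :
    S.F r + derivWithin S.F (Ici 0) r * (l - r) ≤ S.F l := by
  have hd : DifferentiableWithinAt ℝ S.F (Ici 0) r :=
    (hS.F_contDiff.differentiableOn (by norm_num)) r hr
  rcases lt_trichotomy l r with h | rfl | h
  · have := hS.F_convex.slope_le_derivWithin hl hr h hd
    rw [slope_def_field, div_le_iff₀ (by linarith)] at this
    linarith
  · simp
  · have := hS.F_convex.derivWithin_le_slope hr hl h hd
    rw [slope_def_field, le_div_iff₀ (by linarith)] at this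
    linarith

lemma exists_derivWithin_F_eq (hS : S.Standing) {c : ℝ} (hc : 0 < c) :
    ∃ r, 0 < r ∧ derivWithin S.F (Ici 0) r = c := by
  obtain ⟨R, hR, hR0⟩ := ((hS.F_deriv_tendsto.eventually_ge_atTop c).and
    (eventually_ge_atTop 0)).exists
  have hcont : ContinuousOn (derivWithin S.F (Ici 0)) (Icc 0 R) :=
    (hS.F_contDiff.continuousOn_derivWithin (uniqueDiffOn_Ici 0) le_rfl).mono Icc_subset_Ici_self
  obtain ⟨r, hr, rfl⟩ := intermediate_value_Icc hR0 hcont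
    (⟨by rw [hS.F_deriv_zero]; exact hc.le, hR⟩ : c ∈ Icc _ _)
  refine ⟨r, hr.1.lt_of_ne fun h => hc.ne ?_, rfl⟩
  rw [← h, hS.F_deriv_zero]

lemma psi_le_viscous (hS : S.Standing) {ε : ℝ} (hε : 0 < ε) (v : V) : S.Ψ v ≤ S.viscous ε v := by
  have hF : 0 ≤ S.F ‖ε • v‖ := by
    simpa [hS.F_zero, hS.F_deriv_zero] using
      hS.add_derivWithin_F_mul_le le_rfl (norm_nonneg (ε • v))
  exact le_add_of_nonneg_right (mul_nonneg (inv_nonneg.2 hε.le) hF)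

lemma viscous_smul_eq (hS : S.Standing) {ε a : ℝ} (ha : 0 ≤ a) {v w : V}
    (h : ‖a • w‖ = ‖v‖) : S.viscous ε (a • w) = a * S.Ψ w + (S.viscous ε v - S.Ψ v) := by
  simp only [viscous, norm_smul ε, h, hS.psi_homogeneous a w ha, add_sub_cancel_left]

/-- Competitors in the conjugate that have the same norm as `v` have the same viscous part, so they
bound `ξ - Ψ` on the sphere through `v`, hence everywhere by homogeneity. -/
lemma le_viscous_add_viscousConj (hS : S.Standing) {ε : ℝ} (hε : 0 < ε) (v : V)
    (ξ : V →L[ℝ] ℝ) :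
    ENNReal.ofReal (S.Ψ v) + S.stableDist ξ * ENNReal.ofReal ‖v‖ ≤
      ENNReal.ofReal (S.viscous ε v) + S.viscousConj ε ξ := by
  have hvis := hS.psi_le_viscous hε v
  rcases eq_or_ne v 0 with rfl | hv
  · simpa using le_add_right (ENNReal.ofReal_le_ofReal hvis)
  rcases eq_or_ne (S.viscousConj ε ξ) ⊤ with htop | hfin
  · simp [htop]
  have hv' : 0 < ‖v‖ := norm_pos_iff.2 hv
  have hK0 : 0 ≤ (S.viscousConj ε ξ).toReal := ENNReal.toReal_nonneg
  rw [← ENNReal.ofReal_toReal hfin]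
  set K := (S.viscousConj ε ξ).toReal
  set c := (S.viscous ε v - S.Ψ v + K) / ‖v‖
  have hc0 : 0 ≤ c := div_nonneg (by linarith) hv'.le
  have hcv : c * ‖v‖ = S.viscous ε v - S.Ψ v + K := div_mul_cancel₀ _ hv'.ne'
  have hdist : S.stableDist ξ ≤ ENNReal.ofReal c := by
    refine (hS.stableDist_le_ofReal_iff hc0).2 fun w => ?_
    rcases eq_or_ne w 0 with rfl | hw
    · simp [hS.isGauge.map_zero]
    have ha : 0 < ‖v‖ / ‖w‖ := div_pos hv' (norm_pos_iff.2 hw)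
    have haw : ‖v‖ / ‖w‖ * ‖w‖ = ‖v‖ := div_mul_cancel₀ _ (norm_ne_zero_iff.2 hw)
    have hcomp : ξ ((‖v‖ / ‖w‖) • w) - S.viscous ε ((‖v‖ / ‖w‖) • w) ≤ K :=
      (ENNReal.ofReal_le_iff_le_toReal hfin).1
        (le_iSup (fun v => ENNReal.ofReal (ξ v - S.viscous ε v)) _)
    rw [hS.viscous_smul_eq (v := v) ha.le (by rw [norm_smul, Real.norm_of_nonneg ha.le, haw]),
      map_smul, smul_eq_mul] at hcomp
    refine le_of_mul_le_mul_left ?_ ha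
    rw [mul_add, mul_left_comm, haw]
    linarith
  calc ENNReal.ofReal (S.Ψ v) + S.stableDist ξ * ENNReal.ofReal ‖v‖
      ≤ ENNReal.ofReal (S.Ψ v) + ENNReal.ofReal c * ENNReal.ofReal ‖v‖ := by gcongr
    _ = ENNReal.ofReal (S.viscous ε v) + ENNReal.ofReal K := by
      rw [← ENNReal.ofReal_mul hc0, hcv, ← ENNReal.ofReal_add (hS.psi_nonneg v) (by linarith),
        ← ENNReal.ofReal_add ((hS.psi_nonneg v).trans hvis) hK0]
      ring_nf

/-- The optimal `ε` solves `F' (ε ‖v‖) = c`. -/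
lemma contactPotential_le (hS : S.Standing) {v : V} (hv : v ≠ 0) {ξ : V →L[ℝ] ℝ} {c : ℝ}
    (hc : 0 < c) (hξ : ∀ w, ξ w ≤ S.Ψ w + c * ‖w‖) :
    S.contactPotential v ξ ≤ ENNReal.ofReal (S.Ψ v + c * ‖v‖) := by
  obtain ⟨r, hr, hrc⟩ := hS.exists_derivWithin_F_eq hc
  have htangent : ∀ l, 0 ≤ l → S.F r + c * (l - r) ≤ S.F l := fun l hl =>
    hrc ▸ hS.add_derivWithin_F_mul_le hr.le hl
  have hv' : 0 < ‖v‖ := norm_pos_iff.2 hv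
  have hε : 0 < r / ‖v‖ := by positivity
  have hvis : S.viscous (r / ‖v‖) v = S.Ψ v + ‖v‖ / r * S.F r := by
    rw [viscous, norm_smul, Real.norm_of_nonneg hε.le, div_mul_cancel₀ _ hv'.ne', inv_div]
  have hconj : S.viscousConj (r / ‖v‖) ξ ≤ ENNReal.ofReal (‖v‖ / r * (c * r - S.F r)) := by
    refine iSup_le fun w => ENNReal.ofReal_le_ofReal ?_
    have hmul := mul_le_mul_of_nonneg_left (htangent _ (norm_nonneg ((r / ‖v‖) • w)))
      (by positivity : 0 ≤ ‖v‖ / r)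
    rw [norm_smul, Real.norm_of_nonneg hε.le] at hmul
    rw [viscous, norm_smul, Real.norm_of_nonneg hε.le, inv_div]
    have : ‖v‖ / r * (S.F r + c * (r / ‖v‖ * ‖w‖ - r)) =
        c * ‖w‖ - ‖v‖ / r * (c * r - S.F r) := by field_simp; ring
    linarith [hξ w]
  have hF : 0 ≤ c * r - S.F r := by linarith [htangent 0 le_rfl, hS.F_zero]
  calc S.contactPotential v ξ
      ≤ ENNReal.ofReal (S.viscous (r / ‖v‖) v) + S.viscousConj (r / ‖v‖) ξ := iInf₂_le _ hε
    _ ≤ ENNReal.ofReal (S.viscous (r / ‖v‖) v) +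
          ENNReal.ofReal (‖v‖ / r * (c * r - S.F r)) := by gcongr
    _ = ENNReal.ofReal (S.Ψ v + c * ‖v‖) := by
      rw [← ENNReal.ofReal_add ((hS.psi_nonneg v).trans (hS.psi_le_viscous hε v)) (by positivity),
        hvis]
      congr 1
      field_simp
      ring

lemma contactPotential_eq (hS : S.Standing) {v : V} (hv : v ≠ 0) (ξ : V →L[ℝ] ℝ) :
    S.contactPotential v ξ =
      ENNReal.ofReal (S.Ψ v) + S.stableDist ξ * ENNReal.ofReal ‖v‖ := by
  refine le_antisymm ?_ (le_iInf₂ fun ε hε => hS.le_viscous_add_viscousConj hε v ξ)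
  set s := (S.stableDist ξ).toReal
  have hs : S.stableDist ξ = ENNReal.ofReal s :=
    (ENNReal.ofReal_toReal (hS.stableDist_lt_top ξ).ne).symm
  have hs0 : 0 ≤ s := ENNReal.toReal_nonneg
  have happrox : ∀ c ∈ Ioi s, S.contactPotential v ξ ≤ ENNReal.ofReal (S.Ψ v + c * ‖v‖) :=
    fun c hc => hS.contactPotential_le hv (hs0.trans_lt hc)
      ((hS.stableDist_le_ofReal_iff (hs0.trans hc.le)).1
        (hs.trans_le (ENNReal.ofReal_le_ofReal hc.le)))
  have hcont : Tendsto (fun c => ENNReal.ofReal (S.Ψ v + c * ‖v‖)) (𝓝[>] s)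
      (𝓝 (ENNReal.ofReal (S.Ψ v + s * ‖v‖))) :=
    ((ENNReal.continuous_ofReal.comp (by fun_prop)).tendsto s).mono_left nhdsWithin_le_nhds
  have hlim := ge_of_tendsto hcont (eventually_mem_nhdsWithin.mono happrox)
  rwa [ENNReal.ofReal_add (hS.psi_nonneg v) (by positivity), ENNReal.ofReal_mul hs0, ← hs] at hlim

lemma finsler_eq (hS : S.Standing) (t : ℝ) (u v : V) :
    S.finsler t u v = ENNReal.ofReal (S.Ψ v) + S.instability t u * ENNReal.ofReal ‖v‖ := by
  rw [finsler]
  split_ifs with hv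
  · simp [hv, hS.isGauge.map_zero]
  have hv' : ENNReal.ofReal ‖v‖ ≠ 0 := by simpa using hv
  simp_rw [hS.contactPotential_eq hv, ← ENNReal.add_iInf, instability_eq_iInf_stableDist,
    ENNReal.iInf_mul_of_ne hv' ENNReal.ofReal_ne_top]

lemma le_finsler (hS : S.Standing) {t c : ℝ} {u : V} (hc : 0 ≤ c)
    (h : ENNReal.ofReal c ≤ S.instability t u) (v : V) :
    ENNReal.ofReal (S.Ψ v + c * ‖v‖) ≤ S.finsler t u v := by
  rw [hS.finsler_eq, ENNReal.ofReal_add (hS.psi_nonneg v) (by positivity), ENNReal.ofReal_mul hc]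
  gcongr

lemma finsler_le_of_forall_lt (hS : S.Standing) {t C : ℝ} {u v : V} (h₀ : S.Ψ v ≤ C)
    (h : ∀ c, 0 ≤ c → ENNReal.ofReal c < S.instability t u → S.Ψ v + c * ‖v‖ ≤ C) :
    S.finsler t u v ≤ ENNReal.ofReal C := by
  rcases eq_or_ne v 0 with rfl | hv
  · simp [finsler]
  have hv' : 0 < ‖v‖ := norm_pos_iff.2 hv
  have hle : S.instability t u ≤ ENNReal.ofReal ((C - S.Ψ v) / ‖v‖) := by
    refine ENNReal.le_of_forall_nnreal_lt fun c hc => ?_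
    rw [← ENNReal.ofReal_coe_nnreal] at hc ⊢
    refine ENNReal.ofReal_le_ofReal ((le_div_iff₀ hv').2 ?_)
    linarith [h c c.2 hc]
  calc S.finsler t u v
      ≤ ENNReal.ofReal (S.Ψ v) + ENNReal.ofReal ((C - S.Ψ v) / ‖v‖) * ENNReal.ofReal ‖v‖ := by
        rw [hS.finsler_eq]; gcongr
    _ = ENNReal.ofReal C := by
        have hdiv : 0 ≤ (C - S.Ψ v) / ‖v‖ := div_nonneg (by linarith) hv'.le
        rw [← ENNReal.ofReal_mul hdiv, div_mul_cancel₀ _ hv'.ne',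
          ← ENNReal.ofReal_add (hS.psi_nonneg v) (by linarith), add_sub_cancel]

end Standing

end RISystem

section Decrease

lemma deriv_le_of_eventually_sub_le {f g : ℝ → ℝ} {f' g' s : ℝ} (hf : HasDerivAt f f' s)
    (hg : HasDerivAt g g' s) (h : ∀ᶠ y in 𝓝[>] s, f y - f s ≤ g y - g s) : f' ≤ g' := by
  have hright : 𝓝[>] s ≤ 𝓝[≠] s := nhdsWithin_mono s fun _ hy => ne_of_gt hy
  refine le_of_tendsto_of_tendsto (hf.tendsto_slope.mono_left hright)
    (hg.tendsto_slope.mono_left hright) ?_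
  filter_upwards [h, self_mem_nhdsWithin] with y hy (hsy : s < y)
  rw [slope_def_field, slope_def_field]
  exact div_le_div_of_nonneg_right hy (sub_pos.2 hsy).le

variable {f m : ℝ → ℝ} {a b : ℝ}

lemma integral_sub_integral_left (hm : IntervalIntegrable m volume a b) {x y : ℝ} (hx : a ≤ x)
    (hxy : x ≤ y) (hy : y ≤ b) :
    (∫ r in a..y, m r) - ∫ r in a..x, m r = ∫ r in x..y, m r :=
  intervalIntegral.integral_interval_sub_left
    (hm.mono_set (uIcc_subset_uIcc left_mem_uIcc (mem_uIcc_of_le (hx.trans hxy) hy)))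
    (hm.mono_set (uIcc_subset_uIcc left_mem_uIcc (mem_uIcc_of_le hx (hxy.trans hy))))

lemma monotoneOn_add_integral_of_sub_le (hm : IntervalIntegrable m volume a b)
    (h : ∀ x y, a ≤ x → x ≤ y → y ≤ b → f x - f y ≤ ∫ r in x..y, m r) :
    MonotoneOn (fun x => f x + ∫ r in a..x, m r) (Icc a b) := fun x hx y hy hxy => by
  have hdecr := h x y hx.1 hxy hy.2
  rw [← integral_sub_integral_left hm hx.1 hxy hy.2] at hdecr
  dsimp only
  linarith

lemma ae_hasDerivAt_of_sub_le_integral (hab : a ≤ b) (hm : IntervalIntegrable m volume a b)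
    (h : ∀ x y, a ≤ x → x ≤ y → y ≤ b → f x - f y ≤ ∫ r in x..y, m r) :
    ∀ᵐ s ∂volume.restrict (Ioo a b),
      HasDerivAt f (deriv (fun x => f x + ∫ r in a..x, m r) s - m s) s := by
  have hmono := monotoneOn_add_integral_of_sub_le hm h
  filter_upwards [ae_restrict_of_ae hmono.ae_differentiableWithinAt_of_mem,
    ae_restrict_of_ae hm.ae_hasDerivAt_integral, ae_restrict_mem measurableSet_Ioo]
    with s hdiff hprim hs
  have hsI := Ioo_subset_Icc_self hs
  rw [uIcc_of_le hab] at hprim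
  have := ((hdiff hsI).differentiableAt (Icc_mem_nhds hs.1 hs.2)).hasDerivAt.sub
    (hprim hsI a (left_mem_Icc.2 hab))
  exact this.congr_of_eventuallyEq (Eventually.of_forall fun x => by simp)

lemma ofReal_sub_le_lintegral_neg_deriv (hab : a ≤ b) (hm : IntervalIntegrable m volume a b)
    (h : ∀ x y, a ≤ x → x ≤ y → y ≤ b → f x - f y ≤ ∫ r in x..y, m r) :
    ENNReal.ofReal (f a - f b) ≤ ∫⁻ s in Ioo a b, ENNReal.ofReal (-deriv f s) := by
  set g : ℝ → ℝ := fun x => f x + ∫ r in a..x, m r with hg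
  have hmono : MonotoneOn g (uIcc a b) :=
    uIcc_of_le hab ▸ monotoneOn_add_integral_of_sub_le hm h
  have hgi := hmono.intervalIntegrable_deriv
  have hgab : ∫ x in a..b, deriv g x ≤ g b - g a := by
    have hmem := hmono.intervalIntegral_deriv_mem_uIcc
    rw [uIcc_of_le (sub_nonneg.2 (hmono left_mem_uIcc right_mem_uIcc hab))] at hmem
    exact hmem.2
  have hdecr : f a - f b ≤ ∫ s in a..b, (m s - deriv g s) := by
    rw [intervalIntegral.integral_sub hm hgi]
    simp only [hg, intervalIntegral.integral_same, add_zero] at hgab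
    linarith
  refine (ENNReal.ofReal_le_ofReal hdecr).trans ?_
  calc ENNReal.ofReal (∫ s in a..b, (m s - deriv g s))
      ≤ ∫⁻ s in Ioo a b, ENNReal.ofReal (m s - deriv g s) := by
        rw [intervalIntegral.integral_of_le hab, integral_Ioc_eq_integral_Ioo,
          integral_eq_lintegral_pos_part_sub_lintegral_neg_part
            ((intervalIntegrable_iff_integrableOn_Ioo_of_le hab).1 (hm.sub hgi))]
        exact (ENNReal.ofReal_le_ofReal (sub_le_self _ ENNReal.toReal_nonneg)).trans
          ENNReal.ofReal_toReal_le
    _ = ∫⁻ s in Ioo a b, ENNReal.ofReal (-deriv f s) := by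
        refine lintegral_congr_ae ?_
        filter_upwards [ae_hasDerivAt_of_sub_le_integral hab hm h] with s hs
        rw [hs.deriv, neg_sub]

lemma exists_integrable_minorant {q : ℝ → ℝ≥0∞} (hq : ∫⁻ r in Ioo a b, q r ≠ ⊤) :
    ∃ m : ℝ → ℝ, (∀ r, 0 ≤ m r) ∧ Integrable m ∧ (∀ r, ENNReal.ofReal (m r) ≤ q r) ∧
      ∀ x y, a ≤ x → x ≤ y → y ≤ b →
        ∫⁻ r in Ioo x y, q r = ENNReal.ofReal (∫ r in x..y, m r) := by
  obtain ⟨g, hg, hgq, hgi⟩ := exists_measurable_le_setLIntegral_eq_of_integrable hq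
  have hgtop : ∫⁻ r in Ioo a b, g r ≠ ⊤ :=
    ne_top_of_le_ne_top hq (lintegral_mono fun r => hgq r)
  have hgint : IntegrableOn (fun r => (g r).toReal) (Ioo a b) :=
    integrable_toReal_of_lintegral_ne_top hg.aemeasurable hgtop
  have hint : Integrable ((Ioo a b).indicator fun r => (g r).toReal) :=
    hgint.integrable_indicator measurableSet_Ioo
  have hnn : ∀ r, 0 ≤ (Ioo a b).indicator (fun r => (g r).toReal) r :=
    indicator_nonneg fun r _ => ENNReal.toReal_nonneg
  refine ⟨_, hnn, hint, fun r => ?_, fun x y hx hxy hy => ?_⟩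
  · by_cases hr : r ∈ Ioo a b
    · rw [indicator_of_mem hr]
      exact ENNReal.ofReal_toReal_le.trans (hgq r)
    · simp [indicator_of_notMem hr]
  · have hsub : Ioo x y ⊆ Ioo a b := Ioo_subset_Ioo hx hy
    have hxyi := hgi (Ioo x y) measurableSet_Ioo
    rw [Measure.restrict_restrict measurableSet_Ioo, inter_eq_left.2 hsub] at hxyi
    rw [hxyi, intervalIntegral.integral_of_le hxy, integral_Ioc_eq_integral_Ioo,
      ofReal_integral_eq_lintegral_ofReal hint.integrableOn (Eventually.of_forall hnn)]
    refine lintegral_congr_ae ?_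
    filter_upwards [ae_mono (Measure.restrict_mono hsub le_rfl) (ae_lt_top hg hgtop),
      ae_restrict_mem measurableSet_Ioo] with r hr hrm
    rw [indicator_of_mem (hsub hrm), ENNReal.ofReal_toReal hr.ne]

lemma integral_le_of_lintegral_le_ofReal {q : ℝ → ℝ≥0∞} {C : ℝ} (hab : a ≤ b)
    (hm0 : ∀ r, 0 ≤ m r) (hmi : Integrable m) (hmq : ∀ r, ENNReal.ofReal (m r) ≤ q r)
    (hC : 0 ≤ C) (hq : ∫⁻ r in Ioo a b, q r ≤ ENNReal.ofReal C) : ∫ r in a..b, m r ≤ C := by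
  rw [intervalIntegral.integral_of_le hab, integral_Ioc_eq_integral_Ioo,
    ← ENNReal.ofReal_le_ofReal_iff hC,
    ofReal_integral_eq_lintegral_ofReal hmi.integrableOn (Eventually.of_forall hm0)]
  exact (lintegral_mono hmq).trans hq

end Decrease

section GaugeCurves

lemma gaugeAC_of_sub_le_mul {V : Type*} [AddCommGroup V] {N : V → ℝ} {u : ℝ → V} {a b L : ℝ}
    (hL : 0 ≤ L) (h : ∀ p q, a ≤ p → p ≤ q → q ≤ b → N (u q - u p) ≤ L * (q - p)) :
    GaugeAC N u a b := by
  refine ⟨fun _ => L, fun _ => hL, by simp, fun p q hp hpq hq => (h p q hp hpq hq).trans_eq ?_⟩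
  rw [intervalIntegral.integral_const, smul_eq_mul, mul_comm]

lemma GaugeAC.mono {V : Type*} [AddCommGroup V] {M N : V → ℝ} {u : ℝ → V}
    {a b a' b' : ℝ} (h : GaugeAC M u a b) (ha : a ≤ a') (hb : b' ≤ b)
    {L : ℝ} (hL : 0 ≤ L) (hNM : ∀ v, N v ≤ L * M v) : GaugeAC N u a' b' := by
  obtain ⟨m, hm0, hmi, hm⟩ := h
  refine ⟨fun r => L * m r, fun r => mul_nonneg hL (hm0 r),
    (hmi.mono_set (Icc_subset_Icc ha hb)).const_mul L, fun s t hs hst ht => ?_⟩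
  rw [intervalIntegral.integral_const_mul]
  exact (hNM _).trans (mul_le_mul_of_nonneg_left (hm s t (ha.trans hs) hst (ht.trans hb)) hL)

lemma GaugeAC.exists_continuousOn_sub_le {V : Type*} [AddCommGroup V] {N : V → ℝ} {u : ℝ → V}
    {a b : ℝ} (h : GaugeAC N u a b) :
    ∃ A : ℝ → ℝ, ContinuousOn A (Icc a b) ∧
      ∀ p q, a ≤ p → p ≤ q → q ≤ b → N (u q - u p) ≤ A q - A p := by
  obtain ⟨m, -, hmi, hm⟩ := h
  rcases lt_or_ge b a with hab | hab
  · exact ⟨0, continuousOn_const, fun p q hp hpq hq => absurd (hp.trans (hpq.trans hq)) hab.not_ge⟩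
  refine ⟨fun x => ∫ r in a..x, m r, ?_, fun p q hp hpq hq => ?_⟩
  · rw [← uIcc_of_le hab] at hmi ⊢
    exact intervalIntegral.continuousOn_primitive_interval hmi
  · rw [integral_sub_integral_left ((intervalIntegrable_iff_integrableOn_Icc_of_le hab).2 hmi)
      hp hpq hq]
    exact hm p q hp hpq hq

variable {V : Type*} [NormedAddCommGroup V] {N : V → ℝ}

lemma exists_norm_sub_lt_of_isCompact (hcont : Continuous N) (hpos : ∀ v, v ≠ 0 → 0 < N v)
    {K : Set V} (hK : IsCompact K) {δ : ℝ} (hδ : 0 < δ) :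
    ∃ η > 0, ∀ x ∈ K, ∀ y ∈ K, N (y - x) < η → ‖y - x‖ < δ := by
  have hfar : IsCompact ((K ×ˢ K) ∩ {p : V × V | δ ≤ ‖p.2 - p.1‖}) :=
    (hK.prod hK).inter_right (isClosed_le continuous_const (by fun_prop))
  rcases ((K ×ˢ K) ∩ {p : V × V | δ ≤ ‖p.2 - p.1‖}).eq_empty_or_nonempty with h | h
  · refine ⟨1, one_pos, fun x hx y hy _ => ?_⟩
    by_contra! hcon
    exact h.subset (⟨⟨hx, hy⟩, hcon⟩ : (x, y) ∈ (K ×ˢ K) ∩ _)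
  · obtain ⟨p, hp, hmin⟩ := hfar.exists_isMinOn h
      (by fun_prop : Continuous fun p : V × V => N (p.2 - p.1)).continuousOn
    refine ⟨N (p.2 - p.1), hpos _ (norm_pos_iff.1 (hδ.trans_le hp.2)), fun x hx y hy hlt => ?_⟩
    by_contra! hcon
    exact hlt.not_ge (hmin (⟨⟨hx, hy⟩, hcon⟩ : (x, y) ∈ (K ×ˢ K) ∩ _))

lemma continuousOn_of_gauge_sub_le (hcont : Continuous N) (hpos : ∀ v, v ≠ 0 → 0 < N v)
    {K : Set V} (hK : IsCompact K) {u : ℝ → V} {A : ℝ → ℝ} {a b : ℝ}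
    (huK : ∀ r ∈ Icc a b, u r ∈ K) (hA : ContinuousOn A (Icc a b))
    (h : ∀ p q, a ≤ p → p ≤ q → q ≤ b → N (u q - u p) ≤ A q - A p) :
    ContinuousOn u (Icc a b) := by
  intro r hr
  rw [ContinuousWithinAt, Metric.tendsto_nhds]
  intro δ hδ
  obtain ⟨η, hη, hmod⟩ := exists_norm_sub_lt_of_isCompact hcont hpos hK hδ
  filter_upwards [Metric.tendsto_nhds.1 (hA r hr) η hη, self_mem_nhdsWithin] with s hs hsI
  rw [Real.dist_eq, abs_lt] at hs
  rcases le_total s r with hsr | hrs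
  · rw [dist_comm, dist_eq_norm]
    exact hmod _ (huK s hsI) _ (huK r hr) (by linarith [h s r hsI.1 hsr hr.2])
  · rw [dist_eq_norm]
    exact hmod _ (huK r hr) _ (huK s hsI) (by linarith [h r s hr.1 hrs hsI.2])

variable [NormedSpace ℝ V]

lemma metricDeriv_of_differentiableAt (hcont : Continuous N) {u : ℝ → V} {r : ℝ}
    (h : DifferentiableAt ℝ u r) : metricDeriv N u r = ENNReal.ofReal (N (deriv u r)) :=
  (((ENNReal.continuous_ofReal.comp hcont).tendsto _).comp
    (hasDerivAt_iff_tendsto_slope_zero.1 h.hasDerivAt)).limsup_eq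

lemma metricDeriv_le {u : ℝ → V} {r c : ℝ}
    (h : ∀ᶠ h in 𝓝[≠] (0 : ℝ), N (h⁻¹ • (u (r + h) - u r)) ≤ c) :
    metricDeriv N u r ≤ ENNReal.ofReal c :=
  limsup_le_of_le (by isBoundedDefault) (h.mono fun _ hh => ENNReal.ofReal_le_ofReal hh)

lemma IsGauge.neg_deriv_le_metricDeriv (hN : IsGauge N) {f : ℝ → ℝ} {u : ℝ → V} {s : ℝ}
    (hf : DifferentiableAt ℝ f s) (h : ∀ᶠ y in 𝓝[>] s, f s - f y ≤ N (u y - u s)) :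
    ENNReal.ofReal (-deriv f s) ≤ metricDeriv N u s := by
  have hright : 𝓝[>] (0 : ℝ) ≤ 𝓝[≠] 0 := nhdsWithin_mono 0 fun _ hy => ne_of_gt hy
  have hlim : Tendsto (fun h : ℝ => ENNReal.ofReal (-(h⁻¹ • (f (s + h) - f s)))) (𝓝[>] 0)
      (𝓝 (ENNReal.ofReal (-deriv f s))) :=
    ENNReal.tendsto_ofReal
      ((hasDerivAt_iff_tendsto_slope_zero.1 hf.hasDerivAt).mono_left hright).neg
  have hshift : Tendsto (fun h : ℝ => s + h) (𝓝[>] 0) (𝓝[>] s) := by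
    refine tendsto_nhdsWithin_iff.2 ⟨?_, eventually_mem_nhdsWithin.mono fun h hh => ?_⟩
    · exact ((continuous_const_add s).tendsto' 0 s (add_zero s)).mono_left nhdsWithin_le_nhds
    · exact lt_add_of_pos_right s hh
  rw [← hlim.limsup_eq]
  refine (limsup_le_limsup ?_).trans (limsup_le_limsup_of_le hright)
  filter_upwards [hshift.eventually h, self_mem_nhdsWithin] with h hh (hpos : 0 < h)
  refine ENNReal.ofReal_le_ofReal ?_
  rw [hN.smul_eq _ _ (inv_nonneg.2 hpos.le), smul_eq_mul, ← mul_neg, neg_sub]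
  exact mul_le_mul_of_nonneg_left hh (inv_nonneg.2 hpos.le)

/-- The scalar function `r ↦ -N (u r - u a)` decreases at most as fast as the curve moves. -/
lemma IsGauge.ofReal_sub_le_lintegral_metricDeriv (hN : IsGauge N) {u : ℝ → V} {a b : ℝ}
    (hab : a ≤ b) (hu : GaugeAC N u a b) :
    ENNReal.ofReal (N (u b - u a)) ≤ ∫⁻ r in Ioo a b, metricDeriv N u r := by
  obtain ⟨m, -, hmi, hm⟩ := hu
  have hmi' := (intervalIntegrable_iff_integrableOn_Icc_of_le hab).2 hmi
  set f : ℝ → ℝ := fun r => -N (u r - u a) with hf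
  have htriangle : ∀ x y, f x - f y ≤ N (u y - u x) := fun x y => by
    simp only [hf]
    linarith [hN.sub_le (u y) (u x) (u a)]
  have hdecr : ∀ x y, a ≤ x → x ≤ y → y ≤ b → f x - f y ≤ ∫ r in x..y, m r :=
    fun x y hx hxy hy => (htriangle x y).trans (hm x y hx hxy hy)
  calc ENNReal.ofReal (N (u b - u a)) = ENNReal.ofReal (f a - f b) := by simp [hf, hN.map_zero]
    _ ≤ ∫⁻ r in Ioo a b, ENNReal.ofReal (-deriv f r) :=
        ofReal_sub_le_lintegral_neg_deriv hab hmi' hdecr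
    _ ≤ ∫⁻ r in Ioo a b, metricDeriv N u r := by
        refine lintegral_mono_ae ?_
        filter_upwards [ae_hasDerivAt_of_sub_le_integral hab hmi' hdecr] with r hr
        exact hN.neg_deriv_le_metricDeriv hr.differentiableAt
          (Eventually.of_forall fun y => htriangle r y)

lemma IsGauge.ofReal_sub_le_lintegral_deriv (hN : IsGauge N) (hcont : Continuous N)
    {u : ℝ → V} {a b : ℝ} (hab : a ≤ b) (hu : NormAC u a b)
    (hd : ∀ᵐ r ∂volume.restrict (Ioo a b), DifferentiableAt ℝ u r) :
    ENNReal.ofReal (N (u b - u a)) ≤ ∫⁻ r in Ioo a b, ENNReal.ofReal (N (deriv u r)) := by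
  obtain ⟨L, hL, hNL⟩ := hN.exists_le_mul_norm hcont
  refine (hN.ofReal_sub_le_lintegral_metricDeriv hab
    (GaugeAC.mono hu le_rfl le_rfl hL.le hNL)).trans_eq (lintegral_congr_ae ?_)
  filter_upwards [hd] with r hr using metricDeriv_of_differentiableAt hcont hr

lemma NormACLoc.ae_differentiableAt (hV : RadonNikodymProperty V) {u : ℝ → V} {G : Set ℝ}
    (h : NormACLoc u G) : ∀ᵐ r, r ∈ interior G → DifferentiableAt ℝ u r := by
  have hrational : ∀ᵐ r, ∀ p : ℚ × ℚ, Icc (p.1 : ℝ) p.2 ⊆ G →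
      r ∈ Ioo (p.1 : ℝ) p.2 → DifferentiableAt ℝ u r := by
    refine ae_all_iff.2 fun p => ?_
    by_cases hp : Icc (p.1 : ℝ) p.2 ⊆ G ∧ (p.1 : ℝ) ≤ p.2
    · filter_upwards [(ae_restrict_iff' measurableSet_Ioo).1
        (hV u p.1 p.2 (h _ _ hp.2 hp.1))] with r hr _ using hr
    · exact Eventually.of_forall fun r hr hrp => absurd ⟨hr, hrp.1.le.trans hrp.2.le⟩ hp
  filter_upwards [hrational] with r hr hrG
  obtain ⟨l, b, hlb, hsub⟩ := mem_nhds_iff_exists_Ioo_subset.1 (mem_interior_iff_mem_nhds.1 hrG)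
  obtain ⟨q₁, hq₁⟩ := exists_rat_btwn hlb.1
  obtain ⟨q₂, hq₂⟩ := exists_rat_btwn hlb.2
  exact hr (q₁, q₂) ((Icc_subset_Ioo hq₁.1 hq₂.2).trans hsub) ⟨hq₁.2, hq₂.1⟩

end GaugeCurves

section Extraction

lemma exists_subseq_forall_cauchySeq {X Y : Type*} [UniformSpace X] [FirstCountableTopology X]
    {K : Set X} (hK : IsCompact K) {C : Set Y} (hC : C.Countable) {w : ℕ → Y → X}
    (hw : ∀ n, ∀ y ∈ C, w n y ∈ K) :
    ∃ φ : ℕ → ℕ, StrictMono φ ∧ ∀ y ∈ C, CauchySeq fun n => w (φ n) y := by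
  have := hC.to_subtype
  obtain ⟨_, _, φ, hφ, hlim⟩ := (isCompact_univ_pi fun _ : C => hK).tendsto_subseq
    (x := fun n (y : C) => w n y) (fun n y _ => hw n y y.2)
  exact ⟨φ, hφ, fun y hy => (tendsto_pi_nhds.1 hlim ⟨y, hy⟩).cauchySeq⟩

lemma uniformCauchySeqOn_of_forall_net {X Y : Type*} [PseudoMetricSpace X] [PseudoMetricSpace Y]
    {s : Set Y} {w : ℕ → Y → X}
    (hequi : ∀ δ > 0, ∃ ρ > 0, ∀ᶠ n in atTop, ∀ p ∈ s, ∀ q ∈ s,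
      dist p q < ρ → dist (w n p) (w n q) < δ)
    (hnet : ∀ ρ > 0, ∃ c ⊆ s, c.Finite ∧ (s ⊆ ⋃ y ∈ c, Metric.ball y ρ) ∧
      ∀ y ∈ c, CauchySeq fun n => w n y) :
    UniformCauchySeqOn w atTop s := by
  rw [Metric.uniformCauchySeqOn_iff]
  intro δ hδ
  obtain ⟨ρ, hρ, hequi⟩ := hequi (δ / 3) (by linarith)
  obtain ⟨c, hcs, hcf, hcover, hcauchy⟩ := hnet ρ hρ
  have huniform : ∀ᶠ N in atTop, ∀ y ∈ c, ∀ m ≥ N, ∀ n ≥ N, dist (w m y) (w n y) < δ / 3 := by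
    refine hcf.eventually_all.2 fun y hy => ?_
    obtain ⟨N, hN⟩ := Metric.cauchySeq_iff.1 (hcauchy y hy) (δ / 3) (by linarith)
    filter_upwards [eventually_ge_atTop N] with N' hN' m hm n hn
      using hN m (hN'.trans hm) n (hN'.trans hn)
  obtain ⟨N, hN, hequi⟩ := (huniform.and (eventually_forall_ge_atTop.2 hequi)).exists
  refine ⟨N, fun m hm n hn r hr => ?_⟩
  obtain ⟨y, hy, hry⟩ := mem_iUnion₂.1 (hcover hr)
  calc dist (w m r) (w n r)
      ≤ dist (w m r) (w m y) + dist (w m y) (w n y) + dist (w n y) (w n r) := dist_triangle4 ..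
    _ < δ / 3 + δ / 3 + δ / 3 := by
        refine add_lt_add (add_lt_add (hequi m hm r hr y (hcs hy) hry) (hN y hy m hm n hn)) ?_
        exact hequi n hn y (hcs hy) r hr (by rwa [dist_comm])
    _ = δ := by ring

/-- A version of Ascoli's theorem for maps that are equicontinuous only asymptotically, and need not
be continuous. -/
lemma exists_subseq_tendstoUniformlyOn {X Y : Type*} [MetricSpace X] [PseudoMetricSpace Y]
    {K : Set X} (hK : IsCompact K) {s : Set Y} (hs : TotallyBounded s) {w : ℕ → Y → X}
    (hw : ∀ n, ∀ r ∈ s, w n r ∈ K)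
    (hequi : ∀ δ > 0, ∃ ρ > 0, ∀ᶠ n in atTop, ∀ p ∈ s, ∀ q ∈ s,
      dist p q < ρ → dist (w n p) (w n q) < δ) :
    ∃ (φ : ℕ → ℕ) (ϑ : Y → X), StrictMono φ ∧ (∀ r ∈ s, ϑ r ∈ K) ∧
      TendstoUniformlyOn (fun n => w (φ n)) ϑ atTop s := by
  choose net hnets hnetf hcover using fun k : ℕ =>
    Metric.finite_approx_of_totallyBounded hs (1 / ((k : ℝ) + 1)) (by positivity)
  obtain ⟨φ, hφ, hcauchy⟩ := exists_subseq_forall_cauchySeq hK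
    (countable_iUnion fun k => (hnetf k).countable)
    (fun n y hy => let ⟨k, hk⟩ := mem_iUnion.1 hy; hw n y (hnets k hk))
  have hunif : UniformCauchySeqOn (fun n => w (φ n)) atTop s := by
    refine uniformCauchySeqOn_of_forall_net (fun δ hδ => ?_) fun ρ hρ => ?_
    · obtain ⟨ρ, hρ, h⟩ := hequi δ hδ
      exact ⟨ρ, hρ, hφ.tendsto_atTop.eventually h⟩
    · obtain ⟨k, hk⟩ := exists_nat_one_div_lt hρ
      exact ⟨net k, hnets k, hnetf k,
        (hcover k).trans (iUnion₂_mono fun y _ => Metric.ball_subset_ball hk.le),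
        fun y hy => hcauchy y (mem_iUnion.2 ⟨k, hy⟩)⟩
  have hlim : ∀ r, ∃ x, r ∈ s → x ∈ K ∧ Tendsto (fun n => w (φ n) r) atTop (𝓝 x) := fun r => by
    by_cases hr : r ∈ s
    · obtain ⟨x, hxK, hx⟩ := cauchySeq_tendsto_of_isComplete hK.isComplete
        (fun n => hw (φ n) r hr) (hunif.cauchySeq hr)
      exact ⟨x, fun _ => ⟨hxK, hx⟩⟩
    · exact ⟨w 0 r, fun h => absurd h hr⟩
  choose ϑ hϑ using hlim
  exact ⟨φ, ϑ, hφ, fun r hr => (hϑ r hr).1,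
    hunif.tendstoUniformlyOn_of_tendsto fun r hr => (hϑ r hr).2⟩

lemma exists_subseq_lt_add_of_liminf_ne_top {f : ℕ → ℝ≥0∞} (h : liminf f atTop ≠ ⊤) :
    ∃ φ : ℕ → ℕ, StrictMono φ ∧
      ∀ k, f (φ k) < ENNReal.ofReal ((liminf f atTop).toReal + 1 / ((k : ℝ) + 1)) := by
  refine extraction_forall_of_frequently (P := fun k n =>
    f n < ENNReal.ofReal ((liminf f atTop).toReal + 1 / ((k : ℝ) + 1))) fun k => ?_
  refine frequently_lt_of_liminf_lt (by isBoundedDefault) ?_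
  rw [ENNReal.lt_ofReal_iff_toReal_lt h]
  exact lt_add_of_pos_right _ (by positivity)

end Extraction

/-- Absolutely continuous surjective rescalings of `[0, 1]` onto `[α, β]`, nondecreasing, and
strictly increasing unless `[α, β]` is a point. -/
def IsRescaling (τ : ℝ → ℝ) (α β : ℝ) : Prop :=
  NormAC τ 0 1 ∧ τ '' Icc 0 1 = Icc α β ∧ MonotoneOn τ (Icc 0 1) ∧
    (α < β → StrictMonoOn τ (Icc 0 1))

namespace IsRescaling

variable {τ : ℝ → ℝ} {α β : ℝ}

lemma mem_Icc (h : IsRescaling τ α β) {x : ℝ} (hx : x ∈ Icc (0 : ℝ) 1) : τ x ∈ Icc α β :=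
  h.2.1 ▸ mem_image_of_mem τ hx

lemma monotoneOn (h : IsRescaling τ α β) : MonotoneOn τ (Icc 0 1) := h.2.2.1

lemma map_zero (h : IsRescaling τ α β) : τ 0 = α := by
  refine ((h.mem_Icc (by simp)).1).antisymm' ?_
  have hne : (Icc α β).Nonempty := ⟨τ 0, h.mem_Icc (by simp)⟩
  obtain ⟨x, hx, hxα⟩ := h.2.1.symm ▸ left_mem_Icc.2 (nonempty_Icc.1 hne)
  exact hxα ▸ h.monotoneOn (by simp) hx hx.1

lemma map_one (h : IsRescaling τ α β) : τ 1 = β := by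
  refine ((h.mem_Icc (by simp)).2).antisymm ?_
  have hne : (Icc α β).Nonempty := ⟨τ 1, h.mem_Icc (by simp)⟩
  obtain ⟨x, hx, hxβ⟩ := h.2.1.symm ▸ right_mem_Icc.2 (nonempty_Icc.1 hne)
  exact hxβ ▸ h.monotoneOn hx (by simp) hx.2

lemma Icc_subset_image (h : IsRescaling τ α β) {p q : ℝ} (hp : p ∈ Icc (0 : ℝ) 1)
    (hq : q ∈ Icc (0 : ℝ) 1) (hpq : p ≤ q) : Icc (τ p) (τ q) ⊆ τ '' Icc p q := by
  intro r hr
  obtain ⟨x, hx, rfl⟩ : r ∈ τ '' Icc 0 1 :=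
    h.2.1 ▸ Icc_subset_Icc (h.mem_Icc hp).1 (h.mem_Icc hq).2 hr
  rcases le_total x p with hxp | hpx
  · exact ⟨p, left_mem_Icc.2 hpq, hr.1.antisymm (h.monotoneOn hx hp hxp)⟩
  rcases le_total q x with hqx | hxq
  · exact ⟨q, right_mem_Icc.2 hpq, (h.monotoneOn hq hx hqx).antisymm hr.2⟩
  · exact ⟨x, ⟨hpx, hxq⟩, rfl⟩

end IsRescaling

lemma exists_isRescaling {s : ℝ → ℝ} {α β κ : ℝ} (hαβ : α ≤ β) (hκ : 0 < κ)
    (hcont : ContinuousOn s (Icc α β))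
    (hgrow : ∀ p q, α ≤ p → p ≤ q → q ≤ β → κ * (q - p) ≤ s q - s p) :
    ∃ τ : ℝ → ℝ, IsRescaling τ α β ∧
      ∀ x ∈ Icc (0 : ℝ) 1, s (τ x) = s α + (s β - s α) * x := by
  have hs : StrictMonoOn s (Icc α β) := fun p hp q hq hpq => by
    linarith [hgrow p q hp.1 hpq.le hq.2, mul_pos hκ (sub_pos.2 hpq)]
  have hC : 0 ≤ s β - s α :=
    sub_nonneg.2 (hs.monotoneOn (left_mem_Icc.2 hαβ) (right_mem_Icc.2 hαβ) hαβ)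
  have hpreimage : ∀ x ∈ Icc (0 : ℝ) 1, ∃ r ∈ Icc α β, s r = s α + (s β - s α) * x := fun x hx =>
    intermediate_value_Icc hαβ hcont (⟨by nlinarith [hx.1], by nlinarith [hx.2]⟩ : _ ∈ Icc _ _)
  choose! τ hτ hsτ using hpreimage
  have hmono : MonotoneOn τ (Icc 0 1) := fun p hp q hq hpq => by
    rw [← hs.le_iff_le (hτ p hp) (hτ q hq), hsτ p hp, hsτ q hq]
    gcongr
  refine ⟨τ, ⟨?_, ?_, hmono, fun hlt p hp q hq hpq => ?_⟩, hsτ⟩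
  · refine gaugeAC_of_sub_le_mul (L := (s β - s α) / κ) (by positivity) fun p q hp hpq hq => ?_
    have hp' : p ∈ Icc (0 : ℝ) 1 := ⟨hp, hpq.trans hq⟩
    have hq' : q ∈ Icc (0 : ℝ) 1 := ⟨hp.trans hpq, hq⟩
    have hτpq := hmono hp' hq' hpq
    rw [Real.norm_of_nonneg (sub_nonneg.2 hτpq), div_mul_eq_mul_div, le_div_iff₀ hκ]
    linarith [hgrow _ _ (hτ p hp').1 hτpq (hτ q hq').2, hsτ p hp', hsτ q hq']
  · refine Subset.antisymm (image_subset_iff.2 fun x hx => hτ x hx) fun r hr => ?_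
    rcases hαβ.eq_or_lt with rfl | hlt
    · have hτ0 := hτ 0 (by simp)
      rw [Icc_self, mem_singleton_iff] at hτ0 hr
      exact ⟨0, by simp, by rw [hτ0, hr]⟩
    have hαr := hs.monotoneOn (left_mem_Icc.2 hαβ) hr hr.1
    have hrβ := hs.monotoneOn hr (right_mem_Icc.2 hαβ) hr.2
    have hCpos := sub_pos.2 (hs (left_mem_Icc.2 hαβ) (right_mem_Icc.2 hαβ) hlt)
    have hx : (s r - s α) / (s β - s α) ∈ Icc (0 : ℝ) 1 :=
      ⟨div_nonneg (by linarith) hC, (div_le_one hCpos).2 (by linarith)⟩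
    exact ⟨_, hx, hs.injOn (hτ _ hx) hr (by
      rw [hsτ _ hx, mul_div_cancel₀ _ hCpos.ne', add_sub_cancel])⟩
  · rw [← hs.lt_iff_lt (hτ p hp) (hτ q hq), hsτ p hp, hsτ q hq]
    have hCpos := sub_pos.2 (hs (left_mem_Icc.2 hαβ) (right_mem_Icc.2 hαβ) hlt)
    gcongr

/-- The primitive `A` dominates the length of `u` on `[a, b]` for the gauge `N`, and on every
subinterval on which `i ≥ c` even for the larger gauge `N + c‖·‖`. For a time-parametrized curve
this says `N u' + i ‖u'‖ ≤ A'` without reference to derivatives, which makes the estimate stable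
under reparametrization and pointwise convergence. -/
def IsMajorant {V : Type*} [NormedAddCommGroup V] (N : V → ℝ) (i : ℝ → ℝ≥0∞) (u : ℝ → V)
    (a b : ℝ) (A : ℝ → ℝ) : Prop :=
  ∀ p q c : ℝ, a ≤ p → p ≤ q → q ≤ b → 0 ≤ c → (∀ r ∈ Icc p q, ENNReal.ofReal c ≤ i r) →
    N (u q - u p) + c * ‖u q - u p‖ ≤ A q - A p

namespace IsMajorant

variable {V : Type*} [NormedAddCommGroup V] {N : V → ℝ} {i : ℝ → ℝ≥0∞} {u : ℝ → V} {a b : ℝ}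
  {A : ℝ → ℝ}

lemma sub_le (h : IsMajorant N i u a b A) {p q : ℝ} (hp : a ≤ p) (hpq : p ≤ q) (hq : q ≤ b) :
    N (u q - u p) ≤ A q - A p := by
  simpa using h p q 0 hp hpq hq le_rfl (by simp)

lemma monotoneOn (h : IsMajorant N i u a b A) (hN : ∀ v, 0 ≤ N v) : MonotoneOn A (Icc a b) :=
  fun _ hp _ hq hpq => sub_nonneg.1 ((hN _).trans (h.sub_le hp.1 hpq hq.2))

lemma mono (h : IsMajorant N i u a b A) {a' b' : ℝ} (ha : a ≤ a') (hb : b' ≤ b) :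
    IsMajorant N i u a' b' A :=
  fun p q c hp hpq hq hc hi => h p q c (ha.trans hp) hpq (hq.trans hb) hc hi

lemma eventually_sub_le (h : IsMajorant N i u a b A) (hi : LowerSemicontinuousOn i (Icc a b))
    {s c : ℝ} (hs : s ∈ Ico a b) (hc : 0 ≤ c) (hcs : c = 0 ∨ ENNReal.ofReal c < i s) :
    ∀ᶠ y in 𝓝[>] s, N (u y - u s) + c * ‖u y - u s‖ ≤ A y - A s := by
  have hlower : ∀ᶠ r in 𝓝[≥] s, ENNReal.ofReal c ≤ i r := by
    rcases hcs with rfl | hcs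
    · simp
    · have hev := nhdsWithin_le_of_mem (Icc_mem_nhdsGE_of_mem hs)
        (hi s (Ico_subset_Icc_self hs) _ hcs)
      filter_upwards [hev] with r hr using hr.le
  obtain ⟨d, hd, hsub⟩ := mem_nhdsGE_iff_exists_Icc_subset.1 hlower
  filter_upwards [Ioc_mem_nhdsGT hd, Ioc_mem_nhdsGT hs.2] with y hyd hyb
  exact h s y c hs.1 hyd.1.le hyb.2 hc fun r hr => hsub ⟨hr.1, hr.2.trans hyd.2⟩

lemma exists_of_le_lintegral {q : ℝ → ℝ≥0∞} (hq : ∫⁻ r in Ioo a b, q r ≠ ⊤)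
    (h : ∀ x y c, a ≤ x → x ≤ y → y ≤ b → 0 ≤ c → (∀ r ∈ Icc x y, ENNReal.ofReal c ≤ i r) →
      ENNReal.ofReal (N (u y - u x) + c * ‖u y - u x‖) ≤ ∫⁻ r in Ioo x y, q r) :
    ∃ m : ℝ → ℝ, (∀ r, 0 ≤ m r) ∧ Integrable m ∧ (∀ r, ENNReal.ofReal (m r) ≤ q r) ∧
      IsMajorant N i u a b fun x => ∫ r in a..x, m r := by
  obtain ⟨m, hm0, hmi, hmq, hm⟩ := exists_integrable_minorant hq
  refine ⟨m, hm0, hmi, hmq, fun x y c hx hxy hy hc hi => ?_⟩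
  rw [integral_sub_integral_left hmi.intervalIntegrable hx hxy hy]
  have hle := h x y c hx hxy hy hc hi
  rwa [hm x y hx hxy hy, ENNReal.ofReal_le_ofReal_iff
    (intervalIntegral.integral_nonneg hxy fun r _ => hm0 r)] at hle

lemma exists_isRescaling (h : IsMajorant N i u a b A) (hN : ∀ v, 0 ≤ N v) (hab : a ≤ b)
    (hA : ContinuousOn A (Icc a b)) {κ : ℝ} (hκ : 0 < κ) :
    ∃ τ : ℝ → ℝ, IsRescaling τ a b ∧
      IsMajorant N (i ∘ τ) (u ∘ τ) 0 1 fun x => (κ * (b - a) + (A b - A a)) * x := by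
  obtain ⟨τ, hτ, hsτ⟩ := _root_.exists_isRescaling (s := fun r => κ * r + A r) hab hκ
    (by fun_prop) fun p q hp hpq hq => by
      linarith [h.monotoneOn hN ⟨hp, hpq.trans hq⟩ ⟨hp.trans hpq, hq⟩ hpq]
  refine ⟨τ, hτ, fun p q c hp hpq hq hc hi => ?_⟩
  have hp' : p ∈ Icc (0 : ℝ) 1 := ⟨hp, hpq.trans hq⟩
  have hq' : q ∈ Icc (0 : ℝ) 1 := ⟨hp.trans hpq, hq⟩
  have hτpq := hτ.monotoneOn hp' hq' hpq
  have hmaj := h (τ p) (τ q) c (hτ.mem_Icc hp').1 hτpq (hτ.mem_Icc hq').2 hc fun r hr => by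
    obtain ⟨x, hx, rfl⟩ := hτ.Icc_subset_image hp' hq' hpq hr
    exact hi x hx
  have hsp := hsτ p hp'
  have hsq := hsτ q hq'
  have hκτ := mul_le_mul_of_nonneg_left hτpq hκ.le
  simp only [Function.comp_apply]
  linarith

lemma exists_isRescaling_of_integral_le {m : ℝ → ℝ}
    (h : IsMajorant N i u a b fun x => ∫ r in a..x, m r) (hN : ∀ v, 0 ≤ N v)
    (hab : a ≤ b) (hmi : Integrable m) {C κ : ℝ} (hC : ∫ r in a..b, m r ≤ C) (hκ : 0 < κ) :
    ∃ τ : ℝ → ℝ, IsRescaling τ a b ∧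
      IsMajorant N (i ∘ τ) (u ∘ τ) 0 1 fun x => (κ * (b - a) + C) * x := by
  obtain ⟨τ, hτ, hmaj⟩ := h.exists_isRescaling hN hab
    (intervalIntegral.continuous_primitive (fun _ _ => hmi.intervalIntegrable) a).continuousOn hκ
  refine ⟨τ, hτ, fun p q c hp hpq hq hc hi => (hmaj p q c hp hpq hq hc hi).trans ?_⟩
  rw [intervalIntegral.integral_same, sub_zero, ← mul_sub, ← mul_sub]
  gcongr

/-- Only nearly the full rate `c` is available along the sequence; it is recovered by letting
`c' ↑ c` at the end. -/
lemma of_tendsto {ι : Type*} {l : Filter ι} [l.NeBot] {I : ι → ℝ → ℝ≥0∞} {w : ι → ℝ → V}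
    {B : ι → ℝ → ℝ} (hN : Continuous N) (h : ∀ n, IsMajorant N (I n) (w n) a b (B n))
    (hw : ∀ r ∈ Icc a b, Tendsto (w · r) l (𝓝 (u r)))
    (hB : ∀ r ∈ Icc a b, Tendsto (B · r) l (𝓝 (A r)))
    (hI : ∀ r ∈ Icc a b, ∀ c, 0 ≤ c → ENNReal.ofReal c < i r →
      ∀ᶠ x in l ×ˢ 𝓝 r, x.2 ∈ Icc a b → ENNReal.ofReal c < I x.1 x.2) :
    IsMajorant N i u a b A := by
  intro p q c hp hpq hq hc hi
  have hpI : p ∈ Icc a b := ⟨hp, hpq.trans hq⟩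
  have hqI : q ∈ Icc a b := ⟨hp.trans hpq, hq⟩
  have hlimit : ∀ c', 0 ≤ c' → (∀ᶠ n in l, ∀ r ∈ Icc p q, ENNReal.ofReal c' ≤ I n r) →
      N (u q - u p) + c' * ‖u q - u p‖ ≤ A q - A p := fun c' hc' hev => by
    have hsub := (hw q hqI).sub (hw p hpI)
    refine le_of_tendsto_of_tendsto (((hN.tendsto _).comp hsub).add (hsub.norm.const_mul c'))
      ((hB q hqI).sub (hB p hpI)) ?_
    filter_upwards [hev] with n hn using h n p q c' hp hpq hq hc' hn
  rcases hc.eq_or_lt with rfl | hc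
  · exact hlimit 0 le_rfl (Eventually.of_forall fun n r _ => by simp)
  have hlower : ∀ c', 0 ≤ c' → c' < c → ∀ᶠ n in l, ∀ r ∈ Icc p q, ENNReal.ofReal c' ≤ I n r :=
    fun c' hc' hlt => by
      have hprod := isCompact_Icc.mem_prod_nhdsSet_of_forall fun r (hr : r ∈ Icc p q) =>
        hI r ⟨hp.trans hr.1, hr.2.trans hq⟩ c' hc'
          (((ENNReal.ofReal_lt_ofReal_iff hc).2 hlt).trans_le (hi r hr))
      refine (Eventually.curry hprod).mono fun n hn r hr => ?_
      exact (hn.self_of_nhdsSet r hr ⟨hp.trans hr.1, hr.2.trans hq⟩).le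
  have hcont : Tendsto (fun c' => N (u q - u p) + c' * ‖u q - u p‖) (𝓝[<] c)
      (𝓝 (N (u q - u p) + c * ‖u q - u p‖)) :=
    (Continuous.tendsto (by fun_prop) c).mono_left nhdsWithin_le_nhds
  refine le_of_tendsto hcont ?_
  filter_upwards [Ioo_mem_nhdsLT hc] with c' hc'
    using hlimit c' hc'.1.le (hlower c' hc'.1.le hc'.2)

end IsMajorant

section ExponentialGrowth

variable {g g' : ℝ → ℝ} {a b C : ℝ}

lemma monotoneOn_exp_neg_mul (hg : ContinuousOn g (Icc a b))
    (hg' : ∀ s ∈ Ioo a b, HasDerivAt g (g' s) s) (h : ∀ s ∈ Ioo a b, C * g s ≤ g' s) :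
    MonotoneOn (fun s => Real.exp (-(C * s)) * g s) (Icc a b) := by
  have hexp : ∀ s, HasDerivAt (fun s => Real.exp (-(C * s))) (Real.exp (-(C * s)) * -C) s :=
    fun s => by simpa using (((hasDerivAt_id s).const_mul C).neg).exp
  refine monotoneOn_of_hasDerivWithinAt_nonneg (convex_Icc a b)
    ((by fun_prop : Continuous fun s => Real.exp (-(C * s))).continuousOn.mul hg)
    (fun s hs => ((hexp s).mul (hg' s (interior_Icc (a := a) ▸ hs))).hasDerivWithinAt)
    fun s hs => ?_
  rw [interior_Icc] at hs
  have := mul_nonneg (Real.exp_pos (-(C * s))).le (sub_nonneg.2 (h s hs))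
  linarith

lemma le_exp_mul_abs_sub (hg : ContinuousOn g (Icc a b))
    (hg' : ∀ s ∈ Ioo a b, HasDerivAt g (g' s) s) (h : ∀ s ∈ Ioo a b, |g' s| ≤ C * g s)
    {s t : ℝ} (hs : s ∈ Icc a b) (ht : t ∈ Icc a b) :
    g s ≤ Real.exp (C * |s - t|) * g t := by
  have hcancel : ∀ D x y, Real.exp (-(D * s)) * x ≤ Real.exp (-(D * t)) * y →
      x ≤ Real.exp (D * (s - t)) * y := fun D x y hxy => by
    have hmul := mul_le_mul_of_nonneg_left hxy (Real.exp_pos (D * s)).le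
    rwa [← mul_assoc, ← mul_assoc, ← Real.exp_add, ← Real.exp_add, add_neg_cancel, Real.exp_zero,
      one_mul, ← sub_eq_add_neg, ← mul_sub] at hmul
  rcases le_total s t with hst | hts
  · have hmono := monotoneOn_exp_neg_mul (C := -C) hg hg' fun r hr => by
      linarith [neg_abs_le (g' r), h r hr]
    rw [abs_of_nonpos (sub_nonpos.2 hst), mul_neg, ← neg_mul]
    exact hcancel _ _ _ (hmono hs ht hst)
  · have hmono := monotoneOn_exp_neg_mul (C := C) hg.neg (fun r hr => (hg' r hr).neg) fun r hr => by
      rw [Pi.neg_apply]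
      linarith [le_abs_self (g' r), h r hr]
    rw [abs_of_nonneg (sub_nonneg.2 hts)]
    refine hcancel _ _ _ ?_
    simpa using hmono ht hs hts

end ExponentialGrowth

namespace RISystem

lemma sublevel_mono {V : Type*} {S : RISystem V} {e e' : ℝ} (h : e ≤ e') :
    S.sublevel e ⊆ S.sublevel e' :=
  fun _ hu => ⟨hu.1, fun t ht => (hu.2 t ht).trans h⟩

variable {V : Type*} [NormedAddCommGroup V] [NormedSpace ℝ V] {S : RISystem V}

/-- A modulus `ω` of uniform subdifferentiability of the energy on the sublevel `D_e`, with only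
the increment `Ψ (v - u)` of the two directions kept. -/
structure IsModulus (S : RISystem V) (e : ℝ) (ω : ℝ × V × V → ℝ) : Prop where
  nonneg : ∀ p, 0 ≤ ω p
  upperSemicontinuousOn : UpperSemicontinuousOn ω (Icc 0 S.T ×ˢ S.sublevel e ×ˢ S.sublevel e)
  self_eq_zero : ∀ t ∈ Icc 0 S.T, ∀ u ∈ S.sublevel e, ω (t, u, u) = 0
  energy_sub_le : ∀ t ∈ Icc 0 S.T, ∀ u ∈ S.sublevel e, ∀ v ∈ S.sublevel e,
    ∀ ξ : V →L[ℝ] ℝ, -ξ ∈ S.subdiff t u →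
      S.E t u - S.E t v ≤ ξ (v - u) + ω (t, u, v) * S.Ψ (v - u)

namespace IsModulus

variable {e t : ℝ} {ω : ℝ × V × V → ℝ} {u v : V}

lemma eventually_lt (hω : S.IsModulus e ω) (ht : t ∈ Icc 0 S.T) (hu : u ∈ S.sublevel e) {δ : ℝ}
    (hδ : 0 < δ) : ∀ᶠ v in 𝓝[S.sublevel e] u, ω (t, u, v) < δ := by
  refine (Tendsto.eventually ?_) (hω.upperSemicontinuousOn (t, u, u) ⟨ht, hu, hu⟩ δ
    ((hω.self_eq_zero t ht u hu).trans_lt hδ))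
  refine tendsto_nhdsWithin_iff.2 ⟨(Continuous.tendsto (by fun_prop) u).mono_left
    nhdsWithin_le_nhds, eventually_mem_nhdsWithin.mono fun v hv => ⟨ht, hu, hv⟩⟩

lemma exists_le (hω : S.IsModulus e ω) (hS : S.Standing) (he : 0 < e) (ht : t ∈ Icc 0 S.T) :
    ∃ W, ∀ u ∈ S.sublevel e, ∀ v ∈ S.sublevel e, ω (t, u, v) ≤ W := by
  have hK := hS.E_coercive e he
  obtain ⟨W, hW⟩ := (hω.upperSemicontinuousOn.mono (prod_mono_left (singleton_subset_iff.2
    ht))).bddAbove_of_isCompact (isCompact_singleton.prod (hK.prod hK))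
  exact ⟨W, fun u hu v hv => hW (mem_image_of_mem _ ⟨mem_singleton t, hu, hv⟩)⟩

lemma energy_sub_le_of_instability_le (hω : S.IsModulus e ω) (hS : S.Standing)
    (ht : t ∈ Icc 0 S.T) (hu : u ∈ S.sublevel e) (hv : v ∈ S.sublevel e) {c : ℝ} (hc : 0 ≤ c)
    (huc : S.instability t u ≤ ENNReal.ofReal c) :
    S.E t u - S.E t v ≤ (1 + ω (t, u, v)) * S.Ψ (v - u) + c * ‖v - u‖ := by
  have hlimit : Tendsto (fun c' => (1 + ω (t, u, v)) * S.Ψ (v - u) + c' * ‖v - u‖) (𝓝[>] c)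
      (𝓝 ((1 + ω (t, u, v)) * S.Ψ (v - u) + c * ‖v - u‖)) :=
    (Continuous.tendsto (by fun_prop) c).mono_left nhdsWithin_le_nhds
  refine ge_of_tendsto hlimit ?_
  filter_upwards [self_mem_nhdsWithin] with c' (hcc' : c < c')
  have hlt := huc.trans_lt ((ENNReal.ofReal_lt_ofReal_iff (hc.trans_lt hcc')).2 hcc')
  rw [instability_eq_iInf_stableDist] at hlt
  simp only [iInf_lt_iff] at hlt
  obtain ⟨ξ, hξ, hξc⟩ := hlt
  linarith [hω.energy_sub_le t ht u hu v hv ξ hξ,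
    (hS.stableDist_le_ofReal_iff (hc.trans hcc'.le)).1 hξc.le (v - u)]

end IsModulus

namespace Standing

lemma exists_isModulus (hS : S.Standing) {e : ℝ} (he : 0 < e) : ∃ ω, S.IsModulus e ω := by
  obtain ⟨ω, hω, hω0, hineq⟩ := hS.E_subdiff e he
  refine ⟨fun p => ω p ⊔ 0, fun p => le_sup_right,
    hω.sup continuousOn_const.upperSemicontinuousOn,
    fun t ht u hu => by simp [hω0 t ht u hu], fun t ht u hu v hv ξ hξ => ?_⟩
  have h := hineq t ht u hu v hv _ hξ
  have hmin : ω (t, u, v) * min (S.Ψ (v - u)) (S.Ψ (-(v - u))) ≤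
      (ω (t, u, v) ⊔ 0) * S.Ψ (v - u) :=
    mul_le_mul le_sup_left (min_le_left _ _) (le_min (hS.psi_nonneg _) (hS.psi_nonneg _))
      le_sup_right
  rw [neg_apply] at h
  linarith

lemma exists_mem_sublevel (hS : S.Standing) (M : ℝ) :
    ∃ e > 0, ∀ t ∈ Icc 0 S.T, ∀ v ∈ S.D, S.Ψ v + S.E t v ≤ M → v ∈ S.sublevel e := by
  obtain ⟨C, hC, hpow⟩ := hS.power_bound
  refine ⟨Real.exp (C * S.T) * (M ⊔ 0) + 1, by positivity,
    fun t ht v hv hM => ⟨hv, fun s hs => ?_⟩⟩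
  have hgrowth := le_exp_mul_abs_sub (g := fun s => S.Ψ v + S.E s v)
    (continuousOn_const.add (hS.E_differentiable v hv).continuousOn)
    (fun r hr => ((hS.E_differentiable v hv r (Ioo_subset_Icc_self hr)).hasDerivWithinAt.hasDerivAt
      (Icc_mem_nhds hr.1 hr.2)).const_add _) (fun r hr => hpow r hr v hv) hs ht
  calc S.Ψ v + S.E s v ≤ Real.exp (C * |s - t|) * (S.Ψ v + S.E t v) := hgrowth
    _ ≤ Real.exp (C * S.T) * (M ⊔ 0) := by
        have hst : |s - t| ≤ S.T :=
          abs_le.2 ⟨by linarith [hs.1, ht.2], by linarith [hs.2, ht.1]⟩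
        have hM0 : S.Ψ v + S.E t v ≤ M ⊔ 0 := hM.trans le_sup_left
        have := le_sup_right (a := M) (b := 0)
        exact (mul_le_mul_of_nonneg_left hM0 (Real.exp_pos _).le).trans (by gcongr)
    _ ≤ Real.exp (C * S.T) * (M ⊔ 0) + 1 := by linarith

lemma lowerSemicontinuousOn_E (hS : S.Standing) {t : ℝ} (ht : t ∈ Icc 0 S.T) :
    LowerSemicontinuousOn (S.E t) S.D :=
  hS.E_lsc.comp (g := fun u => (t, u)) (by fun_prop) fun u hu => ⟨ht, hu⟩

/-- Points of high energy satisfy the subdifferential inequality trivially near `u`. -/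
lemma mem_subdiff_of_forall_sublevel (hS : S.Standing) {t : ℝ} (ht : t ∈ Icc 0 S.T) {u : V}
    (hu : u ∈ S.D) {η : V →L[ℝ] ℝ}
    (h : ∀ e₀ : ℝ, ∃ e ≥ e₀, ∀ δ > 0, ∀ᶠ v in 𝓝[S.sublevel e] u,
      -(δ * ‖v - u‖) ≤ S.E t v - S.E t u - η (v - u)) :
    η ∈ S.subdiff t u := by
  refine ⟨hu, fun δ hδ => ?_⟩
  obtain ⟨e₀, -, he₀⟩ := hS.exists_mem_sublevel (S.Ψ u + 1 + (S.E t u + 1))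
  obtain ⟨e, hee, he⟩ := h e₀
  have hΨ : ∀ᶠ v in 𝓝 u, S.Ψ v < S.Ψ u + 1 :=
    hS.psi_continuous.continuousAt.eventually_lt_const (by linarith)
  have hη : ∀ᶠ v in 𝓝 u, η (v - u) < 1 :=
    (by fun_prop : Continuous fun v => η (v - u)).continuousAt.eventually_lt_const (by simp)
  refine eventually_nhdsWithin_iff.2 ?_
  filter_upwards [eventually_nhdsWithin_iff.1 (he δ hδ), hΨ, hη] with v hlow hΨv hηv hvD
  by_cases hv : v ∈ S.sublevel e
  · exact hlow hv
  · have hhigh : S.E t u + 1 < S.E t v := by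
      by_contra! hcon
      exact hv (sublevel_mono hee (he₀ t ht v hvD (by linarith)))
    linarith [mul_nonneg hδ.le (norm_nonneg (v - u))]

section Closedness

variable {ι : Type*} {l : Filter ι} [l.NeBot] {e t C : ℝ} {u : V} {ts : ι → ℝ} {us : ι → V}
  {ξs : ι → V →L[ℝ] ℝ} {ξ : V →L[ℝ] ℝ}

lemma energy_sub_le_of_tendsto (hS : S.Standing) {ω : ℝ × V × V → ℝ} (hω : S.IsModulus e ω)
    (ht : t ∈ Icc 0 S.T) (hu : u ∈ S.sublevel e) (hts : ∀ i, ts i ∈ Icc 0 S.T)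
    (hus : ∀ i, us i ∈ S.sublevel e) (hξs : ∀ i, -ξs i ∈ S.subdiff (ts i) (us i))
    (hC : ∀ i, ‖ξs i‖ ≤ C) (htst : Tendsto ts l (𝓝 t)) (husu : Tendsto us l (𝓝 u))
    (hξ : ∀ v, Tendsto (fun i => ξs i v) l (𝓝 (ξ v))) {v : V} (hv : v ∈ S.sublevel e) :
    S.E t u - S.E t v ≤ ξ (v - u) + ω (t, u, v) * S.Ψ (v - u) := by
  have hlimit : ∀ η > 0,
      S.E t u - η - S.E t v ≤ ξ (v - u) + (ω (t, u, v) + η) * S.Ψ (v - u) := fun η hη => by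
    have hE : ∀ᶠ i in l, S.E t u - η < S.E (ts i) (us i) :=
      (tendsto_nhdsWithin_iff.2 ⟨htst.prodMk_nhds husu, Eventually.of_forall fun i =>
        mk_mem_prod (hts i) (hus i).1⟩).eventually
        (hS.E_lsc (t, u) ⟨ht, hu.1⟩ _ (sub_lt_self _ hη))
    have hωlt : ∀ᶠ i in l, ω (ts i, us i, v) < ω (t, u, v) + η :=
      (tendsto_nhdsWithin_iff.2 ⟨htst.prodMk_nhds (husu.prodMk_nhds tendsto_const_nhds),
        Eventually.of_forall fun i =>
          mk_mem_prod (hts i) (mk_mem_prod (hus i) hv)⟩).eventually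
        (hω.upperSemicontinuousOn (t, u, v) ⟨ht, hu, hv⟩ _ (lt_add_of_pos_right _ hη))
    have hEv : Tendsto (fun i => S.E (ts i) v) l (𝓝 (S.E t v)) :=
      ((hS.E_differentiable v hv.1).continuousOn t ht).tendsto.comp
        (tendsto_nhdsWithin_iff.2 ⟨htst, Eventually.of_forall hts⟩)
    have hvu := (tendsto_const_nhds (x := v)).sub husu
    refine le_of_tendsto_of_tendsto (tendsto_const_nhds.sub hEv)
      ((tendsto_apply_of_forall_norm_le hC hξ hvu).add
        (((hS.psi_continuous.tendsto _).comp hvu).const_mul _)) ?_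
    filter_upwards [hE, hωlt] with i hEi hωi
    have hmul := mul_le_mul_of_nonneg_right hωi.le (hS.psi_nonneg (v - us i))
    simp only [Function.comp_apply]
    linarith [hω.energy_sub_le _ (hts i) _ (hus i) v hv _ (hξs i)]
  have hleft : Tendsto (fun η => S.E t u - η - S.E t v) (𝓝[>] 0) (𝓝 (S.E t u - S.E t v)) :=
    (Continuous.tendsto' (by fun_prop) _ _ (by simp)).mono_left nhdsWithin_le_nhds
  have hright : Tendsto (fun η => ξ (v - u) + (ω (t, u, v) + η) * S.Ψ (v - u)) (𝓝[>] 0)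
      (𝓝 (ξ (v - u) + ω (t, u, v) * S.Ψ (v - u))) :=
    (Continuous.tendsto' (by fun_prop) _ _ (by simp)).mono_left nhdsWithin_le_nhds
  exact le_of_tendsto_of_tendsto hleft hright (eventually_mem_nhdsWithin.mono hlimit)

lemma neg_mem_subdiff_of_tendsto (hS : S.Standing) (he : 0 < e)
    (hts : ∀ i, ts i ∈ Icc 0 S.T) (hus : ∀ i, us i ∈ S.sublevel e)
    (hξs : ∀ i, -ξs i ∈ S.subdiff (ts i) (us i)) (hC : ∀ i, ‖ξs i‖ ≤ C)
    (htst : Tendsto ts l (𝓝 t)) (husu : Tendsto us l (𝓝 u))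
    (hξ : ∀ v, Tendsto (fun i => ξs i v) l (𝓝 (ξ v))) :
    -ξ ∈ S.subdiff t u := by
  have ht : t ∈ Icc 0 S.T := isClosed_Icc.mem_of_tendsto htst (Eventually.of_forall hts)
  have hu : u ∈ S.sublevel e :=
    (hS.E_coercive e he).isClosed.mem_of_tendsto husu (Eventually.of_forall hus)
  obtain ⟨L, hL, hΨL⟩ := hS.isGauge.exists_le_mul_norm hS.psi_continuous
  refine hS.mem_subdiff_of_forall_sublevel ht hu.1 fun e₀ => ?_
  have hee := sublevel_mono (S := S) (le_max_left e e₀)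
  obtain ⟨ω, hω⟩ := hS.exists_isModulus (he.trans_le (le_max_left e e₀))
  refine ⟨max e e₀, le_max_right _ _, fun δ hδ => ?_⟩
  filter_upwards [hω.eventually_lt ht (hee hu) (div_pos hδ hL), self_mem_nhdsWithin] with v hωv hv
  have hle := hS.energy_sub_le_of_tendsto hω ht (hee hu) hts (fun i => hee (hus i)) hξs hC htst
    husu hξ hv
  have hsmall : ω (t, u, v) * S.Ψ (v - u) ≤ δ * ‖v - u‖ :=
    calc ω (t, u, v) * S.Ψ (v - u) ≤ δ / L * (L * ‖v - u‖) :=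
          mul_le_mul hωv.le (hΨL _) (hS.psi_nonneg _) (div_nonneg hδ.le hL.le)
      _ = δ * ‖v - u‖ := by field_simp
  rw [neg_apply]
  linarith

end Closedness

lemma norm_le_of_stableDist_le (hS : S.Standing) {c : ℝ} (hc : 0 ≤ c) :
    ∃ C, ∀ ξ : V →L[ℝ] ℝ, S.stableDist ξ ≤ ENNReal.ofReal c → ‖ξ‖ ≤ C := by
  obtain ⟨L, hL, hΨL⟩ := hS.isGauge.exists_le_mul_norm hS.psi_continuous
  refine ⟨L + c, fun ξ hξ => opNorm_le_of_apply_le (by positivity) fun v => ?_⟩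
  linarith [(hS.stableDist_le_ofReal_iff hc).1 hξ v, hΨL v]

/-- Forces realizing the bound along an ultrafilter have a weak* limit, by Banach–Alaoglu, and the
subdifferential is strong-weak* closed. -/
lemma instability_le_of_mem_closure (hS : S.Standing) {e t c : ℝ} {u : V} (he : 0 < e)
    (hc : 0 ≤ c) (h : (t, u) ∈ closure {p : ℝ × V | p ∈ Icc 0 S.T ×ˢ S.sublevel e ∧
      S.instability p.1 p.2 < ENNReal.ofReal c}) :
    S.instability t u ≤ ENNReal.ofReal c := by
  set B := {p : ℝ × V | p ∈ Icc 0 S.T ×ˢ S.sublevel e ∧ S.instability p.1 p.2 < ENNReal.ofReal c}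
  have hforce : ∀ p : B, ∃ ξ : V →L[ℝ] ℝ, -ξ ∈ S.subdiff p.1.1 p.1.2 ∧
      S.stableDist ξ ≤ ENNReal.ofReal c := fun p => by
    have hp := p.2.2
    simp only [instability_eq_iInf_stableDist, iInf_lt_iff] at hp
    obtain ⟨ξ, hξ, hξc⟩ := hp
    exact ⟨ξ, hξ, hξc.le⟩
  choose ξs hξs hξc using hforce
  obtain ⟨C, hC⟩ := hS.norm_le_of_stableDist_le hc
  have := mem_closure_iff_comap_neBot.1 h
  set l := Ultrafilter.of (comap ((↑) : B → ℝ × V) (𝓝 (t, u)))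
  have hlim : Tendsto ((↑) : B → ℝ × V) l (𝓝 (t, u)) :=
    tendsto_comap.mono_left (Ultrafilter.of_le _)
  obtain ⟨ξ, -, hξ⟩ := (WeakDual.isCompact_closedBall (0 : StrongDual ℝ V) C).ultrafilter_le_nhds
    (l.map fun p => StrongDual.toWeakDual (ξs p))
    (le_principal_iff.2 (Ultrafilter.mem_map.2
      (Filter.univ_mem' fun p => by simpa using hC _ (hξc p))))
  have heval : ∀ v, Tendsto (fun p => ξs p v) l (𝓝 (WeakDual.toStrongDual ξ v)) := fun v =>
    ((WeakDual.eval_continuous v).tendsto ξ).comp hξ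
  have hmem := hS.neg_mem_subdiff_of_tendsto he (fun p : B => p.2.1.1) (fun p : B => p.2.1.2)
    hξs (fun p => hC _ (hξc p)) ((continuous_fst.tendsto _).comp hlim)
    ((continuous_snd.tendsto _).comp hlim) heval
  have hdist : S.stableDist (WeakDual.toStrongDual ξ) ≤ ENNReal.ofReal c :=
    (hS.stableDist_le_ofReal_iff hc).2 fun v => le_of_tendsto' (heval v) fun p =>
      (hS.stableDist_le_ofReal_iff hc).1 (hξc p) v
  exact iInf₂_le_of_le _ hmem hdist

lemma lowerSemicontinuousOn_instability (hS : S.Standing) {e : ℝ} (he : 0 < e) :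
    LowerSemicontinuousOn (fun p : ℝ × V => S.instability p.1 p.2)
      (Icc 0 S.T ×ˢ S.sublevel e) := by
  intro p _ y hy
  obtain ⟨c, hc, hyc, hcp⟩ := ENNReal.lt_iff_exists_real_btwn.1 hy
  by_contra hcon
  refine hcp.not_ge (hS.instability_le_of_mem_closure he hc (mem_closure_iff_frequently.2 ?_))
  have hfreq := frequently_nhdsWithin_iff.1 (not_eventually.1 hcon)
  exact hfreq.mono fun q hq => ⟨hq.2, (not_lt.1 hq.1).trans_lt hyc⟩

lemma lowerSemicontinuousOn_instability_comp (hS : S.Standing) {e t a b : ℝ} (he : 0 < e)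
    (ht : t ∈ Icc 0 S.T) {ϑ : ℝ → V} (hϑ : ContinuousOn ϑ (Icc a b))
    (hϑe : ∀ r ∈ Icc a b, ϑ r ∈ S.sublevel e) :
    LowerSemicontinuousOn (fun r => S.instability t (ϑ r)) (Icc a b) :=
  (hS.lowerSemicontinuousOn_instability he).comp (g := fun r => (t, ϑ r))
    (continuousOn_const.prodMk hϑ) fun r hr => ⟨ht, hϑe r hr⟩

end Standing

end RISystem

lemma exists_isLeast_hitting {ρ : ℝ → ℝ} {a b l : ℝ} (hρ : ContinuousOn ρ (Icc a b))
    (ha : ρ a ≤ l) (hl : ∃ s ∈ Icc a b, l ≤ ρ s) :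
    ∃ p, IsLeast {s ∈ Icc a b | l ≤ ρ s} p ∧ ρ p = l := by
  obtain ⟨s, hs, hls⟩ := hl
  have hclosed : IsClosed (Icc a b ∩ ρ ⁻¹' Ici l) :=
    hρ.preimage_isClosed_of_isClosed isClosed_Icc isClosed_Ici
  obtain ⟨p, hp⟩ := (isCompact_Icc.of_isClosed_subset hclosed inter_subset_left).exists_isLeast
    ⟨s, hs, hls⟩
  obtain ⟨q, hq, hql⟩ := intermediate_value_Icc hp.1.1.1
    (hρ.mono (Icc_subset_Icc_right hp.1.1.2)) ⟨ha, hp.1.2⟩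
  have hpq : p ≤ q := hp.2 ⟨⟨hq.1, hq.2.trans hp.1.1.2⟩, hql.ge⟩
  exact ⟨p, hp, hq.2.antisymm hpq ▸ hql⟩

lemma exists_antitone_dyadic_hitting {ρ : ℝ → ℝ} {a b R : ℝ} (hρ : ContinuousOn ρ (Icc a b))
    (ha : ρ a = 0) (hR : 0 ≤ R) (hRρ : ∃ s ∈ Icc a b, R ≤ ρ s) :
    ∃ P : ℕ → ℝ, Antitone P ∧ ∀ k, P k ∈ Icc a b ∧ ρ (P k) = R / 2 ^ k ∧
      ∀ s ∈ Icc a (P k), ρ s ≤ R / 2 ^ k := by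
  obtain ⟨s, hs, hRs⟩ := hRρ
  have hhalf : ∀ k : ℕ, R / 2 ^ (k + 1) ≤ R / 2 ^ k := fun k =>
    div_le_div_of_nonneg_left hR (by positivity) (pow_le_pow_right₀ one_le_two k.le_succ)
  choose P hP hPR using fun k : ℕ => exists_isLeast_hitting (l := R / 2 ^ k) hρ
    (by rw [ha]; positivity)
    ⟨s, hs, (div_le_self hR (one_le_pow₀ one_le_two)).trans hRs⟩
  refine ⟨P, antitone_nat_of_succ_le fun k => (hP (k + 1)).2 ⟨(hP k).1.1, ?_⟩, fun k =>
    ⟨(hP k).1.1, hPR k, fun r hr => ?_⟩⟩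
  · rw [hPR k]
    exact hhalf k
  · by_contra! hcon
    have hPr := (hP k).2 ⟨⟨hr.1, hr.2.trans (hP k).1.1.2⟩, hcon.le⟩
    exact hcon.ne' (hr.2.antisymm hPr ▸ hPR k)

lemma deriv_eq_zero_of_forall_norm_sub_le {V : Type*} [NormedAddCommGroup V] [NormedSpace ℝ V]
    {u : ℝ → V} {A : ℝ → ℝ} {m s : ℝ} (hA : HasDerivAt A m s)
    (h : ∀ c, 0 ≤ c → ∀ᶠ y in 𝓝[>] s, c * ‖u y - u s‖ ≤ A y - A s) : deriv u s = 0 := by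
  by_contra hne
  have hn : 0 < ‖deriv u s‖ := norm_pos_iff.2 hne
  have hu := (differentiableAt_of_deriv_ne_zero hne).hasDerivAt
  have hright : 𝓝[>] s ≤ 𝓝[≠] s := nhdsWithin_mono s fun _ hy => ne_of_gt hy
  have hrate : ∀ c, 0 ≤ c → c * ‖deriv u s‖ ≤ m := fun c hc => by
    refine le_of_tendsto_of_tendsto ((hu.tendsto_slope.mono_left hright).norm.const_mul c)
      (hA.tendsto_slope.mono_left hright) ?_
    filter_upwards [h c hc, self_mem_nhdsWithin] with y hy (hsy : s < y)
    have hpos := sub_pos.2 hsy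
    rw [slope_def_field, slope_def_module, norm_smul, norm_inv, Real.norm_of_nonneg hpos.le,
      le_div_iff₀ hpos]
    calc c * ((y - s)⁻¹ * ‖u y - u s‖) * (y - s) = c * ‖u y - u s‖ := by field_simp
      _ ≤ A y - A s := hy
  have hcon := hrate ((|m| + 1) / ‖deriv u s‖) (by positivity)
  rw [div_mul_cancel₀ _ hn.ne'] at hcon
  linarith [le_abs_self m]

namespace RISystem

variable {V : Type*} [NormedAddCommGroup V] [NormedSpace ℝ V] {S : RISystem V}

namespace Standing

section ChainRule

variable {e t a b W : ℝ} {ω : ℝ × V × V → ℝ} {ϑ : ℝ → V} {A : ℝ → ℝ}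

lemma exists_instability_lt (hS : S.Standing) {p q : ℝ}
    (h : IsMajorant S.Ψ (fun r => S.instability t (ϑ r)) ϑ p q A) (hpq : p ≤ q)
    (hne : ϑ p ≠ ϑ q) :
    ∃ r ∈ Icc p q, S.instability t (ϑ r) < ENNReal.ofReal ((A q - A p) / ‖ϑ q - ϑ p‖) := by
  by_contra! hcon
  have hn : 0 < ‖ϑ q - ϑ p‖ := norm_pos_iff.2 (sub_ne_zero.2 hne.symm)
  have hA : 0 ≤ A q - A p := (hS.psi_nonneg _).trans (h.sub_le le_rfl hpq le_rfl)
  have hmaj := h p q _ le_rfl hpq le_rfl (div_nonneg hA hn.le) hcon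
  rw [div_mul_cancel₀ _ hn.ne'] at hmaj
  linarith [hS.psi_pos _ (sub_ne_zero.2 hne.symm)]

lemma exists_energy_sub_le (hS : S.Standing) (ht : t ∈ Icc 0 S.T) (hω : S.IsModulus e ω)
    (hW : ∀ u ∈ S.sublevel e, ∀ v ∈ S.sublevel e, ω (t, u, v) ≤ W) {p q z M : ℝ}
    (h : IsMajorant S.Ψ (fun r => S.instability t (ϑ r)) ϑ p z A)
    (hϑe : ∀ r ∈ Icc p z, ϑ r ∈ S.sublevel e) (hpq : p ≤ q) (hqz : q ≤ z) (hne : ϑ p ≠ ϑ q)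
    (hM : ∀ r ∈ Icc p q, ‖ϑ z - ϑ r‖ ≤ M * ‖ϑ q - ϑ p‖) :
    ∃ r ∈ Icc p q, S.E t (ϑ r) - S.E t (ϑ z) ≤ (1 + W) * (A z - A r) + M * (A q - A p) := by
  obtain ⟨r, hr, hc⟩ := hS.exists_instability_lt (h.mono le_rfl hqz) hpq hne
  have hn : 0 < ‖ϑ q - ϑ p‖ := norm_pos_iff.2 (sub_ne_zero.2 hne.symm)
  have hc0 := (ENNReal.ofReal_pos.1 (bot_le.trans_lt hc)).le
  have hrz : r ≤ z := hr.2.trans hqz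
  have hre := hϑe r ⟨hr.1, hrz⟩
  have hze := hϑe z ⟨hr.1.trans hrz, le_rfl⟩
  refine ⟨r, hr, (hω.energy_sub_le_of_instability_le hS ht hre hze hc0 hc.le).trans
    (add_le_add (mul_le_mul (add_le_add le_rfl (hW _ hre _ hze)) (h.sub_le hr.1 hrz le_rfl)
      (hS.psi_nonneg _) ?_) ?_)⟩
  · linarith [hω.nonneg (t, ϑ r, ϑ z), hW _ hre _ hze]
  · calc (A q - A p) / ‖ϑ q - ϑ p‖ * ‖ϑ z - ϑ r‖
        ≤ (A q - A p) / ‖ϑ q - ϑ p‖ * (M * ‖ϑ q - ϑ p‖) :=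
          mul_le_mul_of_nonneg_left (hM r hr) hc0
      _ = M * (A q - A p) := by field_simp

/-- The chain `z k` descends to `a` through the times `P k` at which the distance to `ϑ a` is
first `R / 2 ^ k`; on `[P (k + 1), P k]` the mean value of the instability is at most
`2 ^ (k + 1) / R` times the increment of `A`, so the errors are summable. -/
lemma exists_seq_energy_sub_le (hS : S.Standing) (ht : t ∈ Icc 0 S.T) (hω : S.IsModulus e ω)
    (hW : ∀ u ∈ S.sublevel e, ∀ v ∈ S.sublevel e, ω (t, u, v) ≤ W)
    (h : IsMajorant S.Ψ (fun r => S.instability t (ϑ r)) ϑ a b A)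
    (hϑe : ∀ r ∈ Icc a b, ϑ r ∈ S.sublevel e) {P : ℕ → ℝ} {R : ℝ} (hR : 0 < R)
    (hPanti : Antitone P) (hP : ∀ k, P k ∈ Icc a b ∧ ‖ϑ (P k) - ϑ a‖ = R / 2 ^ k ∧
      ∀ s ∈ Icc a (P k), ‖ϑ s - ϑ a‖ ≤ R / 2 ^ k) (hb : ‖ϑ b - ϑ a‖ ≤ R) (k : ℕ) :
    ∃ z ∈ Icc (P k) b, ‖ϑ z - ϑ a‖ ≤ 2 * (R / 2 ^ k) ∧
      S.E t (ϑ z) - S.E t (ϑ b) ≤ (1 + W) * (A b - A z) + 6 * (A b - A (P k)) := by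
  induction k with
  | zero =>
    have hA : A (P 0) ≤ A b := h.monotoneOn hS.psi_nonneg (hP 0).1
      ⟨(hP 0).1.1.trans (hP 0).1.2, le_rfl⟩ (hP 0).1.2
    refine ⟨b, ⟨(hP 0).1.2, le_rfl⟩, by rw [pow_zero, div_one]; linarith, ?_⟩
    linarith
  | succ k ih =>
    obtain ⟨z, hz, hρz, hEz⟩ := ih
    have hRk : R / 2 ^ k = 2 * (R / 2 ^ (k + 1)) := by rw [pow_succ]; field_simp
    have hRpos : 0 < R / 2 ^ (k + 1) := by positivity
    have hfar : R / 2 ^ (k + 1) ≤ ‖ϑ (P k) - ϑ (P (k + 1))‖ := by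
      have := norm_sub_norm_le (ϑ (P k) - ϑ a) (ϑ (P (k + 1)) - ϑ a)
      rw [sub_sub_sub_cancel_right, (hP k).2.1, (hP (k + 1)).2.1] at this
      linarith
    have hnear : ∀ r ∈ Icc (P (k + 1)) (P k), ‖ϑ r - ϑ a‖ ≤ 2 * (R / 2 ^ (k + 1)) := fun r hr =>
      hRk ▸ (hP k).2.2 r ⟨(hP (k + 1)).1.1.trans hr.1, hr.2⟩
    obtain ⟨r, hr, hEr⟩ := hS.exists_energy_sub_le ht hω hW (M := 6)
      (h.mono (hP (k + 1)).1.1 hz.2) (fun s hs => hϑe s ⟨(hP (k + 1)).1.1.trans hs.1,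
        hs.2.trans hz.2⟩) (hPanti k.le_succ) hz.1
      (fun heq => by rw [heq, sub_self, norm_zero] at hfar; linarith) fun r hr => by
        have := norm_sub_le (ϑ z - ϑ a) (ϑ r - ϑ a)
        rw [sub_sub_sub_cancel_right] at this
        linarith [hnear r hr]
    exact ⟨r, ⟨hr.1, hr.2.trans (hz.1.trans hz.2)⟩, hnear r hr, by linarith⟩

lemma energy_sub_le_mul (hS : S.Standing) (ht : t ∈ Icc 0 S.T) (hω : S.IsModulus e ω)
    (hW : ∀ u ∈ S.sublevel e, ∀ v ∈ S.sublevel e, ω (t, u, v) ≤ W) (hab : a ≤ b)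
    (hϑ : ContinuousOn ϑ (Icc a b)) (hϑe : ∀ r ∈ Icc a b, ϑ r ∈ S.sublevel e)
    (h : IsMajorant S.Ψ (fun r => S.instability t (ϑ r)) ϑ a b A) :
    S.E t (ϑ a) - S.E t (ϑ b) ≤ (7 + W) * (A b - A a) := by
  have haI : a ∈ Icc a b := left_mem_Icc.2 hab
  have hbI : b ∈ Icc a b := right_mem_Icc.2 hab
  have hAmono := h.monotoneOn hS.psi_nonneg
  have hW0 : 0 ≤ W := (hω.nonneg _).trans (hW _ (hϑe a haI) _ (hϑe b hbI))
  have hρ : ContinuousOn (fun s => ‖ϑ s - ϑ a‖) (Icc a b) := (hϑ.sub continuousOn_const).norm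
  obtain ⟨s, hs, hmax⟩ := isCompact_Icc.exists_isMaxOn ⟨a, haI⟩ hρ
  have hb : ‖ϑ b - ϑ a‖ ≤ ‖ϑ s - ϑ a‖ := hmax hbI
  rcases (norm_nonneg (ϑ s - ϑ a)).eq_or_lt with hR | hR
  · rw [← hR, norm_le_zero_iff, sub_eq_zero] at hb
    rw [hb, sub_self]
    exact mul_nonneg (by linarith) (sub_nonneg.2 (hAmono haI hbI hab))
  obtain ⟨P, hPanti, hP⟩ := exists_antitone_dyadic_hitting hρ (by simp) hR.le ⟨s, hs, le_rfl⟩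
  choose z hz hρz hEz using
    hS.exists_seq_energy_sub_le ht hω hW h hϑe hR hPanti hP hb
  have hzI : ∀ k, z k ∈ Icc a b := fun k => ⟨(hP k).1.1.trans (hz k).1, (hz k).2⟩
  have hlim : Tendsto (fun k => ϑ (z k)) atTop (𝓝[S.D] (ϑ a)) := by
    refine tendsto_nhdsWithin_iff.2 ⟨tendsto_iff_norm_sub_tendsto_zero.2
      (squeeze_zero (fun k => norm_nonneg _) hρz ?_),
      Eventually.of_forall fun k => (hϑe _ (hzI k)).1⟩
    simpa using ((tendsto_const_nhds (x := ‖ϑ s - ϑ a‖)).div_atTop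
      (tendsto_pow_atTop_atTop_of_one_lt (one_lt_two (α := ℝ)))).const_mul 2
  refine le_of_forall_pos_le_add fun δ hδ => ?_
  obtain ⟨k, hk⟩ := (hlim.eventually (hS.lowerSemicontinuousOn_E ht _ (hϑe a haI).1
    (S.E t (ϑ a) - δ) (by linarith))).exists
  have hAz := mul_le_mul_of_nonneg_left (hAmono haI (hzI k) (hzI k).1) (by linarith : 0 ≤ 1 + W)
  linarith [hEz k, hAmono haI (hP k).1 (hP k).1.1]

lemma eventually_energy_sub_le (hS : S.Standing) (he : 0 < e) (ht : t ∈ Icc 0 S.T)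
    (hϑ : ContinuousOn ϑ (Icc a b)) (hϑe : ∀ r ∈ Icc a b, ϑ r ∈ S.sublevel e)
    (h : IsMajorant S.Ψ (fun r => S.instability t (ϑ r)) ϑ a b A) {s θ : ℝ} (hs : s ∈ Ico a b)
    (hfin : S.instability t (ϑ s) ≠ ⊤) (hθ : 1 < θ) :
    ∀ᶠ y in 𝓝[>] s, S.E t (ϑ s) - S.E t (ϑ y) ≤ θ * (A y - A s) := by
  obtain ⟨ω, hω⟩ := hS.exists_isModulus he
  have hsI := Ico_subset_Icc_self hs
  set i := (S.instability t (ϑ s)).toReal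
  have hi : 0 ≤ i := ENNReal.toReal_nonneg
  have hval : S.instability t (ϑ s) = ENNReal.ofReal i := (ENNReal.ofReal_toReal hfin).symm
  have hrate : i / θ = 0 ∨ ENNReal.ofReal (i / θ) < S.instability t (ϑ s) := by
    rcases hi.eq_or_lt with hi | hi
    · exact Or.inl (by rw [← hi, zero_div])
    · exact Or.inr (hval ▸ (ENNReal.ofReal_lt_ofReal_iff hi).2 (div_lt_self hi hθ))
  have hright : ∀ᶠ y in 𝓝[>] s, y ∈ Icc a b := by
    filter_upwards [Ioc_mem_nhdsGT hs.2] with y hy using ⟨hs.1.trans hy.1.le, hy.2⟩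
  have hmodulus : ∀ᶠ y in 𝓝[>] s, ω (t, ϑ s, ϑ y) < θ - 1 := by
    refine (tendsto_nhdsWithin_iff.2 ⟨?_, hright.mono fun y hy => hϑe y hy⟩).eventually
      (hω.eventually_lt ht (hϑe s hsI) (sub_pos.2 hθ))
    exact (hϑ s hsI).mono_left (le_inf (nhdsWithin_le_nhds) (le_principal_iff.2 hright))
  filter_upwards [hright, hmodulus, h.eventually_sub_le
    (hS.lowerSemicontinuousOn_instability_comp he ht hϑ hϑe) hs (by positivity) hrate]
    with y hy hωy hA
  calc S.E t (ϑ s) - S.E t (ϑ y)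
      ≤ (1 + ω (t, ϑ s, ϑ y)) * S.Ψ (ϑ y - ϑ s) + i * ‖ϑ y - ϑ s‖ :=
        hω.energy_sub_le_of_instability_le hS ht (hϑe s hsI) (hϑe y hy) hi hval.le
    _ ≤ θ * S.Ψ (ϑ y - ϑ s) + i * ‖ϑ y - ϑ s‖ := by
        have := mul_le_mul_of_nonneg_right (by linarith : 1 + ω (t, ϑ s, ϑ y) ≤ θ)
          (hS.psi_nonneg (ϑ y - ϑ s))
        linarith
    _ = θ * (S.Ψ (ϑ y - ϑ s) + i / θ * ‖ϑ y - ϑ s‖) := by field_simp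
    _ ≤ θ * (A y - A s) := mul_le_mul_of_nonneg_left hA (by linarith)

lemma costDensity_eq_zero_of_instability_eq_top (hS : S.Standing) (he : 0 < e)
    (ht : t ∈ Icc 0 S.T) (hϑ : ContinuousOn ϑ (Icc 0 1))
    (hϑe : ∀ r ∈ Icc (0 : ℝ) 1, ϑ r ∈ S.sublevel e)
    (h : IsMajorant S.Ψ (fun r => S.instability t (ϑ r)) ϑ 0 1 A) {s m : ℝ}
    (hs : s ∈ Ico (0 : ℝ) 1) (hA : HasDerivAt A m s) (htop : S.instability t (ϑ s) = ⊤) :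
    S.costDensity t ϑ s = 0 := by
  have hderiv : deriv ϑ s = 0 := deriv_eq_zero_of_forall_norm_sub_le hA fun c hc => by
    filter_upwards [h.eventually_sub_le (hS.lowerSemicontinuousOn_instability_comp he ht hϑ hϑe)
      hs hc (Or.inr (htop ▸ ENNReal.ofReal_lt_top))] with y hy
    linarith [hS.psi_nonneg (ϑ y - ϑ s)]
  rw [costDensity, if_pos ⟨Ico_subset_Icc_self hs, htop ▸ ENNReal.zero_lt_top⟩, finsler,
    if_pos hderiv]

lemma neg_deriv_energy_le (hS : S.Standing) (he : 0 < e) (ht : t ∈ Icc 0 S.T)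
    (hϑ : ContinuousOn ϑ (Icc 0 1)) (hϑe : ∀ r ∈ Icc (0 : ℝ) 1, ϑ r ∈ S.sublevel e)
    (h : IsMajorant S.Ψ (fun r => S.instability t (ϑ r)) ϑ 0 1 A) {s E' m : ℝ}
    (hs : s ∈ Ioo (0 : ℝ) 1) (hE : HasDerivAt (fun r => S.E t (ϑ r)) E' s)
    (hA : HasDerivAt A m s) (hm0 : 0 ≤ m) (hm : ENNReal.ofReal m ≤ S.costDensity t ϑ s) :
    -E' ≤ m := by
  have hs' := Ioo_subset_Ico_self hs
  have hle : ∀ K : ℝ, (∀ᶠ y in 𝓝[>] s, S.E t (ϑ s) - S.E t (ϑ y) ≤ K * (A y - A s)) →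
      -E' ≤ K * m := fun K hK =>
    deriv_le_of_eventually_sub_le hE.neg (hA.const_mul K) (hK.mono fun y hy => by
      simp only [Pi.neg_apply]
      linarith)
  by_cases hfin : S.instability t (ϑ s) = ⊤
  · have hm' : m = 0 := hm0.antisymm' (ENNReal.ofReal_eq_zero.1 (le_antisymm
      (hm.trans_eq (hS.costDensity_eq_zero_of_instability_eq_top he ht hϑ hϑe h hs' hA hfin))
      bot_le))
    obtain ⟨ω, hω⟩ := hS.exists_isModulus he
    obtain ⟨W, hW⟩ := hω.exists_le hS he ht
    refine (hle (7 + W) ?_).trans_eq (by rw [hm', mul_zero])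
    filter_upwards [Ioc_mem_nhdsGT hs.2] with y hy
    have hsub : Icc s y ⊆ Icc 0 1 := Icc_subset_Icc hs.1.le hy.2
    exact hS.energy_sub_le_mul ht hω hW hy.1.le (hϑ.mono hsub) (fun r hr => hϑe r (hsub hr))
      (h.mono hs.1.le hy.2)
  · have hlimit : Tendsto (fun θ => θ * m) (𝓝[>] 1) (𝓝 (1 * m)) :=
      (Continuous.tendsto (by fun_prop) 1).mono_left nhdsWithin_le_nhds
    refine ge_of_tendsto (one_mul m ▸ hlimit) ?_
    filter_upwards [self_mem_nhdsWithin] with θ hθ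
      using hle θ (hS.eventually_energy_sub_le he ht hϑ hϑe h hs' hfin hθ)

lemma energy_sub_le_integral (hS : S.Standing) (he : 0 < e) (ht : t ∈ Icc 0 S.T)
    (hϑ : ContinuousOn ϑ (Icc 0 1)) (hϑe : ∀ r ∈ Icc (0 : ℝ) 1, ϑ r ∈ S.sublevel e) {m : ℝ → ℝ}
    (hm0 : ∀ r, 0 ≤ m r) (hmi : Integrable m)
    (hmle : ∀ r, ENNReal.ofReal (m r) ≤ S.costDensity t ϑ r)
    (h : IsMajorant S.Ψ (fun r => S.instability t (ϑ r)) ϑ 0 1 fun x => ∫ r in 0..x, m r)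
    (ha : a ∈ Icc (0 : ℝ) 1) : S.E t (ϑ a) - S.E t (ϑ 1) ≤ ∫ r in a..1, m r := by
  obtain ⟨ω, hω⟩ := hS.exists_isModulus he
  obtain ⟨W, hW⟩ := hω.exists_le hS he ht
  have hrough : ∀ x y, a ≤ x → x ≤ y → y ≤ 1 →
      S.E t (ϑ x) - S.E t (ϑ y) ≤ ∫ r in x..y, (7 + W) * m r := fun x y hx hxy hy => by
    have hx0 := ha.1.trans hx
    have hsub : Icc x y ⊆ Icc 0 1 := Icc_subset_Icc hx0 hy
    rw [intervalIntegral.integral_const_mul,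
      ← integral_sub_integral_left hmi.intervalIntegrable hx0 hxy hy]
    exact hS.energy_sub_le_mul ht hω hW hxy (hϑ.mono hsub) (fun r hr => hϑe r (hsub hr))
      (h.mono hx0 hy)
  have hmi' : IntervalIntegrable (fun r => (7 + W) * m r) volume a 1 :=
    (hmi.const_mul _).intervalIntegrable
  have hderiv : ∀ᵐ s ∂volume.restrict (Ioo a 1),
      ENNReal.ofReal (-deriv (fun r => S.E t (ϑ r)) s) ≤ ENNReal.ofReal (m s) := by
    filter_upwards [ae_hasDerivAt_of_sub_le_integral ha.2 hmi' hrough,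
      ae_restrict_of_ae (hmi.intervalIntegrable (a := 0) (b := 1)).ae_hasDerivAt_integral,
      ae_restrict_mem measurableSet_Ioo] with s hE hA hs
    have hs' : s ∈ Ioo (0 : ℝ) 1 := ⟨ha.1.trans_lt hs.1, hs.2⟩
    refine ENNReal.ofReal_le_ofReal (hS.neg_deriv_energy_le he ht hϑ hϑe h hs'
      hE.differentiableAt.hasDerivAt ?_ (hm0 s) (hmle s))
    exact hA (uIcc_of_le (zero_le_one' ℝ) ▸ Ioo_subset_Icc_self hs') 0 left_mem_uIcc
  have hle := (ofReal_sub_le_lintegral_neg_deriv ha.2 hmi' hrough).trans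
    (lintegral_mono_ae hderiv)
  rw [← ofReal_integral_eq_lintegral_ofReal hmi.integrableOn (Eventually.of_forall hm0),
    ← integral_Ioc_eq_integral_Ioo, ← intervalIntegral.integral_of_le ha.2] at hle
  exact (ENNReal.ofReal_le_ofReal_iff
    (intervalIntegral.integral_nonneg ha.2 fun r _ => hm0 r)).1 hle

end ChainRule

end Standing

end RISystem

section Curves

variable {V : Type*} [NormedAddCommGroup V] [NormedSpace ℝ V] {N : V → ℝ}

lemma IsGauge.apply_deriv_le (hN : IsGauge N) (hcont : Continuous N) {u : ℝ → V} {r C : ℝ}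
    (h : ∀ᶠ y in 𝓝[>] r, N (u y - u r) ≤ C * (y - r)) : N (deriv u r) ≤ C := by
  have hslope : ∀ᶠ y in 𝓝[>] r, N (slope u r y) ≤ C := by
    filter_upwards [h, self_mem_nhdsWithin] with y hy (hry : r < y)
    have hpos := sub_pos.2 hry
    rwa [slope_def_module, hN.smul_eq _ _ (inv_nonneg.2 hpos.le), inv_mul_le_iff₀ hpos, mul_comm]
  by_cases hd : DifferentiableAt ℝ u r
  · exact le_of_tendsto ((hcont.tendsto _).comp (hd.hasDerivAt.tendsto_slope.mono_left
      (nhdsGT_le_nhdsNE r))) hslope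
  · obtain ⟨y, hy⟩ := hslope.exists
    rw [deriv_zero_of_not_differentiableAt hd, hN.map_zero]
    exact (hN.nonneg _).trans hy

lemma IsGauge.apply_difference_quotient_le (hN : IsGauge N) {u : ℝ → V} {a b C : ℝ}
    (h : ∀ p q, a ≤ p → p ≤ q → q ≤ b → N (u q - u p) ≤ C * (q - p)) {r y : ℝ}
    (hr : r ∈ Icc a b) (hry : r + y ∈ Icc a b) (hy : y ≠ 0) :
    N (y⁻¹ • (u (r + y) - u r)) ≤ C := by
  rcases hy.lt_or_gt with hneg | hpos
  · have hpos : 0 < -y := neg_pos.2 hneg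
    have hflip : y⁻¹ • (u (r + y) - u r) = (-y)⁻¹ • (u r - u (r + y)) := by
      rw [inv_neg, neg_smul, ← smul_neg, neg_sub]
    rw [hflip, hN.smul_eq _ _ (inv_nonneg.2 hpos.le), inv_mul_le_iff₀ hpos]
    linarith [h (r + y) r hry.1 (by linarith) hr.2]
  · rw [hN.smul_eq _ _ (inv_nonneg.2 hpos.le), inv_mul_le_iff₀ hpos]
    linarith [h r (r + y) hr.1 (by linarith) hry.2]

/-- The two uniform bounds control `w` through `N`, and on a compact set `N` controls the norm. -/
lemma IsGauge.exists_dist_lt (hN : IsGauge N) (hcont : Continuous N)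
    (hpos : ∀ v, v ≠ 0 → 0 < N v) {K : Set V} (hK : IsCompact K) {δ C : ℝ} (hδ : 0 < δ)
    (hC : 0 ≤ C) :
    ∃ ρ > 0, ∃ σ > 0, ∀ (a b : ℝ) (w η : ℝ → V), (∀ r ∈ Icc a b, w r ∈ K) →
      (∀ r ∈ Icc a b, ‖w r - η r‖ ≤ σ) →
      (∀ p q, a ≤ p → p ≤ q → q ≤ b → N (η q - η p) ≤ C * (q - p)) →
      ∀ p ∈ Icc a b, ∀ q ∈ Icc a b, dist p q < ρ → dist (w p) (w q) < δ := by
  obtain ⟨L, hL, hNL⟩ := hN.exists_le_mul_norm hcont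
  obtain ⟨μ, hμ, hmod⟩ := exists_norm_sub_lt_of_isCompact hcont hpos hK hδ
  refine ⟨μ / (3 * (C + 1)), by positivity, μ / (3 * L), by positivity,
    fun a b w η hwK hwη hη => ?_⟩
  have hsmall : ∀ v : V, ‖v‖ ≤ μ / (3 * L) → N v ≤ μ / 3 := fun v hv =>
    calc N v ≤ L * ‖v‖ := hNL v
      _ ≤ L * (μ / (3 * L)) := by gcongr
      _ = μ / 3 := by field_simp
  have hordered : ∀ p ∈ Icc a b, ∀ q ∈ Icc a b, p ≤ q → dist p q < μ / (3 * (C + 1)) →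
      dist (w p) (w q) < δ := by
    intro p hp q hq hpq hdist
    rw [dist_comm, Real.dist_eq, abs_of_nonneg (sub_nonneg.2 hpq), lt_div_iff₀ (by positivity)]
      at hdist
    rw [dist_comm, dist_eq_norm]
    refine hmod _ (hwK p hp) _ (hwK q hq) ?_
    have hq' := hsmall _ (hwη q hq)
    have hp' := hsmall (η p - w p) (by rw [norm_sub_rev]; exact hwη p hp)
    nlinarith [hη p q hp.1 hpq hq.2, hN.sub_le (w q) (η q) (w p), hN.sub_le (η q) (η p) (w p)]
  intro p hp q hq hdist
  rcases le_total p q with hpq | hpq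
  · exact hordered p hp q hq hpq hdist
  · rw [dist_comm]
    exact hordered q hq p hp hpq (by rwa [dist_comm])

lemma IsGauge.exists_subseq_tendstoUniformlyOn (hN : IsGauge N) (hcont : Continuous N)
    (hpos : ∀ v, v ≠ 0 → 0 < N v) {K : Set V} (hK : IsCompact K) {a b C : ℝ} (hC : 0 ≤ C)
    {w η : ℕ → ℝ → V} (hwK : ∀ n, ∀ r ∈ Icc a b, w n r ∈ K)
    (hwη : ∀ δ > 0, ∀ᶠ n in atTop, ∀ r ∈ Icc a b, ‖w n r - η n r‖ ≤ δ)
    (hη : ∀ n p q, a ≤ p → p ≤ q → q ≤ b → N (η n q - η n p) ≤ C * (q - p)) :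
    ∃ (φ : ℕ → ℕ) (ϑ : ℝ → V), StrictMono φ ∧ (∀ r ∈ Icc a b, ϑ r ∈ K) ∧
      TendstoUniformlyOn (fun n => w (φ n)) ϑ atTop (Icc a b) ∧
      TendstoUniformlyOn (fun n => η (φ n)) ϑ atTop (Icc a b) := by
  obtain ⟨φ, ϑ, hφ, hϑK, hunif⟩ := _root_.exists_subseq_tendstoUniformlyOn hK
    (isCompact_Icc (a := a) (b := b)).totallyBounded hwK fun δ hδ => by
      obtain ⟨ρ, hρ, σ, hσ, hdist⟩ := hN.exists_dist_lt hcont hpos hK hδ hC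
      exact ⟨ρ, hρ, (hwη σ hσ).mono fun n hn => hdist a b _ _ (hwK n) hn (hη n)⟩
  refine ⟨φ, ϑ, hφ, hϑK, hunif, Metric.tendstoUniformlyOn_iff.2 fun δ hδ => ?_⟩
  filter_upwards [Metric.tendstoUniformlyOn_iff.1 hunif (δ / 2) (half_pos hδ),
    hφ.tendsto_atTop.eventually (hwη (δ / 3) (by positivity))] with n hϑw hwη' r hr
  have hclose := hwη' r hr
  rw [← dist_eq_norm] at hclose
  linarith [hϑw r hr, dist_triangle (ϑ r) (w (φ n) r) (η (φ n) r)]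

end Curves

namespace RISystem

variable {V : Type*} [NormedAddCommGroup V] [NormedSpace ℝ V] {S : RISystem V} {t : ℝ}
  {u₀ u₁ : V} {ϑ : ℝ → V}

namespace IsTransition

lemma continuousOn (h : S.IsTransition t u₀ u₁ ϑ) (hS : S.Standing) :
    ContinuousOn ϑ (Icc 0 1) := by
  obtain ⟨e, he, hϑe⟩ := h.exists_sublevel
  obtain ⟨A, hA, hϑA⟩ := h.gaugeAC.exists_continuousOn_sub_le
  exact continuousOn_of_gauge_sub_le hS.psi_continuous hS.psi_pos (hS.E_coercive e he) hϑe hA hϑA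

lemma mem_interior_unstableTimes (h : S.IsTransition t u₀ u₁ ϑ) (hS : S.Standing)
    (ht : t ∈ Icc 0 S.T) {r : ℝ} (hr : r ∈ Ioo (0 : ℝ) 1) (hrG : r ∈ S.unstableTimes t ϑ) :
    r ∈ interior (S.unstableTimes t ϑ) := by
  obtain ⟨e, he, hϑe⟩ := h.exists_sublevel
  have hpos := hS.lowerSemicontinuousOn_instability_comp he ht (h.continuousOn hS) hϑe r hrG.1 0
    hrG.2
  rw [nhdsWithin_eq_nhds.2 (Icc_mem_nhds hr.1 hr.2)] at hpos
  rw [mem_interior_iff_mem_nhds]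
  filter_upwards [Icc_mem_nhds hr.1 hr.2, hpos] with s hs hsi using ⟨hs, hsi⟩

lemma ae_differentiableAt (h : S.IsTransition t u₀ u₁ ϑ) (hV : RadonNikodymProperty V)
    (hS : S.Standing) (ht : t ∈ Icc 0 S.T) :
    ∀ᵐ r, r ∈ Ioo (0 : ℝ) 1 → r ∈ S.unstableTimes t ϑ → DifferentiableAt ℝ ϑ r := by
  filter_upwards [h.normACLoc.ae_differentiableAt hV] with r hr hr01 hrG
    using hr (h.mem_interior_unstableTimes hS ht hr01 hrG)

lemma ae_metricDeriv_le_costDensity (h : S.IsTransition t u₀ u₁ ϑ) (hV : RadonNikodymProperty V)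
    (hS : S.Standing) (ht : t ∈ Icc 0 S.T) :
    ∀ᵐ r, r ∈ Ioo (0 : ℝ) 1 → metricDeriv S.Ψ ϑ r ≤ S.costDensity t ϑ r := by
  filter_upwards [h.ae_differentiableAt hV hS ht] with r hr hr01
  by_cases hrG : r ∈ S.unstableTimes t ϑ
  · rw [costDensity, if_pos hrG, metricDeriv_of_differentiableAt hS.psi_continuous (hr hr01 hrG)]
    simpa using hS.le_finsler (t := t) (u := ϑ r) le_rfl (by simp) (deriv ϑ r)
  · rw [costDensity, if_neg hrG]

lemma ofReal_gauge_sub_le_lintegral_costDensity (h : S.IsTransition t u₀ u₁ ϑ)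
    (hV : RadonNikodymProperty V) (hS : S.Standing) (ht : t ∈ Icc 0 S.T) {p q c : ℝ}
    (hp : 0 ≤ p) (hpq : p ≤ q) (hq : q ≤ 1) (hc : 0 ≤ c)
    (hlow : ∀ r ∈ Icc p q, ENNReal.ofReal c ≤ S.instability t (ϑ r)) :
    ENNReal.ofReal (S.Ψ (ϑ q - ϑ p) + c * ‖ϑ q - ϑ p‖) ≤
      ∫⁻ r in Ioo p q, S.costDensity t ϑ r := by
  have hsub : Ioo p q ⊆ Ioo 0 1 := Ioo_subset_Ioo hp hq
  rcases hc.eq_or_lt with rfl | hcpos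
  · rw [zero_mul, add_zero]
    refine (hS.isGauge.ofReal_sub_le_lintegral_metricDeriv hpq
      (h.gaugeAC.mono hp hq zero_le_one fun v => (one_mul (S.Ψ v)).ge)).trans
      (setLIntegral_mono_ae' measurableSet_Ioo ?_)
    filter_upwards [h.ae_metricDeriv_le_costDensity hV hS ht] with r hr hrI using hr (hsub hrI)
  · have hG : Icc p q ⊆ S.unstableTimes t ϑ := fun r hr =>
      ⟨⟨hp.trans hr.1, hr.2.trans hq⟩, (ENNReal.ofReal_pos.2 hcpos).trans_le (hlow r hr)⟩
    have hd : ∀ᵐ r ∂volume.restrict (Ioo p q), DifferentiableAt ℝ ϑ r :=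
      (ae_restrict_iff' measurableSet_Ioo).2 ((h.ae_differentiableAt hV hS ht).mono
        fun r hr hrI => hr (hsub hrI) (hG (Ioo_subset_Icc_self hrI)))
    have hΨ := hS.psi_continuous
    refine ((hS.isGauge.add_mul_norm hc).ofReal_sub_le_lintegral_deriv (by fun_prop) hpq
      (h.normACLoc p q hpq hG) hd).trans (setLIntegral_mono' measurableSet_Ioo fun r hr => ?_)
    have hrI := Ioo_subset_Icc_self hr
    rw [costDensity, if_pos (hG hrI)]
    exact hS.le_finsler hc (hlow r hrI) _

lemma exists_isMajorant (h : S.IsTransition t u₀ u₁ ϑ) (hV : RadonNikodymProperty V)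
    (hS : S.Standing) (ht : t ∈ Icc 0 S.T) (hfin : S.curveCost t ϑ ≠ ⊤) :
    ∃ m : ℝ → ℝ, (∀ r, 0 ≤ m r) ∧ Integrable m ∧
      (∀ r, ENNReal.ofReal (m r) ≤ S.costDensity t ϑ r) ∧
      IsMajorant S.Ψ (fun r => S.instability t (ϑ r)) ϑ 0 1 fun x => ∫ r in (0 : ℝ)..x, m r :=
  IsMajorant.exists_of_le_lintegral hfin fun _ _ _ hp hpq hq hc hlow =>
    h.ofReal_gauge_sub_le_lintegral_costDensity hV hS ht hp hpq hq hc hlow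

lemma ofReal_energy_sub_le_curveCost (h : S.IsTransition t u₀ u₁ ϑ) (hV : RadonNikodymProperty V)
    (hS : S.Standing) (ht : t ∈ Icc 0 S.T) :
    ENNReal.ofReal (S.E t u₀ - S.E t u₁) ≤ S.curveCost t ϑ := by
  by_cases hfin : S.curveCost t ϑ = ⊤
  · exact hfin ▸ le_top
  obtain ⟨m, hm0, hmi, hmle, hm⟩ := h.exists_isMajorant hV hS ht hfin
  obtain ⟨e, he, hϑe⟩ := h.exists_sublevel
  have henergy := hS.energy_sub_le_integral he ht (h.continuousOn hS) hϑe hm0 hmi hmle hm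
    (left_mem_Icc.2 zero_le_one)
  rw [h.left_end, h.right_end] at henergy
  have hint : ∫ r in (0 : ℝ)..1, m r ≤ (S.curveCost t ϑ).toReal :=
    integral_le_of_lintegral_le_ofReal zero_le_one hm0 hmi hmle ENNReal.toReal_nonneg
      (ENNReal.ofReal_toReal hfin).ge
  exact ENNReal.ofReal_le_of_le_toReal (henergy.trans hint)

end IsTransition

namespace Standing

/-- The chain rule bounds the energy along `ϑ` by its value at the right end, and the gauge part of
the cost bounds `Ψ` along `ϑ` by its value at the left end. -/
lemma exists_forall_mem_sublevel (hS : S.Standing) (hV : RadonNikodymProperty V)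
    (ht : t ∈ Icc 0 S.T) {e : ℝ} (he : 0 < e) {B : ℝ} (hB : 0 ≤ B) :
    ∃ e' > 0, ∀ u₀ ∈ S.sublevel e, ∀ u₁ ∈ S.sublevel e, ∀ ϑ, S.IsTransition t u₀ u₁ ϑ →
      S.curveCost t ϑ ≤ ENNReal.ofReal B → ∀ r ∈ Icc (0 : ℝ) 1, ϑ r ∈ S.sublevel e' := by
  obtain ⟨P, hP⟩ := (hS.E_coercive e he).bddAbove_image hS.psi_continuous.continuousOn
  obtain ⟨e', he', hlevel⟩ := hS.exists_mem_sublevel (P + B + (e + B))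
  refine ⟨e', he', fun u₀ hu₀ u₁ hu₁ ϑ hϑ hcost r hr => ?_⟩
  obtain ⟨m, hm0, hmi, hmle, hm⟩ := hϑ.exists_isMajorant hV hS ht
    (ne_top_of_le_ne_top ENNReal.ofReal_ne_top hcost)
  obtain ⟨e₁, he₁, hϑe⟩ := hϑ.exists_sublevel
  have hint : ∫ x in (0 : ℝ)..1, m x ≤ B :=
    integral_le_of_lintegral_le_ofReal zero_le_one hm0 hmi hmle hB hcost
  have hsplit := intervalIntegral.integral_add_adjacent_intervals (hmi.intervalIntegrable (a := 0))
    (hmi.intervalIntegrable (a := r) (b := 1))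
  have hleft := intervalIntegral.integral_nonneg (μ := volume) hr.1 fun x _ => hm0 x
  have hright := intervalIntegral.integral_nonneg (μ := volume) hr.2 fun x _ => hm0 x
  have hΨ : S.Ψ (ϑ r) ≤ P + B := by
    have hdist := hm.sub_le le_rfl hr.1 hr.2
    rw [hϑ.left_end, intervalIntegral.integral_same, sub_zero] at hdist
    have hsum := hS.isGauge.add_le (ϑ r - u₀) u₀
    rw [sub_add_cancel] at hsum
    have hΨ₀ : S.Ψ u₀ ≤ P := hP (mem_image_of_mem _ hu₀)
    linarith
  have hE : S.E t (ϑ r) ≤ e + B := by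
    have henergy := hS.energy_sub_le_integral he₁ ht (hϑ.continuousOn hS) hϑe hm0 hmi hmle hm hr
    rw [hϑ.right_end] at henergy
    linarith [hu₁.2 t ht, hS.psi_nonneg u₁]
  exact hlevel t ht _ (hϑe r hr).1 (by linarith)

section LinearMajorant

variable {e C : ℝ}

lemma continuousOn_of_isMajorant (hS : S.Standing) (he : 0 < e)
    (hϑe : ∀ r ∈ Icc (0 : ℝ) 1, ϑ r ∈ S.sublevel e) {i : ℝ → ℝ≥0∞}
    (h : IsMajorant S.Ψ i ϑ 0 1 fun x => C * x) : ContinuousOn ϑ (Icc 0 1) :=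
  continuousOn_of_gauge_sub_le hS.psi_continuous hS.psi_pos (hS.E_coercive e he) hϑe
    (by fun_prop) fun _ _ => h.sub_le

lemma nonneg_of_isMajorant (hS : S.Standing) {i : ℝ → ℝ≥0∞}
    (h : IsMajorant S.Ψ i ϑ 0 1 fun x => C * x) : 0 ≤ C := by
  simpa using (hS.psi_nonneg _).trans (h.sub_le le_rfl zero_le_one le_rfl)

lemma normACLoc_of_isMajorant (hS : S.Standing) (he : 0 < e) (ht : t ∈ Icc 0 S.T)
    (hϑe : ∀ r ∈ Icc (0 : ℝ) 1, ϑ r ∈ S.sublevel e)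
    (h : IsMajorant S.Ψ (fun r => S.instability t (ϑ r)) ϑ 0 1 fun x => C * x) :
    NormACLoc ϑ (S.unstableTimes t ϑ) := by
  intro a b hab hG
  have hsub : Icc a b ⊆ Icc 0 1 := fun r hr => (hG hr).1
  obtain ⟨r₀, hr₀, hmin⟩ := ((hS.lowerSemicontinuousOn_instability_comp he ht
    (hS.continuousOn_of_isMajorant he hϑe h) hϑe).mono hsub).exists_isMinOn
    (nonempty_Icc.2 hab) isCompact_Icc
  obtain ⟨c, hc0, hc⟩ := ENNReal.lt_iff_exists_nnreal_btwn.1 (hG hr₀).2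
  have hcpos : (0 : ℝ) < c := by exact_mod_cast hc0
  refine gaugeAC_of_sub_le_mul (L := C / c) (div_nonneg (hS.nonneg_of_isMajorant h) hcpos.le)
    fun p q hp hpq hq => ?_
  have hlow : ∀ r ∈ Icc p q, ENNReal.ofReal c ≤ S.instability t (ϑ r) := fun r hr => by
    rw [ENNReal.ofReal_coe_nnreal]
    exact hc.le.trans (hmin ⟨hp.trans hr.1, hr.2.trans hq⟩)
  have hle := h p q c (hsub ⟨hp, hpq.trans hq⟩).1 hpq (hsub ⟨hp.trans hpq, hq⟩).2 hcpos.le hlow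
  rw [div_mul_eq_mul_div, le_div_iff₀ hcpos]
  linarith [hS.psi_nonneg (ϑ q - ϑ p)]

lemma isTransition_of_isMajorant (hS : S.Standing) (he : 0 < e) (ht : t ∈ Icc 0 S.T)
    (hϑe : ∀ r ∈ Icc (0 : ℝ) 1, ϑ r ∈ S.sublevel e)
    (h : IsMajorant S.Ψ (fun r => S.instability t (ϑ r)) ϑ 0 1 fun x => C * x) :
    S.IsTransition t (ϑ 0) (ϑ 1) ϑ where
  exists_sublevel := ⟨e, he, hϑe⟩
  gaugeAC := gaugeAC_of_sub_le_mul (hS.nonneg_of_isMajorant h) fun p q hp hpq hq => by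
    linarith [h.sub_le hp hpq hq]
  normACLoc := hS.normACLoc_of_isMajorant he ht hϑe h
  left_end := rfl
  right_end := rfl

lemma curveCost_le_of_isMajorant (hS : S.Standing) (he : 0 < e) (ht : t ∈ Icc 0 S.T)
    (hϑe : ∀ r ∈ Icc (0 : ℝ) 1, ϑ r ∈ S.sublevel e)
    (h : IsMajorant S.Ψ (fun r => S.instability t (ϑ r)) ϑ 0 1 fun x => C * x) :
    S.curveCost t ϑ ≤ ENNReal.ofReal C := by
  have hΨ := hS.psi_continuous
  have hlsc := hS.lowerSemicontinuousOn_instability_comp he ht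
    (hS.continuousOn_of_isMajorant he hϑe h) hϑe
  have hderiv : ∀ r ∈ Ioo (0 : ℝ) 1, ∀ c, 0 ≤ c →
      (c = 0 ∨ ENNReal.ofReal c < S.instability t (ϑ r)) →
      S.Ψ (deriv ϑ r) + c * ‖deriv ϑ r‖ ≤ C := fun r hr c hc hci =>
    (hS.isGauge.add_mul_norm hc).apply_deriv_le (by fun_prop) <| by
      simpa only [mul_sub] using h.eventually_sub_le hlsc ⟨hr.1.le, hr.2⟩ hc hci
  have hdensity : ∀ r ∈ Ioo (0 : ℝ) 1, S.costDensity t ϑ r ≤ ENNReal.ofReal C := by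
    intro r hr
    rw [costDensity]
    split_ifs with hrG
    · exact hS.finsler_le_of_forall_lt (by simpa using hderiv r hr 0 le_rfl (Or.inl rfl))
        fun c hc hci => hderiv r hr c hc (Or.inr hci)
    · refine metricDeriv_le ?_
      have hshift : Tendsto (fun y => r + y) (𝓝 0) (𝓝 r) := by
        simpa using (continuous_const_add r).tendsto 0
      filter_upwards [mem_nhdsWithin_of_mem_nhds (hshift (Icc_mem_nhds hr.1 hr.2)),
        self_mem_nhdsWithin] with y hy hy0
      exact hS.isGauge.apply_difference_quotient_le (fun p q hp hpq hq => by
        linarith [h.sub_le hp hpq hq]) (Ioo_subset_Icc_self hr) hy hy0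
  calc S.curveCost t ϑ ≤ ∫⁻ _ in Ioo (0 : ℝ) 1, ENNReal.ofReal C :=
        setLIntegral_mono' measurableSet_Ioo hdensity
    _ = ENNReal.ofReal C := by simp

end LinearMajorant

end Standing

end RISystem

namespace RISystem

variable {V : Type*} [NormedAddCommGroup V] [NormedSpace ℝ V] {S : RISystem V} {t e : ℝ}

lemma Standing.eventually_lt_instability_of_tendstoUniformlyOn (hS : S.Standing) (he : 0 < e)
    (ht : t ∈ Icc 0 S.T) {a b : ℝ} {w : ℕ → ℝ → V} {s : ℕ → ℝ → ℝ} {ϑ : ℝ → V}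
    (hw : ∀ n, ∀ r ∈ Icc a b, w n r ∈ S.sublevel e)
    (hs : ∀ n, ∀ r ∈ Icc a b, s n r ∈ Icc 0 S.T)
    (hwϑ : TendstoUniformlyOn w ϑ atTop (Icc a b))
    (hst : TendstoUniformlyOn s (fun _ => t) atTop (Icc a b))
    (hϑ : ContinuousOn ϑ (Icc a b)) (hϑe : ∀ r ∈ Icc a b, ϑ r ∈ S.sublevel e) {r : ℝ}
    (hr : r ∈ Icc a b) {y : ℝ≥0∞} (hy : y < S.instability t (ϑ r)) :
    ∀ᶠ x in atTop ×ˢ 𝓝[Icc a b] r, y < S.instability (s x.1 x.2) (w x.1 x.2) := by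
  have hfst : Tendsto Prod.fst (atTop ×ˢ 𝓝[Icc a b] r) (atTop : Filter ℕ) := tendsto_fst
  have hw' : Tendsto (fun x : ℕ × ℝ => w x.1 x.2) (atTop ×ˢ 𝓝[Icc a b] r) (𝓝 (ϑ r)) :=
    TendstoUniformlyOn.tendsto_comp (F := fun x : ℕ × ℝ => w x.1)
      (fun u hu => hfst.eventually (hwϑ u hu)) (hϑ r hr) tendsto_snd
  have hs' : Tendsto (fun x : ℕ × ℝ => s x.1 x.2) (atTop ×ˢ 𝓝[Icc a b] r) (𝓝 t) :=
    TendstoUniformlyOn.tendsto_comp (F := fun x : ℕ × ℝ => s x.1)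
      (fun u hu => hfst.eventually (hst u hu)) continuousWithinAt_const tendsto_snd
  have hmem : ∀ᶠ x : ℕ × ℝ in atTop ×ˢ 𝓝[Icc a b] r, x.2 ∈ Icc a b :=
    tendsto_snd.eventually self_mem_nhdsWithin
  refine (tendsto_nhdsWithin_iff.2 ⟨hs'.prodMk_nhds hw', ?_⟩).eventually
    (hS.lowerSemicontinuousOn_instability he (t, ϑ r) ⟨ht, hϑe r hr⟩ y hy)
  filter_upwards [hmem] with x hx using ⟨hs _ _ hx, hw _ _ hx⟩

/-- The state `w n`, at which the instability is evaluated, and the moving curve `η n` differ for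
viscous sequences; only the latter carries the increments. -/
lemma Standing.exists_isTransition_of_isMajorant (hS : S.Standing) (he : 0 < e)
    (ht : t ∈ Icc 0 S.T) {u₀ u₁ : V} {η w : ℕ → ℝ → V} {s : ℕ → ℝ → ℝ} {C : ℕ → ℝ} {C₀ : ℝ}
    (hw : ∀ n, ∀ r ∈ Icc (0 : ℝ) 1, w n r ∈ S.sublevel e)
    (hwη : ∀ δ > 0, ∀ᶠ n in atTop, ∀ r ∈ Icc (0 : ℝ) 1, ‖w n r - η n r‖ ≤ δ)
    (hs : ∀ n, ∀ r ∈ Icc (0 : ℝ) 1, s n r ∈ Icc 0 S.T)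
    (hst : TendstoUniformlyOn s (fun _ => t) atTop (Icc 0 1)) (hC : Tendsto C atTop (𝓝 C₀))
    (hη : ∀ n, IsMajorant S.Ψ (fun r => S.instability (s n r) (w n r)) (η n) 0 1 fun x => C n * x)
    (h₀ : Tendsto (η · 0) atTop (𝓝 u₀)) (h₁ : Tendsto (η · 1) atTop (𝓝 u₁)) :
    ∃ (φ : ℕ → ℕ) (ϑ : ℝ → V), StrictMono φ ∧ S.IsTransition t u₀ u₁ ϑ ∧
      TendstoUniformlyOn (fun n => η (φ n)) ϑ atTop (Icc 0 1) ∧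
      S.curveCost t ϑ ≤ ENNReal.ofReal C₀ := by
  have hgauge := hS.isGauge
  obtain ⟨B, hB⟩ := hC.bddAbove_range
  have hCB : ∀ n, C n ≤ B := fun n => hB (mem_range_self n)
  obtain ⟨φ, ϑ, hφ, hϑe, hwϑ, hηϑ⟩ := hgauge.exists_subseq_tendstoUniformlyOn hS.psi_continuous
    hS.psi_pos (hS.E_coercive e he) ((hS.nonneg_of_isMajorant (hη 0)).trans (hCB 0)) hw hwη
    fun n p q hp hpq hq => by
      nlinarith [(hη n).sub_le hp hpq hq, mul_le_mul_of_nonneg_right (hCB n) (sub_nonneg.2 hpq)]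
  have hφt := hφ.tendsto_atTop
  have hlim : ∀ i : ℝ → ℝ≥0∞, (∀ r ∈ Icc (0 : ℝ) 1, ∀ c, 0 ≤ c → ENNReal.ofReal c < i r →
      ∀ᶠ x in atTop ×ˢ 𝓝 r, x.2 ∈ Icc (0 : ℝ) 1 →
        ENNReal.ofReal c < S.instability (s (φ x.1) x.2) (w (φ x.1) x.2)) →
      IsMajorant S.Ψ i ϑ 0 1 fun x => C₀ * x := fun i hi =>
    IsMajorant.of_tendsto hS.psi_continuous (fun n => hη (φ n)) (fun r hr => hηϑ.tendsto_at hr)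
      (fun r _ => (hC.comp hφt).mul_const r) hi
  have hϑ : ContinuousOn ϑ (Icc 0 1) :=
    hS.continuousOn_of_isMajorant he hϑe (hlim 0 fun r _ c _ hc => by simp at hc)
  have hmaj := hlim (fun r => S.instability t (ϑ r)) fun r hr c _ hc => by
    have hev := hS.eventually_lt_instability_of_tendstoUniformlyOn he ht (fun n => hw (φ n))
      (fun n => hs (φ n)) hwϑ (fun v hv => hφt.eventually (hst v hv)) hϑ hϑe hr hc
    rwa [prod_eq_inf, nhdsWithin, comap_inf, comap_principal, ← inf_assoc, ← prod_eq_inf,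
      eventually_inf_principal] at hev
  have hend₀ := tendsto_nhds_unique (hηϑ.tendsto_at (left_mem_Icc.2 zero_le_one)) (h₀.comp hφt)
  have hend₁ := tendsto_nhds_unique (hηϑ.tendsto_at (right_mem_Icc.2 zero_le_one)) (h₁.comp hφt)
  exact ⟨φ, ϑ, hφ, hend₀ ▸ hend₁ ▸ hS.isTransition_of_isMajorant he ht hϑe hmaj, hηϑ,
    hS.curveCost_le_of_isMajorant he ht hϑe hmaj⟩

end RISystem

namespace RISystem

variable {V : Type*} [NormedAddCommGroup V] [NormedSpace ℝ V] {S : RISystem V} {t e : ℝ} {u₀ u₁ : V}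

lemma IsTransition.exists_isRescaling {ϑ : ℝ → V} (h : S.IsTransition t u₀ u₁ ϑ)
    (hV : RadonNikodymProperty V) (hS : S.Standing) (ht : t ∈ Icc 0 S.T) {C κ : ℝ} (hC : 0 ≤ C)
    (hcost : S.curveCost t ϑ ≤ ENNReal.ofReal C) (hκ : 0 < κ) :
    ∃ τ : ℝ → ℝ, IsRescaling τ 0 1 ∧
      IsMajorant S.Ψ (fun r => S.instability t (ϑ (τ r))) (ϑ ∘ τ) 0 1 fun x => (κ + C) * x := by
  obtain ⟨m, hm0, hmi, hmle, hm⟩ := h.exists_isMajorant hV hS ht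
    (ne_top_of_le_ne_top ENNReal.ofReal_ne_top hcost)
  simpa [Function.comp_def] using hm.exists_isRescaling_of_integral_le hS.psi_nonneg zero_le_one hmi
    (integral_le_of_lintegral_le_ofReal zero_le_one hm0 hmi hmle hC hcost) hκ

section Cost

namespace Standing

lemma exists_isTransition_of_cost_lt (hS : S.Standing) (hV : RadonNikodymProperty V)
    (ht : t ∈ Icc 0 S.T) (he : 0 < e) {v₀ v₁ : ℕ → V} (hv₀ : ∀ n, v₀ n ∈ S.sublevel e)
    (hv₁ : ∀ n, v₁ n ∈ S.sublevel e) (h₀ : Tendsto v₀ atTop (𝓝 u₀))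
    (h₁ : Tendsto v₁ atTop (𝓝 u₁)) {c : ℕ → ℝ} {c₀ : ℝ} (hc : Tendsto c atTop (𝓝 c₀))
    (hcost : ∀ n, S.cost t (v₀ n) (v₁ n) < ENNReal.ofReal (c n)) :
    ∃ ϑ, S.IsTransition t u₀ u₁ ϑ ∧ S.curveCost t ϑ ≤ ENNReal.ofReal c₀ := by
  have hc0 : ∀ n, 0 ≤ c n := fun n => (ENNReal.ofReal_pos.1 (bot_le.trans_lt (hcost n))).le
  simp only [cost, iInf_lt_iff] at hcost
  choose ϑ hϑ hϑc using hcost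
  obtain ⟨B, hB⟩ := hc.bddAbove_range
  have hcB : ∀ n, c n ≤ B := fun n => hB (mem_range_self n)
  obtain ⟨e', he', hlevel⟩ := hS.exists_forall_mem_sublevel hV ht he ((hc0 0).trans (hcB 0))
  choose τ hτ hmaj using fun n : ℕ => (hϑ n).exists_isRescaling hV hS ht (hc0 n) (hϑc n).le
    (Nat.one_div_pos_of_nat : 0 < 1 / ((n : ℝ) + 1))
  obtain ⟨-, ϑ', -, hϑ', -, hle⟩ := hS.exists_isTransition_of_isMajorant he' ht
    (w := fun n => ϑ n ∘ τ n) (η := fun n => ϑ n ∘ τ n) (s := fun _ _ => t)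
    (fun n r hr => hlevel _ (hv₀ n) _ (hv₁ n) _ (hϑ n)
      ((hϑc n).le.trans (ENNReal.ofReal_le_ofReal (hcB n))) _ ((hτ n).mem_Icc hr))
    (fun δ hδ => Eventually.of_forall fun n r _ => by simpa using hδ.le) (fun _ _ _ => ht)
    (tendsto_const_nhds.tendstoUniformlyOn_const _)
    (tendsto_one_div_add_atTop_nhds_zero_nat.add hc) hmaj
    (by simpa [(hτ _).map_zero, (hϑ _).left_end] using h₀)
    (by simpa [(hτ _).map_one, (hϑ _).right_end] using h₁)
  exact ⟨ϑ', hϑ', by simpa using hle⟩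

lemma exists_curveCost_le_liminf_cost (hS : S.Standing) (hV : RadonNikodymProperty V)
    (ht : t ∈ Icc 0 S.T) (he : 0 < e) {v₀ v₁ : ℕ → V} (hv₀ : ∀ n, v₀ n ∈ S.sublevel e)
    (hv₁ : ∀ n, v₁ n ∈ S.sublevel e) (h₀ : Tendsto v₀ atTop (𝓝 u₀))
    (h₁ : Tendsto v₁ atTop (𝓝 u₁)) (hfin : liminf (fun n => S.cost t (v₀ n) (v₁ n)) atTop ≠ ⊤) :
    ∃ ϑ, S.IsTransition t u₀ u₁ ϑ ∧
      S.curveCost t ϑ ≤ liminf (fun n => S.cost t (v₀ n) (v₁ n)) atTop := by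
  obtain ⟨φ, hφ, hlt⟩ := exists_subseq_lt_add_of_liminf_ne_top hfin
  obtain ⟨ϑ, hϑ, hle⟩ := hS.exists_isTransition_of_cost_lt hV ht he (fun n => hv₀ (φ n))
    (fun n => hv₁ (φ n)) (h₀.comp hφ.tendsto_atTop) (h₁.comp hφ.tendsto_atTop)
    (tendsto_const_nhds.add tendsto_one_div_add_atTop_nhds_zero_nat) hlt
  rw [add_zero, ENNReal.ofReal_toReal hfin] at hle
  exact ⟨ϑ, hϑ, hle⟩

theorem exists_curveCost_eq_cost (hS : S.Standing) (hV : RadonNikodymProperty V)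
    (ht : t ∈ Icc 0 S.T) (hfin : S.cost t u₀ u₁ < ⊤) :
    ∃ ϑ, S.IsTransition t u₀ u₁ ϑ ∧ S.curveCost t ϑ = S.cost t u₀ u₁ := by
  obtain ⟨ϑ, hϑ, -⟩ : ∃ ϑ, ∃ _ : S.IsTransition t u₀ u₁ ϑ, S.curveCost t ϑ < ⊤ := by
    simpa only [cost, iInf_lt_iff] using hfin
  obtain ⟨e, he, hϑe⟩ := hϑ.exists_sublevel
  obtain ⟨ϑ', hϑ', hle⟩ := hS.exists_curveCost_le_liminf_cost hV ht he
    (fun _ => hϑ.left_end ▸ hϑe 0 (by simp)) (fun _ => hϑ.right_end ▸ hϑe 1 (by simp))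
    tendsto_const_nhds tendsto_const_nhds (by simpa using hfin.ne)
  rw [liminf_const] at hle
  exact ⟨ϑ', hϑ', hle.antisymm (iInf₂_le ϑ' hϑ')⟩

theorem cost_le_liminf_cost (hS : S.Standing) (hV : RadonNikodymProperty V)
    (ht : t ∈ Icc 0 S.T) (he : 0 < e) {v₀ v₁ : ℕ → V} (hv₀ : ∀ n, v₀ n ∈ S.sublevel e)
    (hv₁ : ∀ n, v₁ n ∈ S.sublevel e) (h₀ : Tendsto v₀ atTop (𝓝 u₀))
    (h₁ : Tendsto v₁ atTop (𝓝 u₁)) :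
    S.cost t u₀ u₁ ≤ liminf (fun n => S.cost t (v₀ n) (v₁ n)) atTop := by
  by_cases hfin : liminf (fun n => S.cost t (v₀ n) (v₁ n)) atTop = ⊤
  · exact hfin ▸ le_top
  obtain ⟨ϑ, hϑ, hle⟩ := hS.exists_curveCost_le_liminf_cost hV ht he hv₀ hv₁ h₀ h₁ hfin
  exact (iInf₂_le ϑ hϑ).trans hle

theorem ofReal_energy_sub_le_cost (hS : S.Standing) (hV : RadonNikodymProperty V)
    (ht : t ∈ Icc 0 S.T) (u₀ u₁ : V) :
    ENNReal.ofReal (S.E t u₀ - S.E t u₁) ≤ S.cost t u₀ u₁ :=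
  le_iInf₂ fun _ hϑ => hϑ.ofReal_energy_sub_le_curveCost hV hS ht

end Standing

end Cost

end RISystem

section Reversal

lemma GaugeAC.comp_one_sub {V : Type*} [AddCommGroup V] {N : V → ℝ} (hN : ∀ v, N (-v) = N v)
    {u : ℝ → V} {a b : ℝ} (hab : a ≤ b) (h : GaugeAC N u (1 - b) (1 - a)) :
    GaugeAC N (fun r => u (1 - r)) a b := by
  obtain ⟨m, hm0, hmi, hm⟩ := h
  refine ⟨fun r => m (1 - r), fun r => hm0 _, ?_, fun p q hp hpq hq => ?_⟩
  · rw [← intervalIntegrable_iff_integrableOn_Icc_of_le (by linarith)] at hmi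
    have hreflect := (hmi.comp_sub_left 1).symm
    rw [sub_sub_cancel, sub_sub_cancel] at hreflect
    exact (intervalIntegrable_iff_integrableOn_Icc_of_le hab).1 hreflect
  · rw [intervalIntegral.integral_comp_sub_left, ← hN, neg_sub]
    exact hm _ _ (by linarith) (by linarith) (by linarith)

lemma metricDeriv_comp_const_sub {V : Type*} [AddCommGroup V] [Module ℝ V] {N : V → ℝ}
    (hN : ∀ v, N (-v) = N v) (u : ℝ → V) (c r : ℝ) :
    metricDeriv N (fun r => u (c - r)) r = metricDeriv N u (c - r) := by
  have hneg : map (fun h : ℝ => -h) (𝓝[≠] (0 : ℝ)) = 𝓝[≠] (0 : ℝ) := by simp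
  conv_rhs => rw [metricDeriv, ← hneg]
  rw [metricDeriv, ← limsup_comp]
  congr 1 with h
  rw [Function.comp_apply, ← hN (h⁻¹ • _), inv_neg, neg_smul, ← sub_eq_add_neg, sub_sub]

namespace RISystem

variable {V : Type*} [NormedAddCommGroup V] [NormedSpace ℝ V] {S : RISystem V} {t : ℝ}

lemma mem_unstableTimes_comp_one_sub {ϑ : ℝ → V} {r : ℝ} :
    r ∈ S.unstableTimes t (fun r => ϑ (1 - r)) ↔ 1 - r ∈ S.unstableTimes t ϑ :=
  and_congr_left' Icc.mem_iff_one_sub_mem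

lemma IsTransition.comp_one_sub (hsymm : ∀ v, S.Ψ (-v) = S.Ψ v) {u₀ u₁ : V} {ϑ : ℝ → V}
    (h : S.IsTransition t u₀ u₁ ϑ) : S.IsTransition t u₁ u₀ (fun r => ϑ (1 - r)) where
  exists_sublevel := by
    obtain ⟨e, he, hϑ⟩ := h.exists_sublevel
    exact ⟨e, he, fun r hr => hϑ _ (Icc.mem_iff_one_sub_mem.1 hr)⟩
  gaugeAC := GaugeAC.comp_one_sub hsymm zero_le_one (by simpa using h.gaugeAC)
  normACLoc a b hab hG := GaugeAC.comp_one_sub norm_neg hab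
    (h.normACLoc _ _ (by linarith) fun r hr => by
      have hr' : 1 - r ∈ Icc a b := ⟨by linarith [hr.2], by linarith [hr.1]⟩
      simpa using mem_unstableTimes_comp_one_sub.1 (hG hr'))
  left_end := by simpa using h.right_end
  right_end := by simpa using h.left_end

lemma finsler_neg (hsymm : ∀ v, S.Ψ (-v) = S.Ψ v) (t : ℝ) (u v : V) :
    S.finsler t u (-v) = S.finsler t u v := by
  by_cases hv : v = 0
  · rw [hv, neg_zero]
  · simp only [finsler, if_neg hv, if_neg (neg_ne_zero.2 hv), contactPotential, viscous, hsymm,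
      smul_neg, norm_neg]

lemma curveCost_comp_one_sub (hsymm : ∀ v, S.Ψ (-v) = S.Ψ v) (t : ℝ) (ϑ : ℝ → V) :
    S.curveCost t (fun r => ϑ (1 - r)) = S.curveCost t ϑ := by
  have hdensity : ∀ r, S.costDensity t (fun r => ϑ (1 - r)) r = S.costDensity t ϑ (1 - r) :=
    fun r => by
      rw [costDensity, costDensity, deriv_comp_const_sub, finsler_neg hsymm,
        metricDeriv_comp_const_sub hsymm]
      classical exact if_congr mem_unstableTimes_comp_one_sub rfl rfl
  have hreflect := (Measure.measurePreserving_sub_left volume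
    (1 : ℝ)).setLIntegral_comp_preimage_emb (MeasurableEquiv.subLeft (1 : ℝ)).measurableEmbedding
    (S.costDensity t ϑ) (Ioo 0 1)
  simpa [curveCost, hdensity] using hreflect

lemma cost_comm (hsymm : ∀ v, S.Ψ (-v) = S.Ψ v) (t : ℝ) (u₀ u₁ : V) :
    S.cost t u₀ u₁ = S.cost t u₁ u₀ := by
  have hle : ∀ v₀ v₁, S.cost t v₀ v₁ ≤ S.cost t v₁ v₀ := fun v₀ v₁ => le_iInf₂ fun ϑ hϑ =>
    (iInf₂_le _ (hϑ.comp_one_sub hsymm)).trans_eq (curveCost_comp_one_sub hsymm t ϑ)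
  exact (hle _ _).antisymm (hle _ _)

theorem Standing.ofReal_abs_energy_sub_le_cost (hS : S.Standing) (hV : RadonNikodymProperty V)
    (hsymm : ∀ v, S.Ψ (-v) = S.Ψ v) (ht : t ∈ Icc 0 S.T) (u₀ u₁ : V) :
    ENNReal.ofReal |S.E t u₀ - S.E t u₁| ≤ S.cost t u₀ u₁ := by
  rw [abs_eq_max_neg, neg_sub, ENNReal.ofReal_max, max_le_iff]
  exact ⟨hS.ofReal_energy_sub_le_cost hV ht u₀ u₁,
    cost_comm hsymm t u₁ u₀ ▸ hS.ofReal_energy_sub_le_cost hV ht u₁ u₀⟩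

end RISystem

end Reversal

namespace RISystem

variable {V : Type*} [NormedAddCommGroup V] [NormedSpace ℝ V] {S : RISystem V}

namespace Standing

section ViscousCurve

variable {ε α β : ℝ} {u w : ℝ → V} {ξ : ℝ → V →L[ℝ] ℝ}

lemma ofReal_gauge_sub_le_viscousDissipation (hS : S.Standing) (hV : RadonNikodymProperty V)
    (hε : 0 < ε) (hu : NormAC u α β)
    (hξ : ∀ᵐ r ∂volume.restrict (Ioo α β), -ξ r ∈ S.subdiff r (w r)) {p q c : ℝ} (hp : α ≤ p)
    (hpq : p ≤ q) (hq : q ≤ β) (hc : 0 ≤ c)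
    (hlow : ∀ r ∈ Icc p q, ENNReal.ofReal c ≤ S.instability r (w r)) :
    ENNReal.ofReal (S.Ψ (u q - u p) + c * ‖u q - u p‖) ≤ S.viscousDissipation ε p q u ξ := by
  have hpqu : NormAC u p q := hu.mono hp hq zero_le_one fun v => (one_mul ‖v‖).ge
  have hΨ := hS.psi_continuous
  refine ((hS.isGauge.add_mul_norm hc).ofReal_sub_le_lintegral_deriv (by fun_prop) hpq hpqu
    (hV u p q hpqu)).trans (lintegral_mono_ae ?_)
  filter_upwards [ae_mono (Measure.restrict_mono (Ioo_subset_Ioo hp hq) le_rfl) hξ,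
    ae_restrict_mem measurableSet_Ioo] with r hξr hr
  have hdist : ENNReal.ofReal c ≤ S.stableDist (ξ r) :=
    (hlow r (Ioo_subset_Icc_self hr)).trans (iInf₂_le (ξ r) hξr)
  rw [ENNReal.ofReal_add (hS.psi_nonneg _) (by positivity), ENNReal.ofReal_mul hc]
  exact (by gcongr : _ ≤ _).trans (hS.le_viscous_add_viscousConj hε (deriv u r) (ξ r))

lemma exists_isRescaling_of_viscousDissipation_le (hS : S.Standing) (hV : RadonNikodymProperty V)
    (hε : 0 < ε) (hαβ : α ≤ β) (hu : NormAC u α β)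
    (hξ : ∀ᵐ r ∂volume.restrict (Ioo α β), -ξ r ∈ S.subdiff r (w r)) {C κ : ℝ} (hC : 0 ≤ C)
    (hdiss : S.viscousDissipation ε α β u ξ ≤ ENNReal.ofReal C) (hκ : 0 < κ) :
    ∃ τ : ℝ → ℝ, IsRescaling τ α β ∧
      IsMajorant S.Ψ (fun r => S.instability (τ r) (w (τ r))) (u ∘ τ) 0 1
        fun x => (κ * (β - α) + C) * x := by
  obtain ⟨m, hm0, hmi, hmle, hm⟩ := IsMajorant.exists_of_le_lintegral
    (i := fun r => S.instability r (w r)) (ne_top_of_le_ne_top ENNReal.ofReal_ne_top hdiss)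
    fun p q c hp hpq hq hc hlow =>
      hS.ofReal_gauge_sub_le_viscousDissipation hV hε hu hξ hp hpq hq hc hlow
  exact hm.exists_isRescaling_of_integral_le hS.psi_nonneg hαβ hmi
    (integral_le_of_lintegral_le_ofReal hαβ hm0 hmi hmle hC hdiss) hκ

end ViscousCurve

end Standing

namespace IsConcentrating

variable {e t : ℝ} {u₀ u₁ : V} {α β : ℕ → ℝ} {u w : ℕ → ℝ → V} {ξ : ℕ → ℝ → V →L[ℝ] ℝ}
  {ε : ℕ → ℝ}

lemma comp (h : S.IsConcentrating e t u₀ u₁ α β u w ξ ε) {φ : ℕ → ℕ} (hφ : StrictMono φ) :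
    S.IsConcentrating e t u₀ u₁ (α ∘ φ) (β ∘ φ) (u ∘ φ) (w ∘ φ) (ξ ∘ φ) (ε ∘ φ) where
  interval _ := h.interval _
  u_ac _ := h.u_ac _
  w_mem _ := h.w_mem _
  w_meas _ := h.w_meas _
  xi_integrable _ := h.xi_integrable _
  eps_pos _ := h.eps_pos _
  eps_tendsto := h.eps_tendsto.comp hφ.tendsto_atTop
  close δ hδ := hφ.tendsto_atTop.eventually (h.close δ hδ)
  xi_mem _ := h.xi_mem _
  u_left := h.u_left.comp hφ.tendsto_atTop
  u_right := h.u_right.comp hφ.tendsto_atTop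
  alpha_tendsto := h.alpha_tendsto.comp hφ.tendsto_atTop
  beta_tendsto := h.beta_tendsto.comp hφ.tendsto_atTop

lemma tendstoUniformlyOn_of_mem_Icc (h : S.IsConcentrating e t u₀ u₁ α β u w ξ ε)
    {τ : ℕ → ℝ → ℝ} {K : Set ℝ} (hτ : ∀ n, ∀ r ∈ K, τ n r ∈ Icc (α n) (β n)) :
    TendstoUniformlyOn τ (fun _ => t) atTop K := by
  refine Metric.tendstoUniformlyOn_iff.2 fun δ hδ => ?_
  filter_upwards [Metric.tendsto_nhds.1 h.alpha_tendsto δ hδ,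
    Metric.tendsto_nhds.1 h.beta_tendsto δ hδ] with n hα hβ r hr
  rw [dist_comm]
  exact Metric.mem_ball.1 ((convex_ball t δ).ordConnected.out hα hβ (hτ n r hr))

lemma exists_isTransition_of_viscousDissipation_le (h : S.IsConcentrating e t u₀ u₁ α β u w ξ ε)
    (hV : RadonNikodymProperty V) (hS : S.Standing) (ht : t ∈ Icc 0 S.T) (he : 0 < e) {c : ℕ → ℝ}
    {c₀ : ℝ} (hc0 : ∀ n, 0 ≤ c n) (hc : Tendsto c atTop (𝓝 c₀))
    (hdiss : ∀ n, S.viscousDissipation (ε n) (α n) (β n) (u n) (ξ n) ≤ ENNReal.ofReal (c n)) :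
    ∃ (k : ℕ → ℕ) (τ : ℕ → ℝ → ℝ) (ϑ : ℝ → V), StrictMono k ∧
      (∀ j, IsRescaling (τ j) (α (k j)) (β (k j))) ∧ S.IsTransition t u₀ u₁ ϑ ∧
      TendstoUniformlyOn (fun j r => u (k j) (τ j r)) ϑ atTop (Icc 0 1) ∧
      S.curveCost t ϑ ≤ ENNReal.ofReal c₀ := by
  choose τ hτ hmaj using fun n => hS.exists_isRescaling_of_viscousDissipation_le hV (h.eps_pos n)
    (h.interval n).2.1 (h.u_ac n) (h.xi_mem n) (hc0 n) (hdiss n) one_pos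
  have hτI : ∀ n, ∀ r ∈ Icc (0 : ℝ) 1, τ n r ∈ Icc (α n) (β n) := fun n r hr => (hτ n).mem_Icc hr
  have hC : Tendsto (fun n => 1 * (β n - α n) + c n) atTop (𝓝 c₀) := by
    simpa using (h.beta_tendsto.sub h.alpha_tendsto).add hc
  obtain ⟨k, ϑ, hk, hϑ, hunif, hle⟩ := hS.exists_isTransition_of_isMajorant he ht
    (w := fun n => w n ∘ τ n) (η := fun n => u n ∘ τ n)
    (fun n r hr => h.w_mem n _ (hτI n r hr))
    (fun δ hδ => (h.close δ hδ).mono fun n hn r hr => hn _ (hτI n r hr))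
    (fun n r hr => Icc_subset_Icc (h.interval n).1 (h.interval n).2.2 (hτI n r hr))
    (h.tendstoUniformlyOn_of_mem_Icc hτI) hC hmaj
    (by simpa [(hτ _).map_zero] using h.u_left) (by simpa [(hτ _).map_one] using h.u_right)
  exact ⟨k, fun j => τ (k j), ϑ, hk, fun j => hτ (k j), hϑ, hunif, hle⟩

theorem exists_isTransition_of_tendsto (h : S.IsConcentrating e t u₀ u₁ α β u w ξ ε)
    (hV : RadonNikodymProperty V) (hS : S.Standing) (ht : t ∈ Icc 0 S.T) (he : 0 < e) {Δ : ℝ≥0∞}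
    (hΔ : Δ < ⊤)
    (hlim : Tendsto (fun n => S.viscousDissipation (ε n) (α n) (β n) (u n) (ξ n)) atTop (𝓝 Δ)) :
    ∃ (k : ℕ → ℕ) (τ : ℕ → ℝ → ℝ) (ϑ : ℝ → V), StrictMono k ∧
      (∀ j, IsRescaling (τ j) (α (k j)) (β (k j))) ∧ S.IsTransition t u₀ u₁ ϑ ∧
      TendstoUniformlyOn (fun j r => u (k j) (τ j r)) ϑ atTop (Icc 0 1) ∧
      S.curveCost t ϑ ≤ Δ := by
  obtain ⟨N, hN⟩ := eventually_atTop.1 (hlim.eventually_lt_const hΔ)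
  have hshift : StrictMono (· + N) := strictMono_id.add_const N
  obtain ⟨k, τ, ϑ, hk, hτ, hϑ, hunif, hle⟩ :=
    (h.comp hshift).exists_isTransition_of_viscousDissipation_le hV hS ht he
      (fun n => ENNReal.toReal_nonneg)
      ((ENNReal.tendsto_toReal hΔ.ne).comp (hlim.comp hshift.tendsto_atTop))
      (fun n => (ENNReal.ofReal_toReal (hN (n + N) (Nat.le_add_left _ _)).ne).ge)
  rw [ENNReal.ofReal_toReal hΔ.ne] at hle
  exact ⟨fun j => k j + N, τ, ϑ, hshift.comp hk, hτ, hϑ, hunif, hle⟩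

theorem cost_le_liminf_viscousDissipation (h : S.IsConcentrating e t u₀ u₁ α β u w ξ ε)
    (hV : RadonNikodymProperty V) (hS : S.Standing) (ht : t ∈ Icc 0 S.T) (he : 0 < e) :
    S.cost t u₀ u₁ ≤
      liminf (fun n => S.viscousDissipation (ε n) (α n) (β n) (u n) (ξ n)) atTop := by
  by_cases hfin : liminf (fun n => S.viscousDissipation (ε n) (α n) (β n) (u n) (ξ n)) atTop = ⊤
  · exact hfin ▸ le_top
  obtain ⟨φ, hφ, hlt⟩ := exists_subseq_lt_add_of_liminf_ne_top hfin
  obtain ⟨-, -, ϑ, -, -, hϑ, -, hle⟩ :=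
    (h.comp hφ).exists_isTransition_of_viscousDissipation_le hV hS ht he (fun n => by positivity)
      (tendsto_const_nhds.add tendsto_one_div_add_atTop_nhds_zero_nat) fun n => (hlt n).le
  rw [add_zero, ENNReal.ofReal_toReal hfin] at hle
  exact (iInf₂_le ϑ hϑ).trans hle

end IsConcentrating

end RISystem

theorem mainTheorem7_general {V : Type*} [NormedAddCommGroup V] [NormedSpace ℝ V]
    (hV : RadonNikodymProperty V) (S : RISystem V) (hS : S.Standing)
    (t : ℝ) (ht : t ∈ Icc (0 : ℝ) S.T) (e : ℝ) (he : 0 < e) (um up : V) :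
    ((S.cost t um up < ⊤ →
        ∃ ϑ : ℝ → V, S.IsTransition t um up ϑ ∧ S.curveCost t ϑ = S.cost t um up) ∧
      ENNReal.ofReal (S.E t um - S.E t up) ≤ S.cost t um up ∧
      ((∀ v : V, S.Ψ (-v) = S.Ψ v) →
        ENNReal.ofReal |S.E t um - S.E t up| ≤ S.cost t um up)) ∧
    (∀ u₀ u₁ : ℕ → V, (∀ n, u₀ n ∈ S.sublevel e) → (∀ n, u₁ n ∈ S.sublevel e) →
      Tendsto u₀ atTop (𝓝 um) → Tendsto u₁ atTop (𝓝 up) →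
        S.cost t um up ≤ liminf (fun n => S.cost t (u₀ n) (u₁ n)) atTop) ∧
    (∀ (α β : ℕ → ℝ) (u w : ℕ → ℝ → V) (ξ : ℕ → ℝ → V →L[ℝ] ℝ) (ε : ℕ → ℝ),
      S.IsConcentrating e t um up α β u w ξ ε →
        (∀ Δ : ℝ≥0∞, Δ < ⊤ →
          Tendsto (fun n => S.viscousDissipation (ε n) (α n) (β n) (u n) (ξ n)) atTop (𝓝 Δ) →
          ∃ (k : ℕ → ℕ) (τ : ℕ → ℝ → ℝ) (ϑ : ℝ → V),
            StrictMono k ∧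
            (∀ j, IsRescaling (τ j) (α (k j)) (β (k j))) ∧
            S.IsTransition t um up ϑ ∧
            TendstoUniformlyOn (fun j r => u (k j) (τ j r)) ϑ atTop (Icc 0 1) ∧
            S.curveCost t ϑ ≤ Δ) ∧
        S.cost t um up ≤
          liminf (fun n => S.viscousDissipation (ε n) (α n) (β n) (u n) (ξ n)) atTop) := by
  refine ⟨⟨?attained, ?energy, ?symmetric⟩, ?lsc, fun α β u w ξ ε hconc => ⟨?compactness, ?liminf⟩⟩
  case attained => exact hS.exists_curveCost_eq_cost hV ht
  case energy => exact hS.ofReal_energy_sub_le_cost hV ht um up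
  case symmetric => exact fun hsymm => hS.ofReal_abs_energy_sub_le_cost hV hsymm ht um up
  case lsc => exact fun u₀ u₁ hu₀ hu₁ h₀ h₁ => hS.cost_le_liminf_cost hV ht he hu₀ hu₁ h₀ h₁
  case compactness =>
    exact fun Δ hΔ hlim => hconc.exists_isTransition_of_tendsto hV hS ht he hΔ hlim
  case liminf => exact hconc.cost_le_liminf_viscousDissipation hV hS ht he

theorem mainTheorem7 {V : Type*} [NormedAddCommGroup V] [NormedSpace ℝ V] [CompleteSpace V]
    [TopologicalSpace.SeparableSpace V] (hV : RadonNikodymProperty V)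
    (S : RISystem V) (hS : S.Standing)
    (t : ℝ) (ht : t ∈ Icc (0 : ℝ) S.T) (e : ℝ) (he : 0 < e)
    (um up : V) (hum : um ∈ S.sublevel e) (hup : up ∈ S.sublevel e) :
    -- (F1)
    ((S.cost t um up < ⊤ →
        ∃ ϑ : ℝ → V, S.IsTransition t um up ϑ ∧ S.curveCost t ϑ = S.cost t um up) ∧
      ENNReal.ofReal (S.E t um - S.E t up) ≤ S.cost t um up ∧
      ((∀ v : V, S.Ψ (-v) = S.Ψ v) →
        ENNReal.ofReal |S.E t um - S.E t up| ≤ S.cost t um up)) ∧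
    -- (F2)
    (∀ u₀ u₁ : ℕ → V, (∀ n, u₀ n ∈ S.sublevel e) → (∀ n, u₁ n ∈ S.sublevel e) →
      Tendsto u₀ atTop (𝓝 um) → Tendsto u₁ atTop (𝓝 up) →
        S.cost t um up ≤ liminf (fun n => S.cost t (u₀ n) (u₁ n)) atTop) ∧
    -- (F3)
    (∀ (α β : ℕ → ℝ) (u w : ℕ → ℝ → V) (ξ : ℕ → ℝ → V →L[ℝ] ℝ) (ε : ℕ → ℝ),
      S.IsConcentrating e t um up α β u w ξ ε →
        (∀ Δ : ℝ≥0∞, Δ < ⊤ →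
          Tendsto (fun n => S.viscousDissipation (ε n) (α n) (β n) (u n) (ξ n)) atTop (𝓝 Δ) →
          ∃ (k : ℕ → ℕ) (τ : ℕ → ℝ → ℝ) (ϑ : ℝ → V),
            StrictMono k ∧
            (∀ j, NormAC (τ j) 0 1 ∧ τ j '' Icc 0 1 = Icc (α (k j)) (β (k j)) ∧
              MonotoneOn (τ j) (Icc 0 1) ∧
              (α (k j) < β (k j) → StrictMonoOn (τ j) (Icc 0 1))) ∧
            S.IsTransition t um up ϑ ∧
            TendstoUniformlyOn (fun j r => u (k j) (τ j r)) ϑ atTop (Icc 0 1) ∧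
            S.curveCost t ϑ ≤ Δ) ∧
        S.cost t um up ≤
          liminf (fun n => S.viscousDissipation (ε n) (α n) (β n) (u n) (ξ n)) atTop) :=
  mainTheorem7_general hV S hS t ht e he um up
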